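/- **Theorem.** For points $x_1,\dots,x_n\in\mathbb{R}^d$ and an integer $k\ge 0$, a clustering is a partition of the $n$ points into $k$ labelled (possibly empty) clusters $C_1,\dots,C_k$. Its $\ell_2^2$ min-sum cost is $\sum_{i=1}^k\sum_{p,q\in C_i}\|x_p-x_q\|_2^2$, and $\mathsf{OPT}$ is the minimum cost over all clusterings. A labeling of the points by $1,\dots,k$, with label classes $P_1,\dots,P_k$, comes from a *label predictor with error rate* $\alpha$ if there is an optimal clustering $P_1^*,\dots,P_k^*$ such that $$|P_i\cap P_i^*|\ \ge\ (1-\alpha)\max(|P_i|,|P_i^*|)\qquad\text{for all } i\in\{1,\dots,k\}.$$ There is a deterministic algorithm which, given $n$ points with rational coordinates in $\mathbb{R}^d$, the number $k$ and a labeling of the points by $1,\dots,k$ (but not $\alpha$), always halts with a clustering $Q_1,\dots,Q_k$ of the points, in time polynomial in $n$, $d$, $k$ and the total bit length of the coordinates (time is measured on a random access machine that charges each operation the bit lengths of the integers involved), and which has the following guarantee. For every real $\alpha\in[0,\frac12)$ such that the labeling comes from a label predictor with error rate $\alpha$, $$\sum_{i=1}^k\sum_{p,q\in Q_i}\|x_p-x_q\|_2^2\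 \le\ \frac{1+\gamma\alpha}{(1-\alpha)^2}\cdot\mathsf{OPT},$$ both with $\gamma=7.7$ if $\alpha<\frac17$, and with $\gamma=\dfrac{5-2\alpha}{(1-2\alpha)(1-\alpha)}$ for all $\alpha\in[0,\frac12)$ (so that in this case $\gamma\alpha=\dfrac{5\alpha-2\alpha^2}{(1-2\alpha)(1-\alpha)}$). -/

import Mathlib

open Finset

/-! ### Min-sum clustering and label predictors -/

namespace MinSum

/-- The cluster with index `i` of the clustering `C`; a clustering of `n` points into `k`
(possibly empty) clusters is the function that sends each point to the index of its cluster. -/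
def cluster {n k : ℕ} (C : Fin n → Fin k) (i : Fin k) : Finset (Fin n) :=
  univ.filter fun p => C p = i

/-- The `ℓ₂²` min-sum cost of a clustering `C` of the points `x`. -/
noncomputable def cost {n d k : ℕ} (x : Fin n → EuclideanSpace ℝ (Fin d)) (C : Fin n → Fin k) : ℝ :=
  ∑ i : Fin k, ∑ p ∈ cluster C i, ∑ q ∈ cluster C i, ‖x p - x q‖ ^ 2

/-- The optimal `ℓ₂²` min-sum `k`-clustering cost (a minimum over a finite set). -/
noncomputable def opt {n d : ℕ} (k : ℕ) (x : Fin n → EuclideanSpace ℝ (Fin d)) : ℝ :=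
  ⨅ C : Fin n → Fin k, cost x C

/-- `P` is the labeling given by a label predictor with error rate `α`: for some fixed optimal
clustering, every label class has precision and recall at least `1 - α`. -/
def IsLabelPredictor {n d k : ℕ} (x : Fin n → EuclideanSpace ℝ (Fin d)) (P : Fin n → Fin k)
    (α : ℝ) : Prop :=
  ∃ S : Fin n → Fin k, (∀ C : Fin n → Fin k, cost x S ≤ cost x C) ∧
    ∀ i : Fin k, (1 - α) * max ((cluster P i).card : ℝ) ((cluster S i).card : ℝ) ≤
      ((cluster P i ∩ cluster S i).card : ℝ)

/-- The points of `ℝ^d` with the given rational coordinates. -/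
noncomputable def toPoints {n d : ℕ} (x : Fin n → Fin d → ℚ) : Fin n → EuclideanSpace ℝ (Fin d) :=
  fun p => WithLp.toLp 2 fun j => (x p j : ℝ)

end MinSum

/-! ### A random access machine with logarithmic (bit-length) cost

The memory consists of tables of integers, indexed by pairs of integers; a program names finitely
many of them.  Every value that is read, computed or used as an index is charged its bit length,
so the cost of a run is, up to a polynomial, its running time on a Turing machine. -/

namespace LogRAM

/-- Bit length of an integer, with one bit for the sign; always at least `1`. -/
def bitLen (z : ℤ) : ℕ := z.natAbs.size + 1

/-- Memory contents: `m a i j` is the entry of the table `a` in row `i` and column `j`. -/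
abbrev Mem := ℕ → ℤ → ℤ → ℤ

inductive Expr where
  | const (z : ℤ)
  | get (a : ℕ) (i j : Expr)
  | add (e f : Expr)
  | sub (e f : Expr)
  | mul (e f : Expr)
  | div (e f : Expr)

/-- Value of an expression; `div` is integer division (with value `0` for the divisor `0`). -/
def Expr.eval (m : Mem) : Expr → ℤ
  | .const z => z
  | .get a i j => m a (i.eval m) (j.eval m)
  | .add e f => e.eval m + f.eval m
  | .sub e f => e.eval m - f.eval m
  | .mul e f => e.eval m * f.eval m
  | .div e f => e.eval m / f.eval m

/-- Cost of evaluating an expression: the sum of the bit lengths of the values of all its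
subexpressions (itself included). -/
def Expr.cost (m : Mem) : Expr → ℕ
  | .const z => bitLen z
  | .get a i j => i.cost m + j.cost m + bitLen (m a (i.eval m) (j.eval m))
  | .add e f => e.cost m + f.cost m + bitLen (e.eval m + f.eval m)
  | .sub e f => e.cost m + f.cost m + bitLen (e.eval m - f.eval m)
  | .mul e f => e.cost m + f.cost m + bitLen (e.eval m * f.eval m)
  | .div e f => e.cost m + f.cost m + bitLen (e.eval m / f.eval m)

/-- Programs: `set a i j e` is the assignment `a[i, j] := e`; `cond e c c'` runs `c` if `0 < e`
and `c'` otherwise; `loop e c` runs `c` as long as `0 < e`. -/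
inductive Prog where
  | skip
  | set (a : ℕ) (i j e : Expr)
  | seq (c c' : Prog)
  | cond (e : Expr) (c c' : Prog)
  | loop (e : Expr) (c : Prog)

/-- The memory after writing `v` to row `i`, column `j` of the table `a`. -/
def Mem.write (m : Mem) (a : ℕ) (i j v : ℤ) : Mem :=
  fun b r s => if b = a ∧ r = i ∧ s = j then v else m b r s

/-- `Runs c m m' t`: started with memory `m`, the program `c` halts with memory `m'` after a run
of cost `t`. -/
inductive Runs : Prog → Mem → Mem → ℕ → Prop where
  | skip (m : Mem) : Runs .skip m m 1
  | set (a : ℕ) (i j e : Expr) (m : Mem) :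
      Runs (.set a i j e) m (m.write a (i.eval m) (j.eval m) (e.eval m))
        (i.cost m + j.cost m + e.cost m)
  | seq {c c' : Prog} {m m' m'' : Mem} {t t' : ℕ} (h : Runs c m m' t) (h' : Runs c' m' m'' t') :
      Runs (.seq c c') m m'' (t + t')
  | condPos {e : Expr} {c c' : Prog} {m m' : Mem} {t : ℕ} (he : 0 < e.eval m)
      (h : Runs c m m' t) : Runs (.cond e c c') m m' (e.cost m + t)
  | condNeg {e : Expr} {c c' : Prog} {m m' : Mem} {t : ℕ} (he : ¬ 0 < e.eval m)
      (h : Runs c' m m' t) : Runs (.cond e c c') m m' (e.cost m + t)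
  | loopStep {e : Expr} {c : Prog} {m m' m'' : Mem} {t t' : ℕ} (he : 0 < e.eval m)
      (h : Runs c m m' t) (h' : Runs (.loop e c) m' m'' t') :
      Runs (.loop e c) m m'' (e.cost m + t + t')
  | loopDone {e : Expr} {c : Prog} {m : Mem} (he : ¬ 0 < e.eval m) :
      Runs (.loop e c) m m (e.cost m)

end LogRAM

/-! ### Input and output -/

namespace MinSum

/-- The table with the entries `f p j` for `p < n`, `j < d`, and with `0` everywhere else. -/
def table {n d : ℕ} (f : Fin n → Fin d → ℤ) : ℤ → ℤ → ℤ := fun r s =>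
  if h : 0 ≤ r ∧ 0 ≤ s ∧ r.toNat < n ∧ s.toNat < d then
    f ⟨r.toNat, h.2.2.1⟩ ⟨s.toNat, h.2.2.2⟩
  else 0

/-- The initial memory for an instance: table `0` has the row `n, d, k`, the tables `1` and `2` the
numerators and denominators of the coordinates, table `3` the column of the labels (numbered from
`0`), and all other entries are `0`. -/
def inputMem {n d k : ℕ} (x : Fin n → Fin d → ℚ) (P : Fin n → Fin k) : LogRAM.Mem
  | 0 => table (n := 1) (d := 3) fun _ => ![(n : ℤ), (d : ℤ), (k : ℤ)]
  | 1 => table fun p j => (x p j).num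
  | 2 => table fun p j => ((x p j).den : ℤ)
  | 3 => table (d := 1) fun p _ => ((P p : ℕ) : ℤ)
  | _ => fun _ _ => 0

/-- The size of an instance: `n + d + k` plus the total bit length of all the coordinates. -/
def inputSize {n d : ℕ} (k : ℕ) (x : Fin n → Fin d → ℚ) : ℕ :=
  n + d + k + ∑ p, ∑ j, (LogRAM.bitLen (x p j).num + LogRAM.bitLen ((x p j).den : ℤ))

/-- The memory `m` holds the clustering `Q` as output, in the first column of table `4`. -/
def IsOutput {n k : ℕ} (m : LogRAM.Mem) (Q : Fin n → Fin k) : Prop :=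
  ∀ p : Fin n, m 4 ((p : ℕ) : ℤ) 0 = ((Q p : ℕ) : ℤ)

end MinSum

/-! By `sum_sum_sub_sq`, the min-sum cost of a cluster is twice its size times its sum of squared
deviations from the mean. The problem is thus k-means with each cluster weighted by its size, and
the labels approximate both unknowns, the sizes and the centers.

Suppose first that α is known, and let S be the optimal clustering. For a label class P and a
coordinate, let I be a set of at least (1-α)|P| consecutive points of P in sorted order whose sum of
squared deviations is least. It is spread no more than the set G of correctly labeled points of P,
because G can be traded for an interval of the same size without increasing the squared distances to
a given point (`exists_between_sum_le`). Both I and G miss at most a fraction α of P, so they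
overlap in a large set T, and the mean moves only a controlled distance in passing from I to T, to G
and to the true cluster. Hence the mean of I serves the true cluster up to the factor 1 + `excess α`
(`sum_sub_mean_sq_le`). The points are then assigned to the centers C_i so as to minimize the sum of
|P_i|‖x_p - C_i‖², with at most |P_i|/(1-α) points in cluster i. The clustering S is feasible, and
the exchanges of |Q_i| for |P_i| and of |P_i| for |S_i| cost a factor 1/(1-α) each
(`cost_le_of_assignment`).

The rate α need not be known. The least valid rate is a fraction b/c with c ≤ n
(`exists_error_rate`) and the guarantee is monotone in the rate (`ratio_mono`), so it is enough to
try all these fractions and to keep the cheapest clustering (`guarantee`).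

All arithmetic is exact: the coordinates are multiplied by a common denominator and by n!, so every
mean of a nonempty set of points is an integer. The capacitated assignment is computed by a
primal-dual method that assigns one more point per phase along a tree of zero reduced cost; its
prices certify optimality (`DualInv.optimal`).

For the running time, the program is written with counting loops only. Repeated multiplication could
still make numbers too long, so tables carry levels: an entry of level l + 1 is only computed by
expressions of degree at most one in that level, with coefficients of lower level. Each assignment
then adds a bounded amount to the bit length, and with a fixed number of levels everything stays
polynomial (`runs_compile`). -/

/-! ### A language of bounded loops -/

namespace LogRAM

/-- Programs whose only loops are counting loops: `rep v s c` runs `c` with the counter `v[0, 0]`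
going down from `N - 1` to `0`, where `N` is the entry `0[0, s]`. -/
inductive FProg where
  | skip
  | set (a : ℕ) (i j e : Expr)
  | seq (c c' : FProg)
  | cond (e : Expr) (c c' : FProg)
  | rep (v s : ℕ) (c : FProg)

namespace FProg

/-- The step `g` performed for the counter values `N - 1, …, 0`. -/
def countdown (g : Mem → ℤ → Mem) : ℕ → Mem → Mem
  | 0, m => m
  | N + 1, m => countdown g N (g m N)

/-- A conditional on memories. -/
def select : Bool → Mem → Mem → Mem
  | true, m, _ => m
  | false, _, m' => m'

@[simp] theorem select_true (m m' : Mem) : select true m m' = m := rfl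

@[simp] theorem select_false (m m' : Mem) : select false m m' = m' := rfl

/-- The effect of a program on the memory. -/
def run : FProg → Mem → Mem
  | .skip, m => m
  | .set a i j e, m => m.write a (i.eval m) (j.eval m) (e.eval m)
  | .seq c c', m => c'.run (c.run m)
  | .cond e c c', m => select (decide (0 < e.eval m)) (c.run m) (c'.run m)
  | .rep v s c, m =>
      countdown (fun m r => c.run (m.write v 0 0 r)) (m 0 0 s).toNat (m.write v 0 0 (m 0 0 s))

/-- Translation of bounded loops into the loops of the machine. -/
def compile : FProg → Prog
  | .skip => .skip
  | .set a i j e => .set a i j e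
  | .seq c c' => .seq c.compile c'.compile
  | .cond e c c' => .cond e c.compile c'.compile
  | .rep v s c =>
      .seq (.set v (.const 0) (.const 0) (.get 0 (.const 0) (.const s)))
        (.loop (.get v (.const 0) (.const 0))
          (.seq (.set v (.const 0) (.const 0) (.sub (.get v (.const 0) (.const 0)) (.const 1)))
            c.compile))

/-- Does the program write to the table `a`? -/
def writes (a : ℕ) : FProg → Bool
  | .skip => false
  | .set b _ _ _ => b == a
  | .seq c c' => c.writes a || c'.writes a
  | .cond _ c c' => c.writes a || c'.writes a
  | .rep v _ c => v == a || c.writes a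

theorem countdown_table {a : ℕ} {g : Mem → ℤ → Mem} (hg : ∀ m r, g m r a = m a) (N : ℕ) (m : Mem) :
    countdown g N m a = m a := by
  induction N generalizing m with
  | zero => rfl
  | succ N ih => rw [countdown, ih, hg]

theorem _root_.LogRAM.Mem.write_table {a b : ℕ} (h : a ≠ b) (m : Mem) (i j v : ℤ) :
    m.write b i j v a = m a := by
  funext r s; simp [Mem.write, h]

theorem _root_.LogRAM.Mem.write_apply (m : Mem) (a : ℕ) (i j v r s : ℤ) :
    m.write a i j v a r s = if r = i ∧ s = j then v else m a r s := by
  simp [Mem.write]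

/-- The frame rule of all later verification: for a concrete program, `writes` evaluates, so the
hypothesis is usually `rfl`. -/
theorem run_table {a : ℕ} (c : FProg) (h : c.writes a = false) (m : Mem) : c.run m a = m a := by
  induction c generalizing m with
  | skip => rfl
  | set b i j e =>
    simp only [writes, beq_eq_false_iff_ne] at h
    exact Mem.write_table h.symm _ _ _ _
  | seq c c' ih ih' =>
    simp only [writes, Bool.or_eq_false_iff] at h
    rw [run, ih' h.2, ih h.1]
  | cond e c c' ih ih' =>
    simp only [writes, Bool.or_eq_false_iff] at h
    rw [run]
    cases decide (0 < e.eval m)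
    exacts [ih' h.2 m, ih h.1 m]
  | rep v s c ih =>
    simp only [writes, Bool.or_eq_false_iff, beq_eq_false_iff_ne] at h
    rw [run, countdown_table, Mem.write_table h.1.symm]
    intro m r
    rw [ih h.2, Mem.write_table h.1.symm]

theorem countdown_induct {g : Mem → ℤ → Mem} (I : ℤ → Mem → Prop) (N : ℕ)
    (step : ∀ (r : ℤ) (m : Mem), 0 ≤ r → r < N → I (r + 1) m → I r (g m r)) (m : Mem)
    (h : I N m) : I 0 (countdown g N m) := by
  induction N generalizing m with
  | zero => exact_mod_cast h
  | succ N ih =>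
    refine ih (fun r m h0 h1 => step r m h0 (by push_cast; omega)) _ ?_
    exact step N m (by positivity) (by push_cast; omega) (by exact_mod_cast h)

/-- The invariant rule for counting loops: `I r` holds when the counter values `≥ r` are done. -/
theorem rep_induct {v s : ℕ} {c : FProg} {m : Mem} {N : ℤ} (I : ℤ → Mem → Prop)
    (hN : m 0 0 s = N) (hN0 : 0 ≤ N) (init : I N (m.write v 0 0 N))
    (step : ∀ (r : ℤ) (m' : Mem), 0 ≤ r → r < N → I (r + 1) m' → I r (c.run (m'.write v 0 0 r))) :
    I 0 ((FProg.rep v s c).run m) := by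
  rw [run, hN]
  have h : ((N.toNat : ℕ) : ℤ) = N := Int.toNat_of_nonneg hN0
  apply countdown_induct I
  · intro r m h0 h1 hI
    exact step r m h0 (h ▸ h1) hI
  · rw [h]; exact init

end FProg

/-! ### Bit lengths -/

theorem one_le_bitLen (z : ℤ) : 1 ≤ bitLen z := Nat.le_add_left _ _

theorem bitLen_le_iff {z : ℤ} {b : ℕ} : bitLen z ≤ b + 1 ↔ z.natAbs < 2 ^ b := by
  rw [bitLen, Nat.add_le_add_iff_right, Nat.size_le]

theorem natAbs_lt_two_pow (z : ℤ) : z.natAbs < 2 ^ (bitLen z - 1) :=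
  bitLen_le_iff.1 (by rw [bitLen]; omega)

theorem bitLen_mono {y z : ℤ} (h : y.natAbs ≤ z.natAbs) : bitLen y ≤ bitLen z :=
  Nat.add_le_add_right (Nat.size_le_size h) 1

theorem bitLen_add_le (y z : ℤ) : bitLen (y + z) ≤ max (bitLen y) (bitLen z) + 1 := by
  rw [bitLen_le_iff]
  have hy := natAbs_lt_two_pow y
  have hz := natAbs_lt_two_pow z
  have h1 := one_le_bitLen y
  obtain ⟨w, hw⟩ : ∃ w, max (bitLen y) (bitLen z) = w + 1 := ⟨max (bitLen y) (bitLen z) - 1, by omega⟩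
  have hy' : 2 ^ (bitLen y - 1) ≤ 2 ^ w := Nat.pow_le_pow_right (by norm_num) (by omega)
  have hz' : 2 ^ (bitLen z - 1) ≤ 2 ^ w := Nat.pow_le_pow_right (by norm_num) (by omega)
  rw [hw, pow_succ]
  have := Int.natAbs_add_le y z
  omega

theorem bitLen_neg (z : ℤ) : bitLen (-z) = bitLen z := by simp [bitLen]

theorem bitLen_sub_le (y z : ℤ) : bitLen (y - z) ≤ max (bitLen y) (bitLen z) + 1 := by
  have := bitLen_add_le y (-z)
  rwa [bitLen_neg, ← sub_eq_add_neg] at this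

theorem bitLen_mul_le (y z : ℤ) : bitLen (y * z) ≤ bitLen y + bitLen z := by
  have hy := natAbs_lt_two_pow y
  have hz := natAbs_lt_two_pow z
  have h1 := one_le_bitLen y
  have h2 := one_le_bitLen z
  obtain ⟨u, hu⟩ : ∃ u, bitLen y = u + 1 := ⟨bitLen y - 1, by omega⟩
  obtain ⟨w, hw⟩ : ∃ w, bitLen z = w + 1 := ⟨bitLen z - 1, by omega⟩
  rw [hu, hw, show u + 1 + (w + 1) = u + w + 1 + 1 by ring, bitLen_le_iff, Int.natAbs_mul]
  rw [hu, Nat.add_sub_cancel] at hy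
  rw [hw, Nat.add_sub_cancel] at hz
  calc _ < 2 ^ u * 2 ^ w := Nat.mul_lt_mul'' hy hz
    _ = 2 ^ (u + w) := (pow_add _ _ _).symm
    _ ≤ _ := Nat.pow_le_pow_right (by norm_num) (by omega)

/-- This is why `width`, `lowLevel` and `linear` ignore divisors. -/
theorem bitLen_div_le (y z : ℤ) : bitLen (y / z) ≤ bitLen y := by
  apply bitLen_mono
  have := Int.abs_ediv_le_abs y z
  rw [Int.abs_eq_natAbs, Int.abs_eq_natAbs] at this
  exact_mod_cast this

theorem bitLen_le_self_add {z : ℤ} {b : ℕ} (h0 : 0 ≤ z) (h : z ≤ b) : bitLen z ≤ b + 1 := by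
  rw [bitLen_le_iff]
  have := b.lt_two_pow_self
  omega

/-! ### Costs of expressions and programs -/

namespace Expr

/-- A factor by which the values of the expression may be longer than the entries it reads. -/
def width : Expr → ℕ
  | .const z => bitLen z
  | .get _ _ _ => 1
  | .add e f => e.width + f.width
  | .sub e f => e.width + f.width
  | .mul e f => e.width + f.width
  | .div e _ => e.width

/-- A factor by which the evaluation cost may exceed the lengths of the entries read. -/
def weight : Expr → ℕ
  | .const z => bitLen z
  | .get _ i j => i.weight + j.weight + 1
  | .add e f => e.weight + f.weight + (e.width + f.width)
  | .sub e f => e.weight + f.weight + (e.width + f.width)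
  | .mul e f => e.weight + f.weight + (e.width + f.width)
  | .div e f => e.weight + f.weight + e.width

/-- All entries that contribute to the value are taken from tables of level `≤ l`. -/
def lowLevel (lev : ℕ → ℕ) (l : ℕ) : Expr → Bool
  | .const _ => true
  | .get a _ _ => decide (lev a ≤ l)
  | .add e f => e.lowLevel lev l && f.lowLevel lev l
  | .sub e f => e.lowLevel lev l && f.lowLevel lev l
  | .mul e f => e.lowLevel lev l && f.lowLevel lev l
  | .div e _ => e.lowLevel lev l

/-- All entries that contribute to the value are taken from tables of level `≤ l + 1`, and of the
two factors of a product one is of level `≤ l`. -/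
def linear (lev : ℕ → ℕ) (l : ℕ) : Expr → Bool
  | .const _ => true
  | .get a _ _ => decide (lev a ≤ l + 1)
  | .add e f => e.linear lev l && f.linear lev l
  | .sub e f => e.linear lev l && f.linear lev l
  | .mul e f => (e.linear lev l && f.lowLevel lev l) || (e.lowLevel lev l && f.linear lev l)
  | .div e _ => e.linear lev l

theorem one_le_width (e : Expr) : 1 ≤ e.width := by
  induction e with
  | const z => exact one_le_bitLen z
  | get => exact le_rfl
  | add | sub | mul | div => simp only [width]; omega

/-- Widths add up even for sums: the extra carry bit is paid for by the shorter summand, whose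
length is at least one. -/
theorem bitLen_eval_le_of_lowLevel {lev : ℕ → ℕ} {l F : ℕ} {m : Mem} (hF : 1 ≤ F)
    (hm : ∀ a, lev a ≤ l → ∀ i j, bitLen (m a i j) ≤ F) (e : Expr) (he : e.lowLevel lev l) :
    bitLen (e.eval m) ≤ e.width * F := by
  induction e with
  | const z => exact Nat.le_mul_of_pos_right _ hF
  | get a i j => simpa [width, eval] using hm a (by simpa [lowLevel] using he) _ _
  | add e f ihe ihf =>
    simp only [lowLevel, Bool.and_eq_true] at he
    have h1 := ihe he.1
    have h2 := ihf he.2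
    have := bitLen_add_le (e.eval m) (f.eval m)
    have := one_le_bitLen (e.eval m)
    have := one_le_bitLen (f.eval m)
    simp only [width, eval, add_mul]; omega
  | sub e f ihe ihf =>
    simp only [lowLevel, Bool.and_eq_true] at he
    have h1 := ihe he.1
    have h2 := ihf he.2
    have := bitLen_sub_le (e.eval m) (f.eval m)
    have := one_le_bitLen (e.eval m)
    have := one_le_bitLen (f.eval m)
    simp only [width, eval, add_mul]; omega
  | mul e f ihe ihf =>
    simp only [lowLevel, Bool.and_eq_true] at he
    have h1 := ihe he.1
    have h2 := ihf he.2
    have := bitLen_mul_le (e.eval m) (f.eval m)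
    simp only [width, eval, add_mul]; omega
  | div e f ihe ihf => exact (bitLen_div_le _ _).trans (ihe he)

/-- The point is the coefficient one of `E`. A product has at most one factor of the top level, and
a sum takes the maximum of its two lengths, so long entries are never multiplied together and the
growth over `E` is additive. -/
theorem bitLen_eval_le_of_linear {lev : ℕ → ℕ} {l E F : ℕ} {m : Mem} (hF : 1 ≤ F)
    (hm : ∀ a, lev a ≤ l → ∀ i j, bitLen (m a i j) ≤ F)
    (hm' : ∀ a, lev a ≤ l + 1 → ∀ i j, bitLen (m a i j) ≤ E) (e : Expr) (he : e.linear lev l) :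
    bitLen (e.eval m) ≤ E + e.width * F := by
  induction e with
  | const z => exact le_add_left (Nat.le_mul_of_pos_right _ hF)
  | get a i j => exact le_add_right (hm' a (by simpa [linear] using he) _ _)
  | add e f ihe ihf =>
    simp only [linear, Bool.and_eq_true] at he
    have h1 := ihe he.1
    have h2 := ihf he.2
    have := bitLen_add_le (e.eval m) (f.eval m)
    have := Nat.mul_le_mul e.one_le_width hF
    have := Nat.mul_le_mul f.one_le_width hF
    simp only [width, eval, add_mul]; omega
  | sub e f ihe ihf =>
    simp only [linear, Bool.and_eq_true] at he
    have h1 := ihe he.1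
    have h2 := ihf he.2
    have := bitLen_sub_le (e.eval m) (f.eval m)
    have := Nat.mul_le_mul e.one_le_width hF
    have := Nat.mul_le_mul f.one_le_width hF
    simp only [width, eval, add_mul]; omega
  | mul e f ihe ihf =>
    simp only [linear, Bool.and_eq_true, Bool.or_eq_true] at he
    have := bitLen_mul_le (e.eval m) (f.eval m)
    simp only [width, eval, add_mul]
    rcases he with he | he
    · have h1 := ihe he.1
      have h2 := bitLen_eval_le_of_lowLevel hF hm f he.2
      omega
    · have h1 := ihf he.2
      have h2 := bitLen_eval_le_of_lowLevel hF hm e he.1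
      omega
  | div e f ihe ihf => exact (bitLen_div_le _ _).trans (ihe he)

theorem bitLen_eval_le {F : ℕ} {m : Mem} (hF : 1 ≤ F) (hm : ∀ a i j, bitLen (m a i j) ≤ F)
    (e : Expr) : bitLen (e.eval m) ≤ e.width * F := by
  refine bitLen_eval_le_of_lowLevel (lev := fun _ => 0) (l := 0) hF (fun a _ => hm a) e ?_
  induction e with
  | const | get => rfl
  | add _ _ h h' | sub _ _ h h' | mul _ _ h h' => simp [lowLevel, h, h']
  | div _ _ h _ => simp [lowLevel, h]

theorem cost_le {F : ℕ} {m : Mem} (hF : 1 ≤ F) (hm : ∀ a i j, bitLen (m a i j) ≤ F)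
    (e : Expr) : e.cost m ≤ e.weight * F := by
  induction e with
  | const z => exact Nat.le_mul_of_pos_right _ hF
  | get a i j hi hj =>
    have := hm a (i.eval m) (j.eval m)
    simp only [cost, weight, add_mul]; omega
  | add e f he hf =>
    have := bitLen_eval_le hF hm (.add e f)
    simp only [cost, weight, width, eval, add_mul] at *; omega
  | sub e f he hf =>
    have := bitLen_eval_le hF hm (.sub e f)
    simp only [cost, weight, width, eval, add_mul] at *; omega
  | mul e f he hf =>
    have := bitLen_eval_le hF hm (.mul e f)
    simp only [cost, weight, width, eval, add_mul] at *; omega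
  | div e f he hf =>
    have := bitLen_eval_le hF hm (.div e f)
    simp only [cost, weight, width, eval, add_mul] at *; omega

end Expr

namespace FProg

/-- Counters have level `0` and are not written by the loop bodies, table `0` is not written, and
an entry of a table of level `l + 1` is only set to expressions that are linear for `l`. -/
def leveled (lev : ℕ → ℕ) : FProg → Bool
  | .skip => true
  | .set a _ _ e => a != 0 && (lev a != 0 && e.linear lev (lev a - 1))
  | .seq c c' => c.leveled lev && c'.leveled lev
  | .cond _ c c' => c.leveled lev && c'.leveled lev
  | .rep v _ c => (v != 0 && lev v == 0) && (!c.writes v && c.leveled lev)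

/-- The cost of a program, up to the bit length of the numbers involved, if `M` bounds the number
of iterations of each loop. -/
def weight (M : ℕ) : FProg → ℕ
  | .skip => 1
  | .set _ i j e => i.weight + j.weight + e.weight + e.width
  | .seq c c' => c.weight M + c'.weight M
  | .cond e c c' => e.weight + c.weight M + c'.weight M
  | .rep _ s c => 20 + 4 * bitLen s + M * (20 + c.weight M)

/-- The cost bound as a polynomial in the number of iterations. -/
noncomputable def weightPoly : FProg → Polynomial ℕ
  | .skip => 1
  | .set _ i j e => Polynomial.C (i.weight + j.weight + e.weight + e.width)
  | .seq c c' => c.weightPoly + c'.weightPoly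
  | .cond e c c' => Polynomial.C e.weight + c.weightPoly + c'.weightPoly
  | .rep _ s c => Polynomial.C (20 + 4 * bitLen s) + Polynomial.X * (Polynomial.C 20 + c.weightPoly)

theorem eval_weightPoly (M : ℕ) (c : FProg) : c.weightPoly.eval M = c.weight M := by
  induction c with
  | skip => simp [weightPoly, weight]
  | set => simp only [weightPoly, weight, Polynomial.eval_C]
  | seq c c' h h' => simp only [weightPoly, weight, Polynomial.eval_add, h, h']
  | cond e c c' h h' => simp only [weightPoly, weight, Polynomial.eval_add, Polynomial.eval_C, h, h']
  | rep v s c h =>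
    simp only [weightPoly, weight, Polynomial.eval_add, Polynomial.eval_C, Polynomial.eval_mul,
      Polynomial.eval_X, h]

/-- Bound for the bit lengths in tables of level `l` after cost `τ`, if the total is at most `N`. -/
def levelBound (B N : ℕ) : ℕ → ℕ → ℕ
  | 0, _ => B
  | l + 1, τ => B * (1 + N) ^ l * (1 + τ)

theorem levelBound_mono_time (B N l : ℕ) {τ τ' : ℕ} (h : τ ≤ τ') :
    levelBound B N l τ ≤ levelBound B N l τ' := by
  cases l with
  | zero => exact le_rfl
  | succ l => exact Nat.mul_le_mul_left _ (by omega)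

theorem levelBound_le (B N l : ℕ) {τ : ℕ} (h : τ ≤ N) : levelBound B N l τ ≤ B * (1 + N) ^ l := by
  cases l with
  | zero => simp [levelBound]
  | succ l => rw [levelBound, pow_succ, ← mul_assoc]; exact Nat.mul_le_mul_left _ (by omega)

theorem le_levelBound_succ (B N l τ : ℕ) : B * (1 + N) ^ l ≤ levelBound B N (l + 1) τ :=
  Nat.le_mul_of_pos_right _ (by omega)

/-- All entries respect the bounds of their levels. -/
def Bounded (lev : ℕ → ℕ) (B N τ : ℕ) (m : Mem) : Prop :=
  ∀ a i j, bitLen (m a i j) ≤ levelBound B N (lev a) τ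

theorem Bounded.mono {lev : ℕ → ℕ} {B N τ τ' : ℕ} {m : Mem} (hm : Bounded lev B N τ m)
    (h : τ ≤ τ') : Bounded lev B N τ' m :=
  fun a i j => (hm a i j).trans (levelBound_mono_time _ _ _ h)

theorem Bounded.level {lev : ℕ → ℕ} {B N τ : ℕ} {m : Mem} (hm : Bounded lev B N τ m)
    (hτ : τ ≤ N) {l : ℕ} : ∀ a, lev a ≤ l → ∀ i j, bitLen (m a i j) ≤ B * (1 + N) ^ l :=
  fun a ha i j => (hm a i j).trans <| (levelBound_le _ _ _ hτ).trans <|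
    Nat.mul_le_mul_left _ (Nat.pow_le_pow_right (by omega) ha)

theorem Bounded.write {lev : ℕ → ℕ} {B N τ : ℕ} {m : Mem} (hm : Bounded lev B N τ m) {a : ℕ}
    {i j v : ℤ} (hv : bitLen v ≤ levelBound B N (lev a) τ) :
    Bounded lev B N τ (m.write a i j v) := by
  intro b r s
  unfold Mem.write
  split_ifs with h
  · rw [h.1]; exact hv
  · exact hm b r s

/-- A linear expression lengthens entries of its level by at most `e.width` times the bound for the
lower levels. This is exactly the growth of `levelBound` when the clock advances by `e.width`, which
is why `weight` charges the width of an assigned expression. -/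
theorem Bounded.set {lev : ℕ → ℕ} {B N τ : ℕ} {m : Mem} (hm : Bounded lev B N τ m) (hB : 1 ≤ B)
    {a : ℕ} {e : Expr} (ha : lev a ≠ 0) (he : e.linear lev (lev a - 1)) (hτ : τ + e.width ≤ N)
    (i j : ℤ) : Bounded lev B N (τ + e.width) (m.write a i j (e.eval m)) := by
  refine (hm.mono (Nat.le_add_right _ _)).write ?_
  obtain ⟨l, hl⟩ := Nat.exists_eq_succ_of_ne_zero ha
  rw [hl, Nat.succ_sub_one] at he
  rw [hl]
  have hF : 1 ≤ B * (1 + N) ^ l := Nat.mul_pos hB (pow_pos (by omega) _)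
  refine (e.bitLen_eval_le_of_linear hF (hm.level (by omega))
    (E := levelBound B N (l + 1) τ) ?_ he).trans ?_
  · intro b hb r s
    rcases Nat.lt_or_ge (lev b) (l + 1) with h | h
    · exact (hm.level (by omega) b (Nat.lt_succ_iff.1 h) r s).trans (le_levelBound_succ _ _ _ _)
    · rw [show l + 1 = lev b by omega]; exact hm b r s
  · simp only [levelBound]
    apply le_of_eq; ring

/-- A leveled program runs on the machine, at a cost that is polynomial in the number of iterations
and the bit lengths of the input. -/
theorem runs_compile {lev : ℕ → ℕ} {L B N M : ℕ} (hlev : ∀ a, lev a ≤ L) (hB : 1 ≤ B)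
    (m₀ : ℤ → ℤ → ℤ) (hM : ∀ s : ℕ, m₀ 0 s ≤ M) (hMB : bitLen M ≤ B)
    (hs : ∀ s : ℕ, 0 ≤ m₀ 0 s)
    (c : FProg) (hc : c.leveled lev) (m : Mem) (hm₀ : m 0 = m₀) (τ : ℕ)
    (hτ : τ + c.weight M ≤ N) (hm : Bounded lev B N τ m) :
    (c.run m) 0 = m₀ ∧ Bounded lev B N (τ + c.weight M) (c.run m) ∧
      ∃ t, Runs c.compile m (c.run m) t ∧ t ≤ c.weight M * (B * (1 + N) ^ L) := by
  have hF : 1 ≤ B * (1 + N) ^ L := Nat.mul_pos hB (pow_pos (by omega) _)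
  have hcost : ∀ {τ : ℕ} {m : Mem}, Bounded lev B N τ m → τ ≤ N → ∀ e : Expr,
      e.cost m ≤ e.weight * (B * (1 + N) ^ L) := fun hm hτ e =>
    Expr.cost_le hF (fun a => hm.level hτ a (hlev a)) e
  induction c generalizing m τ with
  | skip => exact ⟨hm₀, hm.mono (Nat.le_add_right _ _), 1, .skip m, by simpa [weight] using hF⟩
  | set a i j e =>
    simp only [leveled, Bool.and_eq_true, bne_iff_ne] at hc
    simp only [weight] at hτ ⊢
    refine ⟨?_, ?_, _, .set a i j e m, ?_⟩
    · rw [run, Mem.write_table hc.1.symm, hm₀]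
    · exact (hm.set hB hc.2.1 hc.2.2 (by omega) _ _).mono (by omega)
    · have h1 := hcost hm (by omega) i
      have h2 := hcost hm (by omega) j
      have h3 := hcost hm (by omega) e
      simp only [add_mul]; omega
  | seq c c' ih ih' =>
    simp only [leveled, Bool.and_eq_true] at hc
    simp only [weight] at hτ ⊢
    obtain ⟨h1, h2, t, h3, h4⟩ := ih hc.1 m hm₀ τ (by omega) hm
    obtain ⟨h1', h2', t', h3', h4'⟩ := ih' hc.2 _ h1 _ (by omega) h2
    refine ⟨h1', by rw [← add_assoc]; exact h2', _, .seq h3 h3', ?_⟩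
    rw [add_mul]; omega
  | cond e c c' ih ih' =>
    simp only [leveled, Bool.and_eq_true] at hc
    simp only [weight] at hτ ⊢
    have he := hcost hm (by omega) e
    by_cases h : 0 < e.eval m
    · obtain ⟨h1, h2, t, h3, h4⟩ := ih hc.1 m hm₀ τ (by omega) hm
      simp only [run, h, decide_true, select_true, compile]
      refine ⟨h1, h2.mono (by omega), _, .condPos h h3, ?_⟩
      simp only [add_mul]; omega
    · obtain ⟨h1, h2, t, h3, h4⟩ := ih' hc.2 m hm₀ τ (by omega) hm
      simp only [run, h, decide_false, select_false, compile]
      refine ⟨h1, h2.mono (by omega), _, .condNeg h h3, ?_⟩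
      simp only [add_mul]; omega
  | rep v s c ih =>
    simp only [leveled, Bool.and_eq_true, bne_iff_ne, beq_iff_eq, Bool.not_eq_true'] at hc
    obtain ⟨⟨hv0, hlv⟩, hcv, hc⟩ := hc
    simp only [weight] at hτ ⊢
    have hval : ∀ z : ℤ, 0 ≤ z → z ≤ M → bitLen z ≤ B := fun z h h' =>
      (bitLen_mono (by omega)).trans hMB
    -- Induction on the number of iterations left. One loop test and one decrement have total weight
    -- 13, covered by the 20; the last, failing test has weight 3, covered by the 10.
    have key : ∀ (r : ℕ) (m : Mem) (τ : ℕ), r ≤ M → m 0 = m₀ → m v 0 0 = r →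
        τ + r * (20 + c.weight M) + 10 ≤ N → Bounded lev B N τ m →
        (countdown (fun m r => c.run (m.write v 0 0 r)) r m) 0 = m₀ ∧
        Bounded lev B N (τ + r * (20 + c.weight M))
          (countdown (fun m r => c.run (m.write v 0 0 r)) r m) ∧
        ∃ t, Runs (.loop (.get v (.const 0) (.const 0))
          (.seq (.set v (.const 0) (.const 0) (.sub (.get v (.const 0) (.const 0)) (.const 1)))
            c.compile)) m (countdown (fun m r => c.run (m.write v 0 0 r)) r m) t ∧
          t ≤ (10 + r * (20 + c.weight M)) * (B * (1 + N) ^ L) := by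
      intro r
      induction r with
      | zero =>
        intro m τ _ hm₀ hv hτ hm
        refine ⟨hm₀, hm.mono (by omega), _, .loopDone ?_, ?_⟩
        · simp [Expr.eval, hv]
        · refine (hcost hm (by omega) _).trans (Nat.mul_le_mul_right _ ?_)
          simp [Expr.weight, bitLen]
      | succ r ihr =>
        intro m τ hr hm₀ hv hτ hm
        rw [add_mul, one_mul] at hτ
        have hwr : Bounded lev B N τ (m.write v 0 0 r) := by
          refine hm.write ?_
          rw [hlv]; exact hval _ (by positivity) (by omega)
        obtain ⟨h1, h2, t, h3, h4⟩ := ih hc (m.write v 0 0 r)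
          (by rw [Mem.write_table hv0.symm, hm₀]) τ (by omega) hwr
        obtain ⟨h1', h2', t', h3', h4'⟩ := ihr (c.run (m.write v 0 0 r)) (τ + c.weight M)
          (by omega) h1 (by rw [run_table c hcv, Mem.write_apply]; simp) (by omega) h2
        have hset : Runs (.set v (.const 0) (.const 0)
            (.sub (.get v (.const 0) (.const 0)) (.const 1))) m (m.write v 0 0 r)
            (Expr.cost m (.const 0) + Expr.cost m (.const 0) +
            Expr.cost m (.sub (.get v (.const 0) (.const 0)) (.const 1))) := by
          have := Runs.set v (.const 0) (.const 0)
            (.sub (.get v (.const 0) (.const 0)) (.const 1)) m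
          simpa [Expr.eval, hv] using this
        refine ⟨h1', h2'.mono (by rw [add_mul]; omega), _,
          .loopStep ?_ (.seq hset h3) h3', ?_⟩
        · simp only [Expr.eval, hv]; omega
        · have e1 := hcost hm (by omega) (.get v (.const 0) (.const 0))
          have e2 := hcost hm (by omega) (.const 0)
          have e3 := hcost hm (by omega) (.sub (.get v (.const 0) (.const 0)) (.const 1))
          have w1 : Expr.weight (.get v (.const 0) (.const 0)) = 3 := by simp [Expr.weight, bitLen]
          have w2 : Expr.weight (.const 0) = 1 := by simp [Expr.weight, bitLen]
          have w3 : Expr.weight (.sub (.get v (.const 0) (.const 0)) (.const 1)) = 8 := by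
            simp [Expr.weight, Expr.width, bitLen]
          rw [w1] at e1; rw [w2] at e2; rw [w3] at e3
          simp only [add_mul, one_mul] at h4' ⊢; omega
    have hN : ((m 0 0 s).toNat : ℤ) = m 0 0 s := Int.toNat_of_nonneg (by rw [hm₀]; exact hs s)
    have hNM : (m 0 0 s).toNat ≤ M := by have := hM s; rw [← hm₀] at this; omega
    have hmul := Nat.mul_le_mul_right (20 + c.weight M) hNM
    obtain ⟨h1, h2, t, h3, h4⟩ := key (m 0 0 s).toNat (m.write v 0 0 (m 0 0 s)) τ hNM
      (by rw [Mem.write_table hv0.symm, hm₀]) (by rw [Mem.write_apply]; simpa using hN.symm)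
      (by omega) (hm.write (by rw [hlv]; exact hval _ (by omega) (by omega)))
    refine ⟨h1, h2.mono (by omega), _, .seq (.set v _ _ _ m) h3, ?_⟩
    have e2 := hcost hm (by omega) (.const 0)
    have e3 := hcost hm (by omega) (.get 0 (.const 0) (.const s))
    have w2 : Expr.weight (.const 0) = 1 := by simp [Expr.weight, bitLen]
    have w3 : Expr.weight (.get 0 (.const 0) (.const s)) = 2 + bitLen s := by
      simp [Expr.weight, bitLen]; ring
    rw [w2] at e2; rw [w3] at e3
    have hmul' := Nat.mul_le_mul_right (B * (1 + N) ^ L) hmul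
    simp only [add_mul] at h4 hmul' e3 ⊢
    have : 4 * bitLen (s : ℤ) * (B * (1 + N) ^ L) = 4 * (bitLen (s : ℤ) * (B * (1 + N) ^ L)) := by
      ring
    omega

end FProg

end LogRAM

/-! ### Means and sums of squares on the line -/

namespace MinSum

section Line

variable {ι : Type*}

/-- The mean of `x` over the set `A`. -/
noncomputable def mean (x : ι → ℝ) (A : Finset ι) : ℝ := (∑ p ∈ A, x p) / A.card

/-- The sum of the squared deviations from the mean. -/
noncomputable def sse (x : ι → ℝ) (A : Finset ι) : ℝ := ∑ p ∈ A, (x p - mean x A) ^ 2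

theorem card_mul_mean (x : ι → ℝ) {A : Finset ι} (hA : A.Nonempty) :
    A.card * mean x A = ∑ p ∈ A, x p := by
  have : (A.card : ℝ) ≠ 0 := by exact_mod_cast hA.card_pos.ne'
  rw [mean]; field_simp

theorem sum_sub_mean (x : ι → ℝ) (A : Finset ι) : ∑ p ∈ A, (x p - mean x A) = 0 := by
  rcases A.eq_empty_or_nonempty with rfl | hA
  · simp
  · rw [sum_sub_distrib, sum_const, nsmul_eq_mul, card_mul_mean x hA, sub_self]

theorem sum_sub_sq (x : ι → ℝ) (A : Finset ι) (c : ℝ) :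
    ∑ p ∈ A, (x p - c) ^ 2 = sse x A + A.card * (mean x A - c) ^ 2 := by
  have h : ∀ p ∈ A, (x p - c) ^ 2 = (x p - mean x A) ^ 2 +
      (2 * (mean x A - c) * (x p - mean x A) + (mean x A - c) ^ 2) := fun p _ => by ring
  rw [sum_congr rfl h, sum_add_distrib, sum_add_distrib, ← mul_sum, sum_sub_mean, sum_const,
    nsmul_eq_mul, mul_zero, zero_add, sse]

theorem sse_nonneg (x : ι → ℝ) (A : Finset ι) : 0 ≤ sse x A := sum_nonneg fun _ _ => sq_nonneg _

theorem sse_le (x : ι → ℝ) (A : Finset ι) (c : ℝ) : sse x A ≤ ∑ p ∈ A, (x p - c) ^ 2 := by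
  rw [sum_sub_sq]
  exact le_add_of_nonneg_right (by positivity)

/-- Summing the parallel axis identity `sum_sub_sq` over the reference point turns pairwise
distances into distances to the mean. -/
theorem sum_sum_sub_sq (x : ι → ℝ) (A : Finset ι) :
    ∑ p ∈ A, ∑ q ∈ A, (x p - x q) ^ 2 = 2 * A.card * sse x A := by
  have h : ∀ p ∈ A, ∑ q ∈ A, (x p - x q) ^ 2 = sse x A + A.card * (x p - mean x A) ^ 2 := by
    intro p _
    rw [sum_congr rfl fun q _ => sub_sq_comm (x p) (x q), sum_sub_sq, sub_sq_comm]
  rw [sum_congr rfl h, sum_add_distrib, ← mul_sum, sum_const, nsmul_eq_mul, ← sse]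
  ring

/-- The mean over a subset is close to the mean over the whole set. -/
theorem mean_sub_mean_sq_le [DecidableEq ι] (x : ι → ℝ) {A T : Finset ι} (hTA : T ⊆ A)
    (hT : T.Nonempty) :
    A.card * (T.card * (mean x A - mean x T) ^ 2) ≤ (A.card - T.card) * (sse x A - sse x T) := by
  have hcard : ((A \ T).card : ℝ) = A.card - T.card := by
    rw [card_sdiff_of_subset hTA, Nat.cast_sub (card_le_card hTA)]
  have hsplit := sum_sdiff hTA (f := fun p => (x p - mean x A) ^ 2)
  rw [sum_sub_sq x T, ← sse] at hsplit
  have hsplit' := sum_sdiff hTA (f := fun p => x p - mean x A)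
  have hsum : ∑ p ∈ T, (x p - mean x A) = T.card * (mean x T - mean x A) := by
    rw [sum_sub_distrib, sum_const, nsmul_eq_mul, ← card_mul_mean x hT]; ring
  rw [sum_sub_mean, hsum] at hsplit'
  -- Cauchy–Schwarz on the complement of `T`, where the deviations from the mean of `A` cancel those
  -- over `T`.
  have hcs := sq_sum_le_card_mul_sum_sq (s := A \ T) (f := fun p => x p - mean x A)
  rw [hcard] at hcs
  have h1 : ∑ p ∈ A \ T, (x p - mean x A) = T.card * (mean x A - mean x T) := by linarith
  have h2 : ∑ p ∈ A \ T, (x p - mean x A) ^ 2 =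
      sse x A - sse x T - T.card * (mean x A - mean x T) ^ 2 := by
    rw [← hsplit]; ring
  rw [h1, h2] at hcs
  linarith

/-- The points of `A` between `p` and `q` in the order given by `key`. -/
def between (key : ι → ℤ) (A : Finset ι) (p q : ι) : Finset ι :=
  A.filter fun r => key p ≤ key r ∧ key r ≤ key q

/-- Every set can be replaced by an interval of the same size without increasing the sum of the
squared distances from a given point. -/
theorem exists_between_sum_le [DecidableEq ι] {x : ι → ℝ} {key : ι → ℤ} (hinj : Function.Injective key)
    (hmono : ∀ p q, key p ≤ key q → x p ≤ x q) {A B : Finset ι} (hB : B.Nonempty) (hBA : B ⊆ A)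
    (c : ℝ) : ∃ p q, (between key A p q).card = B.card ∧
      ∑ r ∈ between key A p q, (x r - c) ^ 2 ≤ ∑ r ∈ B, (x r - c) ^ 2 := by
  let hull : Finset ι → Finset ι := fun B' =>
    A.filter fun r => ∃ p ∈ B', ∃ q ∈ B', key p ≤ key r ∧ key r ≤ key q
  let F := (powersetCard B.card A).filter fun B' =>
    ∑ r ∈ B', (x r - c) ^ 2 ≤ ∑ r ∈ B, (x r - c) ^ 2
  -- Among the sets of the right size that are no worse than `B`, one with the smallest hull has no
  -- gaps.
  obtain ⟨B₁, hB₁, hmin⟩ := exists_min_image F (fun B' => (hull B').card)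
    ⟨B, by simp [F, mem_powersetCard, hBA]⟩
  simp only [F, mem_filter, mem_powersetCard] at hB₁ hmin
  obtain ⟨⟨hB₁A, hcard⟩, hsum⟩ := hB₁
  have hne : B₁.Nonempty := card_pos.1 (hcard ▸ hB.card_pos)
  obtain ⟨p, hp, hpmin⟩ := exists_min_image B₁ key hne
  obtain ⟨q, hq, hqmax⟩ := exists_max_image B₁ key hne
  have hsub : B₁ ⊆ between key A p q := fun r hr =>
    mem_filter.2 ⟨hB₁A hr, hpmin r hr, hqmax r hr⟩
  have heq : between key A p q = B₁ := by
    refine (Subset.antisymm hsub fun r hr => ?_).symm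
    by_contra hrB
    obtain ⟨hrA, hpr, hrq⟩ := mem_filter.1 hr
    -- exchanging an endpoint for a missing inner point makes the hull smaller
    have exch : ∀ e ∈ B₁, (x r - c) ^ 2 ≤ (x e - c) ^ 2 →
        e ∈ hull (insert r (B₁.erase e)) := by
      intro e he hle
      by_contra hnot
      have hin : insert r (B₁.erase e) ⊆ A := insert_subset hrA ((erase_subset _ _).trans hB₁A)
      have hrE : r ∉ B₁.erase e := fun h => hrB (mem_of_mem_erase h)
      have hlt : (hull (insert r (B₁.erase e))).card < (hull B₁).card := by
        apply card_lt_card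
        rw [ssubset_iff_of_subset]
        · exact ⟨e, mem_filter.2 ⟨hB₁A he, e, he, e, he, le_rfl, le_rfl⟩, hnot⟩
        · intro s hs
          obtain ⟨hsA, u, hu, w, hw, hus, hsw⟩ := mem_filter.1 hs
          have hb : ∀ u ∈ insert r (B₁.erase e), key p ≤ key u ∧ key u ≤ key q := by
            intro u hu
            rcases mem_insert.1 hu with rfl | hu
            · exact ⟨hpr, hrq⟩
            · exact ⟨hpmin u (mem_of_mem_erase hu), hqmax u (mem_of_mem_erase hu)⟩
          exact mem_filter.2 ⟨hsA, p, hp, q, hq, (hb u hu).1.trans hus, hsw.trans (hb w hw).2⟩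
      refine absurd (hmin _ ⟨⟨hin, ?_⟩, ?_⟩) (not_le.2 hlt)
      · rw [card_insert_of_notMem hrE, card_erase_add_one he, hcard]
      · rw [sum_insert hrE]
        have := add_sum_erase B₁ (fun r => (x r - c) ^ 2) he
        linarith
    have hxp := hmono p r hpr
    have hxq := hmono r q hrq
    -- A missing inner point on the left of `c` is at least as close to `c` as the left end, and
    -- symmetrically on the right, so one of the two ends can be exchanged for it.
    rcases le_total (x r) c with h | h
    · obtain ⟨-, u, hu, w, hw, hup, -⟩ := mem_filter.1 (exch p hp (by nlinarith))
      rcases mem_insert.1 hu with rfl | hu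
      · exact hrB (hinj (le_antisymm hup hpr) ▸ hp)
      · have := hinj (le_antisymm hup (hpmin u (mem_of_mem_erase hu)))
        exact (mem_erase.1 hu).1 this
    · obtain ⟨-, u, hu, w, hw, -, hqw⟩ := mem_filter.1 (exch q hq (by nlinarith))
      rcases mem_insert.1 hw with rfl | hw
      · exact hrB (hinj (le_antisymm hrq hqw) ▸ hq)
      · have := hinj (le_antisymm (hqmax w (mem_of_mem_erase hw)) hqw)
        exact (mem_erase.1 hw).1 this
  exact ⟨p, q, by rw [heq, hcard], by rw [heq]; exact hsum⟩

/-- `γ α` for the guarantee on the whole range of error rates. -/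
noncomputable def excess (α : ℝ) : ℝ := (5 - 2 * α) / ((1 - 2 * α) * (1 - α)) * α

/-- The two summands are the contributions of the moves of the mean in `sum_sub_mean_sq_le`: the
first comes from I to T to G, the second from G to S. Monotonicity in α is also evident in this
form. -/
theorem excess_eq {α : ℝ} (h : α < 1 / 2) :
    excess α = 4 * (α / ((1 - 2 * α) * (1 - α))) + α / (1 - α) := by
  have h1 : 1 - 2 * α ≠ 0 := by linarith
  have h2 : 1 - α ≠ 0 := by linarith
  rw [excess]; field_simp; ring

/-- The mean over a set `I` of points of the label class `P` which is spread less than the correctly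
labeled points is a good center for the true cluster `S`. -/
theorem sum_sub_mean_sq_le [DecidableEq ι] (x : ι → ℝ) {P S I : Finset ι} {α : ℝ} (h0 : 0 ≤ α)
    (h2 : α < 1 / 2) (hG : (1 - α) * max (P.card : ℝ) S.card ≤ (P ∩ S).card) (hP : P.Nonempty)
    (hI : I ⊆ P) (hIc : (1 - α) * P.card ≤ I.card) (hsse : sse x I ≤ sse x (P ∩ S)) :
    ∑ p ∈ S, (x p - mean x I) ^ 2 ≤ (1 + excess α) * sse x S := by
  set G := P ∩ S with hGdef
  set T := I ∩ G with hTdef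
  have hTI : T ⊆ I := inter_subset_left
  have hTG : T ⊆ G := inter_subset_right
  have hGS : G ⊆ S := inter_subset_right
  have hGP : G ⊆ P := inter_subset_left
  have hm0 : 0 < (P.card : ℝ) := by exact_mod_cast hP.card_pos
  have hGm : (1 - α) * P.card ≤ G.card :=
    (mul_le_mul_of_nonneg_left (le_max_left _ _) (by linarith)).trans hG
  have hGs : (1 - α) * S.card ≤ G.card :=
    (mul_le_mul_of_nonneg_left (le_max_right _ _) (by linarith)).trans hG
  -- Both sets lie in `P`, so their overlap has at least (1 - 2α)|P| points; this is where α < 1/2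
  -- is needed.
  have hcard : (I.card : ℝ) + G.card ≤ P.card + T.card := by
    have h1 := card_union_add_card_inter I G
    have h2 := card_le_card (union_subset hI hGP)
    rw [← hTdef] at h1
    exact_mod_cast (by omega : I.card + G.card ≤ P.card + T.card)
  have hGle : (G.card : ℝ) ≤ P.card := by exact_mod_cast card_le_card hGP
  have hIle : (I.card : ℝ) ≤ P.card := by exact_mod_cast card_le_card hI
  have hTle : (T.card : ℝ) ≤ I.card := by exact_mod_cast card_le_card hTI
  have hTle' : (T.card : ℝ) ≤ G.card := by exact_mod_cast card_le_card hTG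
  have hGSle : (G.card : ℝ) ≤ S.card := by exact_mod_cast card_le_card hGS
  have ht0 : 0 < (T.card : ℝ) := by nlinarith
  have hT : T.Nonempty := card_pos.1 (by exact_mod_cast ht0)
  have hu := mean_sub_mean_sq_le x hTI hT
  have hw := mean_sub_mean_sq_le x hTG hT
  have hz := mean_sub_mean_sq_le x hGS (hT.mono hTG)
  have hT0 := sse_nonneg x T
  have hG0 := sse_nonneg x G
  have hGSs : sse x G ≤ sse x S := by
    have h := sse_le x G (mean x S)
    exact h.trans (sum_le_sum_of_subset_of_nonneg hGS fun _ _ _ => sq_nonneg _)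
  rw [sum_sub_sq]
  set s := (S.card : ℝ)
  set g := (G.card : ℝ)
  set a := (I.card : ℝ)
  set t := (T.card : ℝ)
  set m := (P.card : ℝ)
  set u := mean x I - mean x T
  set w := mean x G - mean x T
  set z := mean x S - mean x G
  set y := sse x G
  set Y := sse x S
  have h1α : 0 < 1 - α := by linarith
  have h2α : 0 < 1 - 2 * α := by linarith
  have hg0 : 0 < g := ht0.trans_le hTle'
  have ha0 : 0 < a := ht0.trans_le hTle
  have hmS : mean x S - mean x I = z + w - u := by simp only [z, w, u]; ring
  rw [hmS, excess_eq h2]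
  set A := α / ((1 - 2 * α) * (1 - α)) with hA
  set B := α / (1 - α) with hB
  have hA0 : 0 ≤ A := by positivity
  have hB0 : 0 ≤ B := by positivity
  -- the three steps from the mean of `I` to the mean of `S`
  have hU : s * u ^ 2 ≤ A * y := by
    have e1 : (1 - α) * (s * (a * (t * u ^ 2))) ≤ g * ((a - t) * y) := by
      have : a * (t * u ^ 2) ≤ (a - t) * y :=
        hu.trans (mul_le_mul_of_nonneg_left (by linarith) (by linarith))
      calc _ = ((1 - α) * s) * (a * (t * u ^ 2)) := by ring
        _ ≤ g * (a * (t * u ^ 2)) := mul_le_mul_of_nonneg_right hGs (by positivity)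
        _ ≤ _ := mul_le_mul_of_nonneg_left this hg0.le
    have e2 : (1 - 2 * α) * (g * (a - t)) ≤ α * (a * t) := by
      have e3 : a - t ≤ m - g := by linarith
      -- On g ≥ (1-α)m ≥ m/2 the product g(m - g) decreases in g, so its maximum is at g = (1-α)m.
      have e4 : g * (m - g) ≤ (1 - α) * m * (α * m) := by
        have e9 : α * m ≤ (1 - α) * m := mul_le_mul_of_nonneg_right (by linarith) hm0.le
        nlinarith [mul_nonneg (sub_nonneg.2 hGm) (sub_nonneg.2 (e9.trans hGm))]
      have e5 : (1 - α) * m * (α * m) * (1 - 2 * α) ≤ α * (a * t) := by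
        have : (1 - α) * m * ((1 - 2 * α) * m) ≤ a * t :=
          mul_le_mul hIc (by linarith) (by positivity) ha0.le
        have := mul_le_mul_of_nonneg_left this h0
        linarith
      have e6 : g * (a - t) ≤ (1 - α) * m * (α * m) :=
        (mul_le_mul_of_nonneg_left e3 hg0.le).trans e4
      have := mul_le_mul_of_nonneg_left e6 h2α.le
      linarith
    have e7 : (1 - 2 * α) * (1 - α) * (s * u ^ 2) * (a * t) ≤ α * y * (a * t) := by
      have := mul_le_mul_of_nonneg_left e1 h2α.le
      have := mul_le_mul_of_nonneg_right e2 hG0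
      linarith
    have e8 := le_of_mul_le_mul_right e7 (by positivity)
    rw [hA, div_mul_eq_mul_div, le_div_iff₀ (by positivity)]
    linarith
  have hW : s * w ^ 2 ≤ A * y := by
    have e1 : (1 - α) * (s * (t * w ^ 2)) ≤ (g - t) * y := by
      have : g * (t * w ^ 2) ≤ (g - t) * y :=
        hw.trans (mul_le_mul_of_nonneg_left (by linarith) (by linarith))
      refine le_trans ?_ this
      calc _ = ((1 - α) * s) * (t * w ^ 2) := by ring
        _ ≤ _ := mul_le_mul_of_nonneg_right hGs (by positivity)
    have e2 : (1 - 2 * α) * (g - t) ≤ α * t := by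
      have e3 := mul_le_mul_of_nonneg_left (by linarith : g - α * m ≤ t) h1α.le
      have e4 := mul_le_mul_of_nonneg_left hGm h0
      linarith
    have e7 : (1 - 2 * α) * (1 - α) * (s * w ^ 2) * t ≤ α * y * t := by
      have := mul_le_mul_of_nonneg_left e1 h2α.le
      have := mul_le_mul_of_nonneg_right e2 hG0
      linarith
    have e8 := le_of_mul_le_mul_right e7 ht0
    rw [hA, div_mul_eq_mul_div, le_div_iff₀ (by positivity)]
    linarith
  have hZ : s * z ^ 2 ≤ B * (Y - y) := by
    have e1 : (s * z ^ 2) * g ≤ (s - g) * (Y - y) := by linarith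
    have e2 : (1 - α) * (s - g) ≤ α * g := by linarith
    have e3 : (1 - α) * (s * z ^ 2) * g ≤ α * (Y - y) * g := by
      have := mul_le_mul_of_nonneg_left e1 h1α.le
      have := mul_le_mul_of_nonneg_right e2 (sub_nonneg.2 hGSs)
      linarith
    have e4 := le_of_mul_le_mul_right e3 hg0
    rw [hB, div_mul_eq_mul_div, le_div_iff₀ h1α]
    linarith
  have hs0 : 0 ≤ s := hg0.le.trans hGSle
  -- From (w - u)² ≤ 2w² + 2u².
  have hV : s * (w - u) ^ 2 ≤ 4 * A * y := by
    linarith [mul_nonneg hs0 (sq_nonneg (w + u))]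
  -- AM–GM on the product of `hZ` and `hV`. The split is chosen so that the missing parts of `4 * A
  -- * Y` and `B * Y` are filled exactly; this relies on `hZ` being bounded by `Y - y` and not
  -- merely by `Y`.
  have hcross : s * (2 * (z * (w - u))) ≤ 4 * A * (Y - y) + B * y := by
    have hd : 0 ≤ Y - y := sub_nonneg.2 hGSs
    have hle : (s * z ^ 2) * (s * (w - u) ^ 2) ≤ (B * (Y - y)) * (4 * A * y) :=
      mul_le_mul hZ hV (by positivity) (by positivity)
    refine le_of_abs_le (sq_le_sq.1 ?_ |>.trans_eq (abs_of_nonneg (by positivity)))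
    have := sq_nonneg (4 * A * (Y - y) - B * y)
    calc _ = 4 * ((s * z ^ 2) * (s * (w - u) ^ 2)) := by ring
      _ ≤ 4 * ((B * (Y - y)) * (4 * A * y)) := by linarith
      _ ≤ _ := by linarith
  linarith

end Line

end MinSum

/-! ### The guarantee of capacitated assignments to good centers -/

namespace MinSum

variable {n d k : ℕ}

theorem sum_cluster (C : Fin n → Fin k) (f : Fin n → Fin k → ℝ) :
    ∑ i, ∑ p ∈ cluster C i, f p i = ∑ p, f p (C p) := by
  rw [← sum_fiberwise univ C fun p => f p (C p)]
  refine sum_congr rfl fun i _ => sum_congr rfl fun p hp => ?_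
  rw [(mem_filter.1 hp).2]

theorem cost_eq_sum_sse (x : Fin n → EuclideanSpace ℝ (Fin d)) (C : Fin n → Fin k) :
    cost x C = ∑ i, ∑ j, 2 * ((cluster C i).card : ℝ) * sse (fun p => x p j) (cluster C i) := by
  refine sum_congr rfl fun i _ => ?_
  simp only [EuclideanSpace.real_norm_sq_eq, PiLp.sub_apply, ← sum_sum_sub_sq]
  symm
  rw [sum_comm]
  refine sum_congr rfl fun p _ => ?_
  rw [sum_comm]

/-- The form in which the program evaluates the cost. -/
theorem cost_eq_sum_ite (x : Fin n → EuclideanSpace ℝ (Fin d)) (C : Fin n → Fin k) :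
    cost x C = ∑ p, ∑ q, if C p = C q then ∑ j, (x p j - x q j) ^ 2 else 0 := by
  rw [cost, sum_cluster C fun p i => ∑ q ∈ cluster C i, ‖x p - x q‖ ^ 2]
  refine sum_congr rfl fun p _ => ?_
  rw [cluster, sum_filter]
  refine sum_congr rfl fun q _ => ?_
  simp only [EuclideanSpace.real_norm_sq_eq, PiLp.sub_apply, eq_comm]

theorem cost_nonneg (x : Fin n → EuclideanSpace ℝ (Fin d)) (C : Fin n → Fin k) : 0 ≤ cost x C :=
  sum_nonneg fun _ _ => sum_nonneg fun _ _ => sum_nonneg fun _ _ => sq_nonneg _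

/-- The capacities bound |Q_i| by |P_i|/(1-α), and precision bounds |P_i| by |S_i|/(1-α); between
these two exchanges of weights stands the optimality of the assignment. Empty label classes have
weight zero, so nothing is asked of their centers. -/
theorem cost_le_of_assignment {x : Fin n → EuclideanSpace ℝ (Fin d)} {P S Q : Fin n → Fin k}
    {C : Fin k → Fin d → ℝ} {α : ℝ} (h0 : 0 ≤ α) (h2 : α < 1 / 2)
    (hS : ∀ i, (1 - α) * max ((cluster P i).card : ℝ) ((cluster S i).card : ℝ) ≤
      ((cluster P i ∩ cluster S i).card : ℝ))
    (hC : ∀ i j, (cluster P i).Nonempty → ∑ p ∈ cluster S i, (x p j - C i j) ^ 2 ≤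
      (1 + excess α) * sse (fun p => x p j) (cluster S i))
    (hcap : ∀ i, (1 - α) * ((cluster Q i).card : ℝ) ≤ (cluster P i).card)
    (hopt : ∑ p, ((cluster P (Q p)).card : ℝ) * ∑ j, (x p j - C (Q p) j) ^ 2 ≤
      ∑ p, ((cluster P (S p)).card : ℝ) * ∑ j, (x p j - C (S p) j) ^ 2) :
    cost x Q ≤ (1 + excess α) / (1 - α) ^ 2 * cost x S := by
  have h1 : 0 < 1 - α := by linarith
  have key : ∀ R : Fin n → Fin k, ∑ p, ((cluster P (R p)).card : ℝ) * ∑ j, (x p j - C (R p) j) ^ 2 =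
      ∑ i, ∑ j, ((cluster P i).card : ℝ) * ∑ p ∈ cluster R i, (x p j - C i j) ^ 2 := by
    intro R
    rw [← sum_cluster R fun p i => ((cluster P i).card : ℝ) * ∑ j, (x p j - C i j) ^ 2]
    refine sum_congr rfl fun i _ => ?_
    rw [← mul_sum, sum_comm, mul_sum]
  rw [key, key] at hopt
  have hex : 0 ≤ 1 + excess α := by
    have : 0 ≤ excess α := by
      have : 0 < 1 - 2 * α := by linarith
      rw [excess_eq h2]; positivity
    linarith
  have hQ : (1 - α) * cost x Q ≤
      2 * ∑ i, ∑ j, ((cluster P i).card : ℝ) * ∑ p ∈ cluster Q i, (x p j - C i j) ^ 2 := by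
    rw [cost_eq_sum_sse, mul_sum, mul_sum]
    refine sum_le_sum fun i _ => ?_
    rw [mul_sum, mul_sum]
    refine sum_le_sum fun j _ => ?_
    have e1 := sse_le (fun p => x p j) (cluster Q i) (C i j)
    have e2 := mul_le_mul (hcap i) e1 (sse_nonneg _ _) (Nat.cast_nonneg _)
    linarith
  have hSS : (1 - α) * ∑ i, ∑ j, ((cluster P i).card : ℝ) * ∑ p ∈ cluster S i, (x p j - C i j) ^ 2
      ≤ (1 + excess α) * (cost x S / 2) := by
    rw [cost_eq_sum_sse, sum_div, mul_sum, mul_sum]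
    refine sum_le_sum fun i _ => ?_
    rw [sum_div, mul_sum, mul_sum]
    refine sum_le_sum fun j _ => ?_
    have e0 := sse_nonneg (fun p => x p j) (cluster S i)
    rcases (cluster P i).eq_empty_or_nonempty with hP | hP
    · rw [hP, card_empty]
      simp only [Nat.cast_zero, zero_mul, mul_zero]
      positivity
    · have e1 : (1 - α) * ((cluster P i).card : ℝ) ≤ (cluster S i).card := by
        refine (mul_le_mul_of_nonneg_left (le_max_left _ _) h1.le).trans ((hS i).trans ?_)
        exact_mod_cast card_le_card inter_subset_right
      have e2 := mul_le_mul e1 (hC i j hP) (sum_nonneg fun _ _ => sq_nonneg _) (Nat.cast_nonneg _)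
      linarith
  rw [div_mul_eq_mul_div, le_div_iff₀ (by positivity)]
  nlinarith

/-! ### The integer problem -/

/-- The order of the points along a coordinate, with ties broken by the index. -/
def sortKey (X : Fin n → ℤ) (p : Fin n) : ℤ := n * X p + (p : ℕ)

/-- Indices are less than n, so the tie-breaker never outweighs a difference of one in the
coordinate. -/
theorem sortKey_le {X : Fin n → ℤ} {p q : Fin n} (h : sortKey X p ≤ sortKey X q) : X p ≤ X q := by
  by_contra! hlt
  have hp := p.2
  have hq := q.2
  unfold sortKey at h
  have : (n : ℤ) * (X q + 1) ≤ n * X p := mul_le_mul_of_nonneg_left hlt (by positivity)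
  rw [mul_add, mul_one] at this
  omega

theorem sortKey_injective (X : Fin n → ℤ) : Function.Injective (sortKey X) := by
  intro p q h
  have h1 := sortKey_le h.le
  have h2 := sortKey_le h.ge
  unfold sortKey at h
  rw [le_antisymm h1 h2] at h
  exact Fin.ext (by omega)

/-- `C` is the mean of a set of at least `(1 - b/c)|A|` points of `A` whose spread is minimal among
the intervals of this size. -/
def IsCenter (X : Fin n → ℤ) (A : Finset (Fin n)) (b c C : ℤ) : Prop :=
  ∃ I ⊆ A, I.Nonempty ∧ (c - b) * A.card ≤ c * I.card ∧ C * I.card = ∑ p ∈ I, X p ∧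
    ∀ p q e, (between (sortKey X) A p q).Nonempty →
      (c - b) * A.card ≤ c * (between (sortKey X) A p q).card →
      e * (between (sortKey X) A p q).card = ∑ r ∈ between (sortKey X) A p q, X r →
      ∑ r ∈ I, (X r - C) ^ 2 ≤ ∑ r ∈ between (sortKey X) A p q, (X r - e) ^ 2

theorem cast_eq_mean {X : Fin n → ℤ} {I : Finset (Fin n)} {C : ℤ} (hI : I.Nonempty)
    (h : C * I.card = ∑ p ∈ I, X p) : (C : ℝ) = mean (fun p => (X p : ℝ)) I := by
  have : (I.card : ℝ) ≠ 0 := by exact_mod_cast hI.card_pos.ne'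
  rw [mean, eq_div_iff this]
  exact_mod_cast h

/-- The correctly labeled points need not be an interval, but `exists_between_sum_le` provides an
interval of the same size that is spread no more, and the set behind the center was compared with
this interval. Divisibility by n! makes the mean of the interval an integer, as the comparison
requires. -/
theorem IsCenter.sum_le {X : Fin n → ℤ} (hX : ∀ p, (n.factorial : ℤ) ∣ X p)
    {P S : Finset (Fin n)} {b c C : ℤ} (hb : 0 ≤ b) (hbc : 2 * b < c)
    (hG : (1 - (b / c : ℝ)) * max (P.card : ℝ) S.card ≤ (P ∩ S).card) (hP : P.Nonempty)
    (hC : IsCenter X P b c C) :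
    ∑ p ∈ S, ((X p : ℝ) - C) ^ 2 ≤ (1 + excess (b / c)) * sse (fun p => (X p : ℝ)) S := by
  obtain ⟨I, hIP, hI, hIc, hsum, hmin⟩ := hC
  have hc0 : (0 : ℝ) < c := by exact_mod_cast (by omega : 0 < c)
  have hb0 : (0 : ℝ) ≤ b := by exact_mod_cast hb
  have h2 : (b / c : ℝ) < 1 / 2 := by
    rw [div_lt_iff₀ hc0]
    have : (2 * b : ℝ) < c := by exact_mod_cast hbc
    linarith
  have hmul : ∀ y z : ℝ, (1 - (b / c : ℝ)) * y ≤ z ↔ (c - b) * y ≤ c * z := by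
    intro y z
    rw [← mul_le_mul_iff_right₀ hc0]
    field_simp
  have hGP : (1 - (b / c : ℝ)) * (P.card : ℝ) ≤ (P ∩ S).card :=
    (mul_le_mul_of_nonneg_left (le_max_left _ _) (by linarith)).trans hG
  have hGne : (P ∩ S).Nonempty := by
    have h1 : (0 : ℝ) < P.card := by exact_mod_cast hP.card_pos
    have h3 : 0 < (1 - (b / c : ℝ)) * P.card := mul_pos (by linarith) h1
    exact card_pos.1 (by exact_mod_cast h3.trans_le hGP)
  rw [cast_eq_mean hI hsum]
  refine sum_sub_mean_sq_le _ (div_nonneg hb0 hc0.le) h2 hG hP hIP ?_ ?_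
  · rw [hmul]; exact_mod_cast hIc
  · obtain ⟨p, q, hcard, hle⟩ := exists_between_sum_le (x := fun p => (X p : ℝ))
      (sortKey_injective X) (fun p q h => by exact_mod_cast sortKey_le h) hGne inter_subset_left
      (mean (fun p => (X p : ℝ)) (P ∩ S))
    have hJ : (between (sortKey X) P p q).Nonempty := card_pos.1 (hcard ▸ hGne.card_pos)
    obtain ⟨e, he⟩ : ((between (sortKey X) P p q).card : ℤ) ∣
        ∑ r ∈ between (sortKey X) P p q, X r := by
      refine dvd_sum fun r _ => dvd_trans ?_ (hX r)
      exact_mod_cast Nat.dvd_factorial hJ.card_pos (card_finset_fin_le _)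
    have he' : e * (between (sortKey X) P p q).card = ∑ r ∈ between (sortKey X) P p q, X r := by
      rw [he, mul_comm]
    have h3 := hmin p q e hJ (by
      rw [hcard]
      have := (hmul _ _).1 hGP
      exact_mod_cast this) he'
    have h4 : sse (fun p => (X p : ℝ)) I ≤ ∑ r ∈ between (sortKey X) P p q, ((X r : ℝ) - e) ^ 2 := by
      rw [sse, ← cast_eq_mean hI hsum]
      exact_mod_cast h3
    rw [cast_eq_mean hJ he', ← sse] at h4
    exact h4.trans ((sse_le _ _ _).trans hle)

/-- The cost of a clustering of points with integer coordinates. -/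
def intCost (X : Fin n → Fin d → ℤ) (Q : Fin n → Fin k) : ℤ :=
  ∑ p, ∑ q, if Q p = Q q then ∑ j, (X p j - X q j) ^ 2 else 0

/-- `Q` is an optimal assignment to centers for the error rate `b/c`, subject to the capacities
`|P i|/(1 - b/c)`. -/
def IsAssignment (X : Fin n → Fin d → ℤ) (P : Fin n → Fin k) (b c : ℤ) (Q : Fin n → Fin k) : Prop :=
  ∃ C : Fin k → Fin d → ℤ,
    (∀ i j, (cluster P i).Nonempty → IsCenter (fun p => X p j) (cluster P i) b c (C i j)) ∧
    (∀ i, (c - b) * (cluster Q i).card ≤ c * (cluster P i).card) ∧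
    ∀ S : Fin n → Fin k, (∀ i, (c - b) * ((cluster S i).card : ℤ) ≤ c * (cluster P i).card) →
      ∑ p, ((cluster P (Q p)).card : ℤ) * ∑ j, (X p j - C (Q p) j) ^ 2 ≤
        ∑ p, ((cluster P (S p)).card : ℤ) * ∑ j, (X p j - C (S p) j) ^ 2

theorem cost_toPoints {x : Fin n → Fin d → ℚ} {X : Fin n → Fin d → ℤ} {D : ℤ}
    (hX : ∀ p j, (X p j : ℚ) = D * x p j) (Q : Fin n → Fin k) :
    (D : ℝ) ^ 2 * cost (toPoints x) Q = cost (toPoints fun p j => (X p j : ℚ)) Q := by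
  rw [cost_eq_sum_ite, cost_eq_sum_ite]
  simp only [mul_sum, mul_ite, mul_zero]
  refine sum_congr rfl fun p _ => sum_congr rfl fun q _ => ?_
  congr 1
  refine sum_congr rfl fun j _ => ?_
  simp only [toPoints, hX]
  push_cast
  ring

theorem cost_toPoints_int (X : Fin n → Fin d → ℤ) (Q : Fin n → Fin k) :
    cost (toPoints fun p j => (X p j : ℚ)) Q = intCost X Q := by
  rw [cost_eq_sum_ite, intCost]
  simp [toPoints]

/-- The clustering `S` competes in the assignment problem: recall bounds (1 - b/c)|S_i| by |P_i|,
which is the capacity constraint. -/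
theorem IsAssignment.cost_le {X : Fin n → Fin d → ℤ} (hX : ∀ p j, (n.factorial : ℤ) ∣ X p j)
    {P S Q : Fin n → Fin k} {b c : ℤ} (hb : 0 ≤ b) (hbc : 2 * b < c)
    (hS : ∀ i, (1 - (b / c : ℝ)) * max ((cluster P i).card : ℝ) ((cluster S i).card : ℝ) ≤
      ((cluster P i ∩ cluster S i).card : ℝ)) (hQ : IsAssignment X P b c Q) :
    (intCost X Q : ℝ) ≤ (1 + excess (b / c)) / (1 - b / c) ^ 2 * intCost X S := by
  obtain ⟨C, hC, hcap, hopt⟩ := hQ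
  have hc0 : (0 : ℝ) < c := by exact_mod_cast (by omega : 0 < c)
  have hb0 : (0 : ℝ) ≤ b := by exact_mod_cast hb
  have h2 : (b / c : ℝ) < 1 / 2 := by
    rw [div_lt_iff₀ hc0]
    have : (2 * b : ℝ) < c := by exact_mod_cast hbc
    linarith
  have hmul : ∀ y z : ℝ, (1 - (b / c : ℝ)) * y ≤ z ↔ (c - b) * y ≤ c * z := by
    intro y z
    rw [← mul_le_mul_iff_right₀ hc0]
    field_simp
  rw [← cost_toPoints_int, ← cost_toPoints_int]
  refine cost_le_of_assignment (C := fun i j => (C i j : ℝ)) (P := P) (div_nonneg hb0 hc0.le) h2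
    hS ?_ ?_ ?_
  · intro i j hP
    have := (hC i j hP).sum_le (fun p => hX p j) hb hbc (hS i) hP
    simpa [toPoints] using this
  · intro i
    rw [hmul]
    exact_mod_cast hcap i
  · have hSP : ∀ i, (c - b) * ((cluster S i).card : ℤ) ≤ c * (cluster P i).card := by
      intro i
      have h3 := (mul_le_mul_of_nonneg_left
        (le_max_right ((cluster P i).card : ℝ) ((cluster S i).card : ℝ)) (by linarith)).trans (hS i)
      have h4 : ((cluster P i ∩ cluster S i).card : ℝ) ≤ (cluster P i).card := by
        exact_mod_cast card_le_card inter_subset_left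
      have := (hmul _ _).1 (h3.trans h4)
      exact_mod_cast this
    have := hopt S hSP
    simp only [toPoints, Rat.cast_intCast]
    exact_mod_cast this

theorem excess_mono {α β : ℝ} (h0 : 0 ≤ α) (h : α ≤ β) (h2 : β < 1 / 2) : excess α ≤ excess β := by
  have h3 : 0 < 1 - 2 * β := by linarith
  have h4 : 0 < 1 - β := by linarith
  rw [excess_eq h2, excess_eq (h.trans_lt h2)]
  gcongr <;> linarith

/-- Transfers the guarantee from the tried rate b/c to every α above it. -/
theorem ratio_mono {α β : ℝ} (h0 : 0 ≤ α) (h : α ≤ β) (h2 : β < 1 / 2) :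
    (1 + excess α) / (1 - α) ^ 2 ≤ (1 + excess β) / (1 - β) ^ 2 := by
  have h3 : 0 < 1 - β := by linarith
  have h4 := excess_mono h0 h h2
  have h5 : 0 ≤ excess α := by
    have : 0 < 1 - 2 * α := by linarith
    have : 0 < 1 - α := by linarith
    rw [excess_eq (h.trans_lt h2)]; positivity
  gcongr
  linarith

/-- The factor (5 - 2α)/((1 - 2α)(1 - α)) increases in α and equals 7.7 at α = 1/7. -/
theorem excess_le {α : ℝ} (h0 : 0 ≤ α) (h : α < 1 / 7) : excess α ≤ 7.7 * α := by
  have h3 : 0 < 1 - 2 * α := by linarith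
  have h4 : 0 < 1 - α := by linarith
  rw [excess]
  refine mul_le_mul_of_nonneg_right ?_ h0
  rw [div_le_iff₀ (by positivity)]
  nlinarith

/-- The smallest error rate for which the labels are correct is a fraction with small terms. -/
theorem exists_error_rate {P S : Fin n → Fin k} (hn : 0 < n) {α : ℝ} (h2 : α < 1 / 2)
    (hS : ∀ i, (1 - α) * max ((cluster P i).card : ℝ) ((cluster S i).card : ℝ) ≤
      ((cluster P i ∩ cluster S i).card : ℝ)) (h0 : 0 ≤ α) :
    ∃ b c : ℤ, 0 ≤ b ∧ 2 * b < c ∧ c ≤ n ∧ (b / c : ℝ) ≤ α ∧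
      ∀ i, (1 - (b / c : ℝ)) * max ((cluster P i).card : ℝ) ((cluster S i).card : ℝ) ≤
        ((cluster P i ∩ cluster S i).card : ℝ) := by
  let c : Fin k → ℕ := fun i => max (cluster P i).card (cluster S i).card
  let g : Fin k → ℕ := fun i => (cluster P i ∩ cluster S i).card
  have hgc : ∀ i, g i ≤ c i := fun i =>
    (card_le_card inter_subset_left).trans (le_max_left _ _)
  have hcn : ∀ i, c i ≤ n := fun i => max_le (card_finset_fin_le _) (card_finset_fin_le _)
  have hS' : ∀ i, (1 - α) * (c i : ℝ) ≤ g i := fun i => by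
    simpa only [c, g, Nat.cast_max] using hS i
  -- The least rate valid for all classes is the largest ratio of misplaced points. The maximum with
  -- 1 gives ratio 0 to an index whose two clusters are empty.
  obtain ⟨i₀, -, hmax⟩ := exists_max_image univ
    (fun i => ((c i : ℝ) - g i) / (max (c i) 1 : ℕ)) ⟨P ⟨0, hn⟩, mem_univ _⟩
  have hpos : (0 : ℝ) < (max (c i₀) 1 : ℕ) := by exact_mod_cast (by omega)
  have hle : ((c i₀ : ℝ) - g i₀) ≤ α * c i₀ := by linarith [hS' i₀]
  have hlt : 2 * (c i₀ - g i₀ : ℤ) < (max (c i₀) 1 : ℕ) := by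
    rcases Nat.eq_zero_or_pos (c i₀) with h | h
    · have := hgc i₀
      rw [h]; push_cast; omega
    · rw [max_eq_left h]
      have h' : (0 : ℝ) < c i₀ := by exact_mod_cast h
      have : 2 * ((c i₀ : ℝ) - g i₀) < c i₀ := by nlinarith
      exact_mod_cast this
  refine ⟨c i₀ - g i₀, (max (c i₀) 1 : ℕ), by have := hgc i₀; omega, hlt,
    by have := hcn i₀; omega, ?_, fun i => ?_⟩
  · push_cast
    push_cast at hpos
    rw [div_le_iff₀ hpos]
    exact hle.trans (mul_le_mul_of_nonneg_left (le_max_left _ _) h0)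
  · have h3 := hmax i (mem_univ i)
    have e1 : max ((cluster P i).card : ℝ) ((cluster S i).card : ℝ) = c i := by
      simp only [c, Nat.cast_max]
    rw [e1]
    change _ ≤ (g i : ℝ)
    rcases Nat.eq_zero_or_pos (c i) with h | h
    · rw [h]; simp
    · rw [max_eq_left (show 1 ≤ c i from h)] at h3
      have h' : (0 : ℝ) < c i := by exact_mod_cast h
      rw [div_le_iff₀ h'] at h3
      push_cast at h3 ⊢
      linarith

/-- A clustering that is as cheap as an optimal assignment for each error rate `b/c` with
`c ≤ n` has the guarantee for all error rates. -/
theorem guarantee {x : Fin n → Fin d → ℚ} {X : Fin n → Fin d → ℤ} {D : ℤ} (hD : 0 < D)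
    (hX : ∀ p j, (X p j : ℚ) = D * x p j) (hdvd : ∀ p j, (n.factorial : ℤ) ∣ X p j)
    {P Q : Fin n → Fin k}
    (hQ : ∀ b c : ℤ, 0 ≤ b → 2 * b < c → c ≤ n →
      ∃ Q', IsAssignment X P b c Q' ∧ intCost X Q ≤ intCost X Q')
    {α : ℝ} (h0 : 0 ≤ α) (h2 : α < 1 / 2) (hα : IsLabelPredictor (toPoints x) P α) :
    (α < 1 / 7 → cost (toPoints x) Q ≤ (1 + 7.7 * α) / (1 - α) ^ 2 * opt k (toPoints x)) ∧
      cost (toPoints x) Q ≤ (1 + (5 - 2 * α) / ((1 - 2 * α) * (1 - α)) * α) / (1 - α) ^ 2 *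
        opt k (toPoints x) := by
  obtain ⟨S, hSopt, hS⟩ := hα
  have hne : Nonempty (Fin n → Fin k) := ⟨S⟩
  have hopt : opt k (toPoints x) = cost (toPoints x) S :=
    le_antisymm (ciInf_le ⟨0, by rintro _ ⟨C, rfl⟩; exact cost_nonneg _ _⟩ S) (le_ciInf hSopt)
  have h1 : 0 < 1 - α := by linarith
  have hmain : cost (toPoints x) Q ≤ (1 + excess α) / (1 - α) ^ 2 * cost (toPoints x) S := by
    rcases Nat.eq_zero_or_pos n with rfl | hn
    -- Without points there is no fraction with 0 < c ≤ n to try, but all costs vanish.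
    · have hz : ∀ C : Fin 0 → Fin k, cost (toPoints x) C = 0 := fun C => by
        rw [cost_eq_sum_ite]; simp
      rw [hz, hz, mul_zero]
    · obtain ⟨b, c, hb, hbc, hcn, hle, hS'⟩ := exists_error_rate hn h2 hS h0
      obtain ⟨Q', hQ', hcost⟩ := hQ b c hb hbc hcn
      have h3 := hQ'.cost_le hdvd hb hbc hS'
      have hc0 : (0 : ℝ) < c := by exact_mod_cast (by omega : 0 < c)
      have hb0 : (0 : ℝ) ≤ b := by exact_mod_cast hb
      have h4 : (intCost X Q : ℝ) ≤ intCost X Q' := by exact_mod_cast hcost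
      have h5 : (0 : ℝ) ≤ intCost X S := by
        rw [← cost_toPoints_int]; exact cost_nonneg _ _
      have h6 := (h4.trans h3).trans
        (mul_le_mul_of_nonneg_right (ratio_mono (div_nonneg hb0 hc0.le) hle h2) h5)
      rw [← cost_toPoints_int, ← cost_toPoints_int, ← cost_toPoints hX, ← cost_toPoints hX] at h6
      have hD2 : (0 : ℝ) < (D : ℝ) ^ 2 := by
        have : (0 : ℝ) < D := by exact_mod_cast hD
        positivity
      refine le_of_mul_le_mul_left ?_ hD2
      linarith
  rw [hopt]
  refine ⟨fun h7 => hmain.trans (mul_le_mul_of_nonneg_right ?_ (cost_nonneg _ _)), hmain⟩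
  have := excess_le h0 h7
  gcongr

end MinSum

/-! ### The program -/

namespace LogRAM

notation "vP" => (5 : ℕ)
notation "vQ" => (6 : ℕ)
notation "vR" => (7 : ℕ)
notation "vI" => (8 : ℕ)
notation "vJ" => (9 : ℕ)
notation "vB" => (10 : ℕ)
notation "vC" => (11 : ℕ)
notation "vS" => (12 : ℕ)
notation "vT" => (13 : ℕ)
notation "vH" => (14 : ℕ)
notation "tOut" => (4 : ℕ)
notation "tD" => (20 : ℕ)
notation "tX" => (21 : ℕ)
notation "tM" => (22 : ℕ)
notation "tCnt" => (23 : ℕ)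
notation "tSum" => (24 : ℕ)
notation "tCen" => (25 : ℕ)
notation "tC" => (26 : ℕ)
notation "tU" => (27 : ℕ)
notation "tQ" => (28 : ℕ)
notation "tR" => (29 : ℕ)
notation "tK" => (30 : ℕ)
notation "tHas" => (31 : ℕ)
notation "tBq" => (32 : ℕ)
notation "tBi" => (33 : ℕ)
notation "tMov" => (34 : ℕ)
notation "tCur" => (35 : ℕ)
notation "tTmp" => (36 : ℕ)
notation "tPt" => (37 : ℕ)
notation "tRk" => (38 : ℕ)
notation "tDone" => (39 : ℕ)
notation "tAcc" => (40 : ℕ)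
notation "tVal" => (41 : ℕ)
notation "tBest" => (42 : ℕ)
notation "tW" => (43 : ℕ)
notation "tLam" => (44 : ℕ)
notation "tCost" => (45 : ℕ)
notation "tOpt" => (46 : ℕ)

infixr:60 " ;; " => FProg.seq

/-- The levels of the tables: inputs and counters have level `0`, coordinates and indices level `1`,
and squares of coordinates level `2`. -/
def tableLevel (a : ℕ) : ℕ :=
  if a ≤ 3 then 0 else if a = 4 then 1 else if a ≤ 14 then 0 else if a ≤ 39 then 1 else 2

namespace Expr

/-- The scalar stored in the table `a`. -/
abbrev scalar (a : ℕ) : Expr := .get a (.const 0) (.const 0)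

/-- The entry of the column stored in the table `a` at the index held by the scalar `i`. -/
abbrev entry (a i : ℕ) : Expr := .get a (.scalar i) (.const 0)

/-- The entry of the matrix stored in the table `a` at the indices held by the scalars. -/
abbrev entry₂ (a i j : ℕ) : Expr := .get a (.scalar i) (.scalar j)

/-- The number `n`, `d` or `k` of the instance. -/
abbrev param (s : ℕ) : Expr := .get 0 (.const 0) (.const s)

/-- Positive if and only if the two values are equal. -/
abbrev eq (e f : Expr) : Expr := .sub (.const 1) (.mul (.sub e f) (.sub e f))

/-- Positive if and only if the first value is at most the second. -/
abbrev le (e f : Expr) : Expr := .add (.sub f e) (.const 1)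

/-- Positive if and only if the first value is less than the second. -/
abbrev lt (e f : Expr) : Expr := .sub f e

/-- The square of a value. -/
abbrev sq (e : Expr) : Expr := .mul e e

/-- The position of a point in the order along the coordinate `vJ`. -/
abbrev key (p : ℕ) : Expr := .add (.mul (.param 0) (.entry₂ tX p vJ)) (.scalar p)

end Expr

namespace FProg

/-- Assignment to a scalar. -/
abbrev put (a : ℕ) (e : Expr) : FProg := .set a (.const 0) (.const 0) e

/-- Conditional execution. -/
abbrev guard (e : Expr) (c : FProg) : FProg := .cond e c .skip

/-- Update the minimum `tBest` by the value of `e`, and execute `save` if it is smaller. -/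
abbrev offer (e : Expr) (save : FProg) : FProg :=
  put tVal e ;;
  -- If there is no minimum yet, the record is placed one above the offer, so that the strict
  -- comparison accepts it.
  guard (.sub (.const 1) (.scalar tHas)) (put tBest (.add (.scalar tVal) (.const 1))) ;;
  guard (.lt (.scalar tVal) (.scalar tBest))
    (put tHas (.const 1) ;; put tBest (.scalar tVal) ;; save)

/-- Compute the common denominator `tD` and the integer coordinates `tX`. -/
def scaleProg : FProg :=
  put tD (.const 1) ;;
  -- The factors `vP + 1` contribute n!, which makes the later divisions by the sizes of nonempty
  -- sets of points exact.
  .rep vP 0 (put tD (.mul (.scalar tD) (.add (.scalar vP) (.const 1))) ;;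
    .rep vJ 1 (put tD (.mul (.scalar tD) (.entry₂ 2 vP vJ)))) ;;
  .rep vP 0 (.rep vJ 1 (.set tX (.scalar vP) (.scalar vJ)
    (.mul (.entry₂ 1 vP vJ) (.div (.scalar tD) (.entry₂ 2 vP vJ)))))

/-- Compute the sizes `tM` of the label classes. -/
def countProg : FProg :=
  .rep vI 2 (.set tM (.scalar vI) (.const 0) (.const 0) ;;
    .rep vP 0 (guard (.eq (.entry 3 vP) (.scalar vI))
      (.set tM (.scalar vI) (.const 0) (.add (.entry tM vI) (.const 1)))))

/-- Start with the given labels. -/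
def initProg : FProg := .rep vP 0 (.set tQ (.scalar vP) (.const 0) (.entry 3 vP))

/-- Compute the cost `tCost` of the clustering `tQ`. -/
def costProg : FProg :=
  put tCost (.const 0) ;;
  .rep vP 0 (.rep vQ 0 (guard (.eq (.entry tQ vP) (.entry tQ vQ))
    (.rep vJ 1 (put tCost (.add (.scalar tCost)
      (.sq (.sub (.entry₂ tX vP vJ) (.entry₂ tX vQ vJ))))))))

/-- Keep the clustering `tQ` as output. -/
def keepProg : FProg :=
  .rep vP 0 (.set tOut (.scalar vP) (.const 0) (.entry tQ vP)) ;; put tOpt (.scalar tCost)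

/-- Execute `c` for each point `vR` of the cluster `vI` between the points `vP` and `vQ`. -/
abbrev forBetween (c : FProg) : FProg :=
  .rep vR 0 (guard (.eq (.entry 3 vR) (.scalar vI))
    (guard (.le (.key vP) (.key vR)) (guard (.le (.key vR) (.key vQ)) c)))

/-- The candidate interval with the ends `vP` and `vQ`. -/
def intervalProg : FProg :=
  put tCnt (.const 0) ;; put tSum (.const 0) ;;
  forBetween (put tCnt (.add (.scalar tCnt) (.const 1)) ;;
    put tSum (.add (.scalar tSum) (.entry₂ tX vR vJ))) ;;
  guard (.scalar tCnt)
    (guard (.le (.mul (.sub (.add (.scalar vC) (.const 1)) (.scalar vB)) (.entry tM vI))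
        (.mul (.add (.scalar vC) (.const 1)) (.scalar tCnt)))
      (put tCen (.div (.scalar tSum) (.scalar tCnt)) ;; put tAcc (.const 0) ;;
        forBetween (put tAcc (.add (.scalar tAcc) (.sq (.sub (.entry₂ tX vR vJ) (.scalar tCen))))) ;;
        offer (.scalar tAcc) (.set tC (.scalar vI) (.scalar vJ) (.scalar tCen))))

/-- Compute the centers `tC`. -/
def centerProg : FProg :=
  .rep vI 2 (.rep vJ 1 (put tHas (.const 0) ;; .rep vP 0 (.rep vQ 0 intervalProg)))

/-- Compute the assignment costs `tW` and the capacities `tU`. -/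
def weightProg : FProg :=
  .rep vP 0 (.rep vI 2 (put tAcc (.const 0) ;;
    .rep vJ 1 (put tAcc (.add (.scalar tAcc) (.sq (.sub (.entry₂ tX vP vJ) (.entry₂ tC vI vJ))))) ;;
    .set tW (.scalar vP) (.scalar vI) (.mul (.entry tM vI) (.scalar tAcc)))) ;;
  .rep vI 2 (.set tU (.scalar vI) (.const 0)
    (.div (.mul (.add (.scalar vC) (.const 1)) (.entry tM vI))
      (.sub (.add (.scalar vC) (.const 1)) (.scalar vB))))

/-- Find the point `tBq` of a reached cluster and the cluster `tBi` that is not yet reached for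
which the reduced cost `tBest` is minimal. -/
def slackProg : FProg :=
  put tHas (.const 0) ;;
  .rep vQ 0 (.rep vI 2 (guard (.get tR (.entry tQ vQ) (.const 0))
    (guard (.le (.entry tR vI) (.const 0))
      (offer (.sub (.add (.entry₂ tW vQ vI) (.entry tLam vI))
          (.add (.get tW (.scalar vQ) (.entry tQ vQ)) (.get tLam (.entry tQ vQ) (.const 0))))
        (put tBq (.scalar vQ) ;; put tBi (.scalar vI))))))

/-- Move a point to the cluster `tCur`, which lacks one. -/
def moveProg : FProg :=
  put tPt (.entry tMov tCur) ;; put tTmp (.scalar tCur) ;; put tCur (.entry tQ tPt) ;;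
  .set tQ (.scalar tPt) (.const 0) (.scalar tTmp)

/-- Add a point to the cluster `tBi`. -/
def augmentProg : FProg :=
  put tDone (.const 1) ;;
  .set tK (.scalar tBi) (.const 0) (.add (.entry tK tBi) (.const 1)) ;;
  put tCur (.scalar tBi) ;;
  .rep vT 2 (guard (.lt (.scalar tCur) (.param 2)) moveProg)

/-- Raise the prices of the reached clusters. -/
def raiseProg : FProg :=
  .rep vI 2 (guard (.entry tR vI) (.set tLam (.scalar vI) (.const 0)
    (.add (.entry tLam vI) (.scalar tBest)))) ;;
  .set tLam (.param 2) (.const 0) (.add (.get tLam (.param 2) (.const 0)) (.scalar tBest))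

/-- Reach the cluster `tBi`. -/
def reachProg : FProg :=
  put tRk (.add (.scalar tRk) (.const 1)) ;;
  .set tR (.scalar tBi) (.const 0) (.scalar tRk) ;;
  .set tMov (.scalar tBi) (.const 0) (.scalar tBq)

/-- Reach one more cluster, and augment if it is not full. -/
def growProg : FProg :=
  slackProg ;; raiseProg ;; reachProg ;;
  guard (.lt (.entry tK tBi) (.entry tU tBi)) augmentProg

/-- Start a new tree of reached clusters from the dummy cluster. -/
def rootProg : FProg :=
  .rep vI 2 (.set tR (.scalar vI) (.const 0) (.const 0)) ;;
  .set tR (.param 2) (.const 0) (.const 1) ;; put tDone (.const 0) ;; put tRk (.const 1)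

/-- Assign one more point. -/
def phaseProg : FProg :=
  rootProg ;; .rep vS 2 (guard (.le (.scalar tDone) (.const 0)) growProg)

/-- Start with all points in the dummy cluster and with the prices zero. -/
def startProg : FProg :=
  .rep vI 2 (.set tLam (.scalar vI) (.const 0) (.const 0) ;;
    .set tK (.scalar vI) (.const 0) (.const 0)) ;;
  .set tLam (.param 2) (.const 0) (.const 0) ;;
  .rep vP 0 (.set tQ (.scalar vP) (.const 0) (.param 2) ;;
    .set tW (.scalar vP) (.param 2) (.const 0))

/-- Compute a cheapest assignment `tQ` of the points to the centers. -/
def assignProg : FProg := startProg ;; .rep vH 0 phaseProg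

/-- The candidate clustering for the error rate `vB / (vC + 1)`. -/
def candidateProg : FProg :=
  centerProg ;; weightProg ;; assignProg ;; costProg ;;
  guard (.lt (.scalar tCost) (.scalar tOpt)) keepProg

/-- The clustering algorithm. -/
def mainProg : FProg :=
  scaleProg ;; countProg ;; initProg ;; costProg ;; keepProg ;;
  .rep vB 0 (.rep vC 0 (guard
    (.lt (.mul (.const 2) (.scalar vB)) (.add (.scalar vC) (.const 1))) candidateProg))

/-- A syntactic check. The common denominator grows by factors of level 0 only, hence has level 1
like the coordinates; squared distances, assignment costs and prices have level 2. -/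
theorem leveled_mainProg : mainProg.leveled tableLevel = true := by decide +kernel

theorem tableLevel_le (a : ℕ) : tableLevel a ≤ 2 := by
  unfold tableLevel; split_ifs <;> omega

end FProg

end LogRAM

namespace LogRAM

/-! ### Sums over integer intervals -/

theorem sum_Ico_step {r N : ℤ} (h : r < N) (f : ℤ → ℤ) :
    ∑ p ∈ Ico r N, f p = f r + ∑ p ∈ Ico (r + 1) N, f p := by
  have : Ico r N = insert r (Ico (r + 1) N) := by
    ext z; simp only [mem_insert, mem_Ico]; omega
  rw [this, sum_insert (by simp)]

theorem sum_Ico_fin (n : ℕ) (f : ℤ → ℤ) : ∑ z ∈ Ico (0 : ℤ) n, f z = ∑ p : Fin n, f (p : ℕ) := by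
  rw [Fin.sum_univ_eq_sum_range (fun i => f (i : ℤ)) n]
  refine sum_nbij' Int.toNat (fun i => (i : ℤ)) ?_ ?_ ?_ ?_ ?_ <;>
    intro z hz <;> simp only [mem_Ico, mem_range] at * <;> try omega
  rw [Int.toNat_of_nonneg hz.1]

/-- The number of points `p < n` with `Q p = i`. -/
noncomputable def countEq (n : ℤ) (Q : ℤ → ℤ) (i : ℤ) : ℤ := ∑ p ∈ Ico 0 n, if Q p = i then 1 else 0

theorem countEq_eq_zero {n : ℤ} {Q : ℤ → ℤ} {i : ℤ} (h : countEq n Q i = 0) {p : ℤ} (h0 : 0 ≤ p)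
    (h1 : p < n) : Q p ≠ i := by
  intro hp
  have := (sum_eq_zero_iff_of_nonneg fun p _ => by split_ifs <;> norm_num).1 h p
    (mem_Ico.2 ⟨h0, h1⟩)
  simp [hp] at this

theorem exists_of_countEq_pos {n : ℤ} {Q : ℤ → ℤ} {i : ℤ} (h : 0 < countEq n Q i) :
    ∃ p, 0 ≤ p ∧ p < n ∧ Q p = i := by
  by_contra! hne
  refine h.ne' (sum_eq_zero fun p hp => ?_)
  rw [mem_Ico] at hp
  simp [hne p hp.1 hp.2]

theorem countEq_move {n : ℤ} {Q Q' : ℤ → ℤ} {q a : ℤ} (hq : 0 ≤ q) (hqn : q < n)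
    (hQ' : ∀ p, Q' p = if p = q then a else Q p) (i : ℤ) :
    countEq n Q' i + (if i = Q q then 1 else 0) = countEq n Q i + (if i = a then 1 else 0) := by
  have hm : q ∈ Ico 0 n := mem_Ico.2 ⟨hq, hqn⟩
  rw [countEq, countEq, ← add_sum_erase _ _ hm, ← add_sum_erase _ _ hm]
  have : ∑ p ∈ (Ico 0 n).erase q, (if Q' p = i then (1 : ℤ) else 0) =
      ∑ p ∈ (Ico 0 n).erase q, if Q p = i then 1 else 0 := by
    refine sum_congr rfl fun p hp => ?_
    rw [hQ', if_neg (mem_erase.1 hp).1]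
  rw [this, hQ', if_pos rfl]
  simp only [eq_comm (a := i)]
  ring

theorem sum_comp_eq {n k : ℤ} {Q : ℤ → ℤ} (hQ : ∀ p, 0 ≤ p → p < n → 0 ≤ Q p ∧ Q p < k)
    (f : ℤ → ℤ) : ∑ p ∈ Ico 0 n, f (Q p) = ∑ i ∈ Ico 0 k, f i * countEq n Q i := by
  simp only [countEq, mul_sum]
  rw [sum_comm]
  refine sum_congr rfl fun p hp => ?_
  rw [mem_Ico] at hp
  obtain ⟨h0, h1⟩ := hQ p hp.1 hp.2
  rw [sum_eq_single_of_mem (Q p) (mem_Ico.2 ⟨h0, h1⟩)]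
  · simp
  · intro i _ hi; simp [hi.symm]

theorem sum_countEq {n k : ℤ} (hn : 0 ≤ n) {Q : ℤ → ℤ}
    (hQ : ∀ p, 0 ≤ p → p < n → 0 ≤ Q p ∧ Q p < k) : ∑ i ∈ Ico 0 k, countEq n Q i = n := by
  have := sum_comp_eq hQ fun _ => 1
  simp only [one_mul] at this
  rw [← this]
  simp [hn]

/-! ### The primal-dual method for capacitated assignment -/

/-- The prices `lam` show that the partial assignment `Q` with the cluster sizes `K` is optimal. The
points assigned to `k` are those not yet assigned. -/
structure DualInv (n k : ℤ) (W : ℤ → ℤ → ℤ) (U Q lam K : ℤ → ℤ) : Prop where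
  range : ∀ p, 0 ≤ p → p < n → 0 ≤ Q p ∧ Q p ≤ k
  nonneg : ∀ i, 0 ≤ i → i < k → 0 ≤ lam i
  tight : ∀ p i, 0 ≤ p → p < n → 0 ≤ i → i < k → W p (Q p) + lam (Q p) ≤ W p i + lam i
  cap : ∀ i, 0 ≤ i → i < k → K i ≤ U i
  slack : ∀ i, 0 ≤ i → i < k → K i < U i → lam i = 0

/-- The cluster `i` is reached from the cluster that holds the point `mv i`, at no reduced cost. -/
structure Reached (n : ℤ) (W : ℤ → ℤ → ℤ) (Q lam R mv : ℤ → ℤ) (i : ℤ) : Prop where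
  two_le : 2 ≤ R i
  nonneg : 0 ≤ mv i
  lt : mv i < n
  pos : 0 < R (Q (mv i))
  rank : R (Q (mv i)) < R i
  eq : W (mv i) (Q (mv i)) + lam (Q (mv i)) = W (mv i) i + lam i

/-- Raising all reached prices by δ tightens only the inequalities from a point of a reached cluster
to an unreached cluster, and δ is at most their least slack. Complementary slackness survives
because only full clusters, and the dummy, become more expensive. -/
theorem DualInv.raise {n k : ℤ} {W : ℤ → ℤ → ℤ} {U Q lam K R lam' : ℤ → ℤ}
    (h : DualInv n k W U Q lam K) (hfull : ∀ i, 0 ≤ i → i < k → 0 < R i → K i = U i) {δ : ℤ}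
    (hδ : 0 ≤ δ)
    (hmin : ∀ q i, 0 ≤ q → q < n → 0 ≤ i → i < k → 0 < R (Q q) → R i ≤ 0 →
      δ ≤ W q i + lam i - (W q (Q q) + lam (Q q)))
    (hlam : ∀ i, 0 ≤ i → i ≤ k → lam' i = if 0 < R i then lam i + δ else lam i) :
    DualInv n k W U Q lam' K where
  range := h.range
  cap := h.cap
  nonneg i h0 h1 := by
    have := h.nonneg i h0 h1
    rw [hlam i h0 h1.le]; split_ifs <;> omega
  slack i h0 h1 hi := by
    rw [hlam i h0 h1.le, if_neg, h.slack i h0 h1 hi]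
    intro hR
    exact hi.ne (hfull i h0 h1 hR)
  tight p i hp hpn h0 h1 := by
    obtain ⟨hq0, hq1⟩ := h.range p hp hpn
    have h2 := h.tight p i hp hpn h0 h1
    have h3 := hmin p i hp hpn h0 h1
    rw [hlam i h0 h1.le, hlam _ hq0 hq1]
    split_ifs with hR hRi hRi
    · omega
    · have := h3 hR (by omega); omega
    · omega
    · exact h2

/-- Old tree edges join two reached clusters, whose prices rise by the same δ, so they stay tight;
the new edge becomes tight because δ is its slack. The new rank exceeds all others, which keeps
ranks decreasing towards the root. -/
theorem Reached.raise {n k : ℤ} {W : ℤ → ℤ → ℤ} {Q lam R mv lam' R' mv' : ℤ → ℤ}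
    (hrange : ∀ p, 0 ≤ p → p < n → 0 ≤ Q p ∧ Q p ≤ k) {δ rk q₀ i₀ : ℤ}
    (hq : 0 ≤ q₀) (hqn : q₀ < n) (hi : 0 ≤ i₀) (hik : i₀ < k) (hqR : 0 < R (Q q₀)) (hiR : R i₀ ≤ 0)
    (hδ : δ = W q₀ i₀ + lam i₀ - (W q₀ (Q q₀) + lam (Q q₀)))
    (hrk : ∀ i, 0 ≤ i → i ≤ k → R i < rk)
    (hlam : ∀ i, 0 ≤ i → i ≤ k → lam' i = if 0 < R i then lam i + δ else lam i)
    (hR' : ∀ i, R' i = if i = i₀ then rk else R i) (hmv : ∀ i, mv' i = if i = i₀ then q₀ else mv i)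
    (hold : ∀ i, 0 ≤ i → i < k → 0 < R i → Reached n W Q lam R mv i)
    {i : ℤ} (h0 : 0 ≤ i) (h1 : i < k) (hRi : 0 < R' i) : Reached n W Q lam' R' mv' i := by
  rw [hR'] at hRi
  by_cases hii : i = i₀
  · subst hii
    obtain ⟨ha, hb⟩ := hrange q₀ hq hqn
    have hne : Q q₀ ≠ i := fun h => by rw [h] at hqR; omega
    have hlt := hrk _ ha hb
    constructor
    · rw [hR', if_pos rfl]; omega
    · rwa [hmv, if_pos rfl]
    · rwa [hmv, if_pos rfl]
    · rwa [hmv, if_pos rfl, hR', if_neg hne]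
    · rwa [hmv, if_pos rfl, hR', if_neg hne, hR', if_pos rfl]
    · rw [hmv, if_pos rfl, hlam _ ha hb, if_pos hqR, hlam _ h0 h1.le, if_neg (by omega)]; omega
  · rw [if_neg hii] at hRi
    have h := hold i h0 h1 hRi
    obtain ⟨ha, hb⟩ := hrange _ h.nonneg h.lt
    have hne : Q (mv i) ≠ i₀ := fun h' => by have := h.pos; rw [h'] at this; omega
    constructor
    · rw [hR', if_neg hii]; exact h.two_le
    · rw [hmv, if_neg hii]; exact h.nonneg
    · rw [hmv, if_neg hii]; exact h.lt
    · rw [hmv, if_neg hii, hR', if_neg hne]; exact h.pos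
    · rw [hmv, if_neg hii, hR', if_neg hne, hR', if_neg hii]; exact h.rank
    · rw [hmv, if_neg hii, hlam _ ha hb, if_pos h.pos, hlam _ h0 h1.le, if_pos hRi]
      have := h.eq; omega

/-- The state during an augmentation: the cluster `cur` lacks one point. -/
structure AugInv (n k : ℤ) (W : ℤ → ℤ → ℤ) (U Q lam K R mv : ℤ → ℤ) (c₀ cur : ℤ) : Prop where
  dual : DualInv n k W U Q lam K
  nonneg : 0 ≤ cur
  le : cur ≤ k
  pos : 0 < R cur
  count : ∀ i, 0 ≤ i → i < k → K i = countEq n Q i + if i = cur then 1 else 0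
  free : c₀ = countEq n Q k + if k = cur then 1 else 0
  reached : ∀ i, 0 ≤ i → i < k → 0 < R i → R i ≤ R cur → Reached n W Q lam R mv i

/-- The moved point travels along a tight edge, so the prices still certify it, and the shortage
passes to a cluster of smaller rank. The edges still to be used come from clusters of rank at most
that one, so their points differ from the moved one and are undisturbed. -/
theorem AugInv.move {n k : ℤ} {W : ℤ → ℤ → ℤ} {U Q lam K R mv Q' : ℤ → ℤ} {c₀ cur : ℤ}
    (h : AugInv n k W U Q lam K R mv c₀ cur) (hcur : cur < k)
    (hQ' : ∀ p, Q' p = if p = mv cur then cur else Q p) :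
    AugInv n k W U Q' lam K R mv c₀ (Q (mv cur)) ∧ R (Q (mv cur)) < R cur := by
  have hr := h.reached cur h.nonneg hcur h.pos le_rfl
  obtain ⟨ha, hb⟩ := h.dual.range _ hr.nonneg hr.lt
  have hcount := countEq_move hr.nonneg hr.lt hQ'
  refine ⟨⟨⟨?_, h.dual.nonneg, ?_, h.dual.cap, h.dual.slack⟩, ha, hb, hr.pos, ?_, ?_, ?_⟩, hr.rank⟩
  · intro p h0 h1
    rw [hQ']
    split_ifs
    · exact ⟨h.nonneg, h.le⟩
    · exact h.dual.range p h0 h1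
  · intro p i h0 h1 h2 h3
    rw [hQ']
    split_ifs with hp
    · subst hp
      rw [← hr.eq]; exact h.dual.tight _ i h0 h1 h2 h3
    · exact h.dual.tight p i h0 h1 h2 h3
  · intro i h0 h1
    rw [h.count i h0 h1, hcount]
  · rw [h.free, hcount]
  · intro i h0 h1 hR hle
    have hi := h.reached i h0 h1 hR (hle.trans hr.rank.le)
    have hne : mv i ≠ mv cur := fun he => by
      have := hi.rank; rw [he] at this; omega
    have he : Q' (mv i) = Q (mv i) := by rw [hQ', if_neg hne]
    exact ⟨hi.two_le, hi.nonneg, hi.lt, by rw [he]; exact hi.pos, by rw [he]; exact hi.rank,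
      by rw [he]; exact hi.eq⟩

/-- By counting: full clusters would hold all n points and leave none in the dummy. -/
theorem DualInv.not_all_full {n k : ℤ} {W : ℤ → ℤ → ℤ} {U Q lam K : ℤ → ℤ} (hn : 0 ≤ n) (hk : 0 ≤ k)
    (h : DualInv n k W U Q lam K) (hK : ∀ i, 0 ≤ i → i < k → K i = countEq n Q i)
    (hU : n ≤ ∑ i ∈ Ico 0 k, U i) (hfree : 0 < countEq n Q k) :
    ¬ ∀ i, 0 ≤ i → i < k → K i = U i := by
  intro hall
  have h1 := sum_countEq (k := k + 1) hn fun p h0 h1 => by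
    have := h.range p h0 h1; exact ⟨this.1, by omega⟩
  have h2 : Ico 0 (k + 1) = insert k (Ico 0 k) := by
    ext z; simp only [mem_insert, mem_Ico]; omega
  rw [h2, sum_insert (by simp)] at h1
  have h3 : ∑ i ∈ Ico 0 k, U i = ∑ i ∈ Ico 0 k, countEq n Q i := sum_congr rfl fun i hi => by
    rw [mem_Ico] at hi
    rw [← hall i hi.1 hi.2, hK i hi.1 hi.2]
  omega

/-- Weak duality: `Q` is pointwise optimal for the costs with prices added. The total price paid by
`S` is no larger than that paid by `Q`, since a cluster with room has price 0 and in a full one `S`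
has no more points than `Q`. -/
theorem DualInv.optimal {n k : ℤ} {W : ℤ → ℤ → ℤ} {U Q lam K : ℤ → ℤ}
    (h : DualInv n k W U Q lam K) (hK : ∀ i, 0 ≤ i → i < k → K i = countEq n Q i)
    (hfree : countEq n Q k = 0) {S : ℤ → ℤ} (hS : ∀ p, 0 ≤ p → p < n → 0 ≤ S p ∧ S p < k)
    (hSU : ∀ i, 0 ≤ i → i < k → countEq n S i ≤ U i) :
    ∑ p ∈ Ico 0 n, W p (Q p) ≤ ∑ p ∈ Ico 0 n, W p (S p) := by
  have hQ : ∀ p, 0 ≤ p → p < n → 0 ≤ Q p ∧ Q p < k := fun p h0 h1 => by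
    have := h.range p h0 h1
    have := countEq_eq_zero hfree h0 h1
    omega
  have h1 : ∑ p ∈ Ico 0 n, (W p (Q p) + lam (Q p)) ≤ ∑ p ∈ Ico 0 n, (W p (S p) + lam (S p)) :=
    sum_le_sum fun p hp => by
      rw [mem_Ico] at hp
      exact h.tight p _ hp.1 hp.2 (hS p hp.1 hp.2).1 (hS p hp.1 hp.2).2
  rw [sum_add_distrib, sum_add_distrib, sum_comp_eq hQ, sum_comp_eq hS] at h1
  have h2 : ∑ i ∈ Ico 0 k, lam i * countEq n S i ≤ ∑ i ∈ Ico 0 k, lam i * countEq n Q i := by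
    refine sum_le_sum fun i hi => ?_
    rw [mem_Ico] at hi
    rw [← hK i hi.1 hi.2]
    rcases (h.cap i hi.1 hi.2).lt_or_eq with hlt | heq
    · rw [h.slack i hi.1 hi.2 hlt]; simp
    · rw [heq]
      exact mul_le_mul_of_nonneg_left (hSU i hi.1 hi.2) (h.nonneg i hi.1 hi.2)
  omega

/-! ### Rules for the verification of programs -/

namespace FProg

/-- The tables that `c` does not write agree. -/
def Frame (c : FProg) (m m' : Mem) : Prop := ∀ b, c.writes b = false → m' b = m b

theorem frame_run (c : FProg) (m : Mem) : Frame c m (c.run m) := fun _ hb => run_table c hb m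

/-- `rep_induct` with the frame condition carried along, so that an invariant need only speak of
tables which the loop changes. -/
theorem rep_rule {v s : ℕ} {c : FProg} {m : Mem} {N : ℤ} (I : ℤ → Mem → Prop)
    (hN : m 0 0 s = N) (hN0 : 0 ≤ N) (init : I N (m.write v 0 0 N))
    (step : ∀ r m', 0 ≤ r → r < N → Frame (.rep v s c) m m' → I (r + 1) m' →
      I r (c.run (m'.write v 0 0 r))) : I 0 ((FProg.rep v s c).run m) := by
  refine (rep_induct (fun r m' => Frame (.rep v s c) m m' ∧ I r m') hN hN0 ⟨?_, init⟩ ?_).2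
  · intro b hb
    simp only [writes, Bool.or_eq_false_iff, beq_eq_false_iff_ne] at hb
    exact Mem.write_table hb.1.symm _ _ _ _
  · rintro r m' h0 h1 ⟨hf, hI⟩
    refine ⟨fun b hb => ?_, step r m' h0 h1 hf hI⟩
    rw [← hf b hb]
    simp only [writes, Bool.or_eq_false_iff, beq_eq_false_iff_ne] at hb
    rw [run_table c hb.2, Mem.write_table hb.1.symm]

/-- A loop that adds `f r` to an entry. -/
theorem rep_sum {v s : ℕ} {c : FProg} {m : Mem} {N : ℤ} {a : ℕ} {i j : ℤ} (f : ℤ → ℤ)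
    (hN : m 0 0 s = N) (hN0 : 0 ≤ N) (hav : a ≠ v)
    (step : ∀ r m', 0 ≤ r → r < N → Frame (.rep v s c) m m' →
      (c.run (m'.write v 0 0 r)) a i j = m' a i j + f r) :
    ((FProg.rep v s c).run m) a i j = m a i j + ∑ r ∈ Ico 0 N, f r := by
  refine rep_rule (fun r m' => m' a i j = m a i j + ∑ r ∈ Ico r N, f r) hN hN0 ?_ ?_
  · rw [Mem.write_table hav]; simp
  · intro r m' h0 h1 hf hI
    rw [step r m' h0 h1 hf, hI, sum_Ico_step h1]; ring

/-- A loop that establishes one property for each value of the counter. -/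
theorem rep_forall {v s : ℕ} {c : FProg} {m : Mem} {N : ℤ} (R : ℤ → Mem → Prop)
    (hN : m 0 0 s = N) (hN0 : 0 ≤ N)
    (step : ∀ r m', 0 ≤ r → r < N → Frame (.rep v s c) m m' → R r (c.run (m'.write v 0 0 r)))
    (pres : ∀ r r' m', 0 ≤ r → r < r' → r' < N → Frame (.rep v s c) m m' → R r' m' →
      R r' (c.run (m'.write v 0 0 r))) :
    ∀ r, 0 ≤ r → r < N → R r ((FProg.rep v s c).run m) := by
  refine rep_rule (fun r m' => ∀ r', r ≤ r' → r' < N → R r' m') hN hN0 ?_ ?_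
  · intro r' h h'; omega
  · intro r m' h0 h1 hf hI r' h2 h3
    rcases h2.eq_or_lt with rfl | h2
    · exact step r m' h0 h1 hf
    · exact pres r r' m' h0 h2 h3 hf (hI r' h2 h3)

/-- The memory holds the minimum of `f` over the pairs in `D`, and `pay` holds for a minimizer. -/
def HasMin (f : ℤ → ℤ → ℤ) (pay : Mem → ℤ → ℤ → Prop) (D : ℤ → ℤ → Prop) (m : Mem) : Prop :=
  (m tHas 0 0 = 0 ∧ ∀ p q, ¬ D p q) ∨
    (m tHas 0 0 = 1 ∧ (∃ p q, D p q ∧ m tBest 0 0 = f p q ∧ pay m p q) ∧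
      ∀ p q, D p q → m tBest 0 0 ≤ f p q)

theorem HasMin.congr {f : ℤ → ℤ → ℤ} {pay : Mem → ℤ → ℤ → Prop} {D D' : ℤ → ℤ → Prop} {m m' : Mem}
    (h : HasMin f pay D m) (hD : ∀ p q, D p q ↔ D' p q) (hh : m' tHas 0 0 = m tHas 0 0)
    (hb : m' tBest 0 0 = m tBest 0 0) (hp : ∀ p q, pay m p q → pay m' p q) :
    HasMin f pay D' m' := by
  rcases h with ⟨h1, h2⟩ | ⟨h1, ⟨p, q, h2, h3, h4⟩, h5⟩
  · exact Or.inl ⟨hh.trans h1, fun p q h => h2 p q ((hD p q).2 h)⟩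
  · exact Or.inr ⟨hh.trans h1, ⟨p, q, (hD p q).1 h2, hb.trans h3, hp p q h4⟩,
      fun p q h => hb.trans_le (h5 p q ((hD p q).2 h))⟩

/-- A double loop that computes a minimum over all valid pairs. -/
theorem rep_rep_min {v s v' s' : ℕ} {c : FProg} {m : Mem} {N N' : ℤ} (f : ℤ → ℤ → ℤ)
    (valid : ℤ → ℤ → Prop) (pay : Mem → ℤ → ℤ → Prop) (hN : m 0 0 s = N) (hN0 : 0 ≤ N)
    (hN' : m 0 0 s' = N') (hN0' : 0 ≤ N')
    (hw : (FProg.rep v s (.rep v' s' c)).writes 0 = false) (hvv : v ≠ v') (hcv : c.writes v = false)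
    (hv : v ≠ tHas ∧ v ≠ tBest ∧ v' ≠ tHas ∧ v' ≠ tBest)
    (hpay : ∀ (m' : Mem) r p q, pay m' p q → pay (m'.write v 0 0 r) p q ∧ pay (m'.write v' 0 0 r) p q)
    (hhas : m tHas 0 0 = 0)
    (step : ∀ p q m', 0 ≤ p → p < N → 0 ≤ q → q < N' → m' v 0 0 = p → m' v' 0 0 = q →
      Frame (.rep v s (.rep v' s' c)) m m' →
      (valid p q ∧ (m' tHas 0 0 ≤ 0 ∨ f p q < m' tBest 0 0) ∧ (c.run m') tHas 0 0 = 1 ∧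
          (c.run m') tBest 0 0 = f p q ∧ pay (c.run m') p q) ∨
        ((valid p q → 0 < m' tHas 0 0 ∧ m' tBest 0 0 ≤ f p q) ∧
          (c.run m') tHas 0 0 = m' tHas 0 0 ∧
          (0 < m' tHas 0 0 → (c.run m') tBest 0 0 = m' tBest 0 0) ∧
          ∀ p' q', pay m' p' q' → pay (c.run m') p' q')) :
    HasMin f pay (fun p q => (0 ≤ p ∧ p < N) ∧ (0 ≤ q ∧ q < N') ∧ valid p q)
      ((FProg.rep v s (.rep v' s' c)).run m) := by
  have hw0 : ∀ m', Frame (.rep v s (.rep v' s' c)) m m' → ∀ r s : ℤ, m' 0 r s = m 0 r s :=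
    fun m' hf r s => by rw [hf 0 hw]
  simp only [writes, Bool.or_eq_false_iff, beq_eq_false_iff_ne] at hw
  refine rep_rule (fun r m' => HasMin f pay
    (fun p q => (r ≤ p ∧ p < N) ∧ (0 ≤ q ∧ q < N') ∧ valid p q) m') hN hN0 ?_ ?_
  · refine Or.inl ⟨?_, fun p q h => ?_⟩
    · rw [Mem.write_table hv.1.symm]; exact hhas
    · have := h.1; omega
  · intro r m' h0 h1 hf hI
    -- The inner invariant describes a partly finished row r: of this row only the columns from the
    -- inner counter on are covered.
    have hI' : HasMin f pay (fun p q => (r ≤ p ∧ p < N) ∧ (0 ≤ q ∧ q < N') ∧ valid p q ∧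
        (p = r → 0 ≤ q)) ((FProg.rep v' s' c).run (m'.write v 0 0 r)) := by
      refine rep_rule (fun r' m'' => HasMin f pay
        (fun p q => (r ≤ p ∧ p < N) ∧ (0 ≤ q ∧ q < N') ∧ valid p q ∧ (p = r → r' ≤ q)) m'')
        (N := N') ?_ hN0' ?_ ?_
      · rw [Mem.write_table hw.1.symm, hw0 m' hf, hN']
      · refine hI.congr (fun p q => ?_) ?_ ?_ ?_
        · constructor
          · rintro ⟨h2, h3, h4⟩; exact ⟨⟨by omega, h2.2⟩, h3, h4, by omega⟩
          · rintro ⟨h2, h3, h4, h5⟩; exact ⟨⟨by omega, h2.2⟩, h3, h4⟩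
        · rw [Mem.write_table hv.2.2.1.symm, Mem.write_table hv.1.symm]
        · rw [Mem.write_table hv.2.2.2.symm, Mem.write_table hv.2.1.symm]
        · intro p q h; exact (hpay _ _ _ _ (hpay _ _ _ _ h).1).2
      · intro r' m'' h0' h1' hf' hI''
        have hmem : Frame (.rep v s (.rep v' s' c)) m (m''.write v' 0 0 r') := by
          intro b hb
          have hb' := hb
          simp only [writes, Bool.or_eq_false_iff, beq_eq_false_iff_ne] at hb
          rw [Mem.write_table hb.2.1.symm, hf' b (by simp [writes, hb]),
            Mem.write_table hb.1.symm, hf b hb']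
        have hvr : (m''.write v' 0 0 r') v 0 0 = r := by
          rw [Mem.write_table hvv, hf' v (by simp [writes, hvv.symm, hcv]), Mem.write_apply]; simp
        have hvr' : (m''.write v' 0 0 r') v' 0 0 = r' := by rw [Mem.write_apply]; simp
        have hs := step r r' _ h0 h1 h0' h1' hvr hvr' hmem
        rw [Mem.write_table hv.2.2.1.symm, Mem.write_table hv.2.2.2.symm] at hs
        rcases hs with ⟨hval, hlt, hh, hb, hp⟩ | ⟨hval, hh, hb, hp⟩
        · refine Or.inr ⟨hh, ⟨r, r', ⟨⟨le_rfl, h1⟩, ⟨h0', h1'⟩, hval, fun _ => le_rfl⟩, hb, hp⟩, ?_⟩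
          rintro p q ⟨h2, h3, h4, h5⟩
          rw [hb]
          by_cases hpq : p = r ∧ q = r'
          · rw [hpq.1, hpq.2]
          · have hD : (r ≤ p ∧ p < N) ∧ (0 ≤ q ∧ q < N') ∧ valid p q ∧ (p = r → r' + 1 ≤ q) :=
              ⟨h2, h3, h4, fun h => by have := h5 h; omega⟩
            rcases hI'' with ⟨h6, h7⟩ | ⟨h6, -, h7⟩
            · exact absurd hD (h7 p q)
            · have := h7 p q hD; omega
        · rcases hI'' with ⟨h6, h7⟩ | ⟨h6, ⟨p, q, ⟨h2, h3, h4, h5⟩, h8, h9⟩, h7⟩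
          · refine Or.inl ⟨hh.trans h6, ?_⟩
            rintro p q ⟨h2, h3, h4, h5⟩
            by_cases hpq : p = r ∧ q = r'
            · rw [hpq.1, hpq.2] at h4
              have := (hval h4).1; omega
            · exact h7 p q ⟨h2, h3, h4, fun h => by have := h5 h; omega⟩
          · have hpos : 0 < m'' tHas 0 0 := by omega
            refine Or.inr ⟨hh.trans h6, ⟨p, q, ⟨h2, h3, h4, fun h => by have := h5 h; omega⟩,
              (hb hpos).trans h8, hp _ _ (hpay _ _ _ _ h9).2⟩, ?_⟩
            rintro p q ⟨h2, h3, h4, h5⟩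
            rw [hb hpos]
            by_cases hpq : p = r ∧ q = r'
            · rw [hpq.1, hpq.2] at h4 ⊢
              exact (hval h4).2
            · exact h7 p q ⟨h2, h3, h4, fun h => by have := h5 h; omega⟩
    refine hI'.congr (fun p q => ?_) rfl rfl fun _ _ h => h
    constructor
    · rintro ⟨h2, h3, h4, -⟩; exact ⟨h2, h3, h4⟩
    · rintro ⟨h2, h3, h4⟩; exact ⟨h2, h3, h4, fun _ => h3.1⟩

end FProg

end LogRAM

namespace LogRAM

/-! ### Correctness of the assignment program -/

/-- The first column of a table. -/
abbrev col (m : Mem) (a : ℕ) : ℤ → ℤ := fun i => m a i 0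

theorem col_congr {a : ℕ} {m m' : Mem} (h : m' a = m a) : col m' a = col m a := by
  funext p
  rw [col, h]

theorem col_write {a b : ℕ} (h : a ≠ b) (m : Mem) (i j v : ℤ) :
    col (m.write b i j v) a = col m a := by
  funext p
  rw [col, Mem.write_table h]

namespace FProg

/-- With r iterations left the rank of the current cluster is at most r + 1, since each move lowers
it. At the end the rank is at most 1, which only the dummy has, as reached clusters have rank at
least 2. Iterations after arrival at the dummy do nothing. -/
theorem run_augmentLoop {n k c₀ : ℤ} {W : ℤ → ℤ → ℤ} {U lam K R : ℤ → ℤ} {m : Mem}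
    (hk : m 0 0 2 = k) (hk0 : 0 ≤ k)
    (h : AugInv n k W U (col m tQ) lam K R (col m tMov) c₀ (m tCur 0 0))
    (hRk : R k = 1) (hR : R (m tCur 0 0) ≤ k + 1) :
    AugInv n k W U (col ((FProg.rep vT 2 (guard (.lt (.scalar tCur) (.param 2)) moveProg)).run m) tQ)
      lam K R (col m tMov) c₀ k := by
  have key := rep_rule (v := vT) (s := 2) (c := guard (.lt (.scalar tCur) (.param 2)) moveProg)
    (m := m) (fun r m' => AugInv n k W U (col m' tQ) lam K R (col m tMov) c₀ (m' tCur 0 0) ∧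
      R (m' tCur 0 0) ≤ r + 1) hk hk0 ?_ ?_
  · obtain ⟨h1, h2⟩ := key
    set m' := (FProg.rep vT 2 (guard (.lt (.scalar tCur) (.param 2)) moveProg)).run m
    have hcur : m' tCur 0 0 = k := by
      by_contra hne
      have := h1.reached _ h1.nonneg (lt_of_le_of_ne h1.le hne) h1.pos le_rfl
      have := this.two_le
      omega
    rwa [hcur] at h1
  · simpa [col, Mem.write] using ⟨h, hR⟩
  · rintro r m' h0 h1 hf ⟨hI, hr⟩
    have hf0 := hf 0 rfl
    have hfm := hf tMov rfl
    by_cases hc : m' tCur 0 0 < k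
    · have hc' : 0 < k - m' tCur 0 0 := by omega
      obtain ⟨h2, h3⟩ := hI.move hc (Q' := col ((guard (.lt (.scalar tCur) (.param 2)) moveProg).run
        (m'.write vT 0 0 r)) tQ) (fun p => by
          simp [col, run, moveProg, Expr.eval, Mem.write, hf0, hk, hc, hfm])
      have h4 : (guard (.lt (.scalar tCur) (.param 2)) moveProg).run (m'.write vT 0 0 r) tCur 0 0 =
          col m' tQ (col m tMov (m' tCur 0 0)) := by
        simp [col, run, moveProg, Expr.eval, Mem.write, hf0, hk, hc, hfm]
      rw [h4]
      exact ⟨h2, by omega⟩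
    · have hcur : m' tCur 0 0 = k := le_antisymm hI.le (not_lt.1 hc)
      have : (guard (.lt (.scalar tCur) (.param 2)) moveProg).run (m'.write vT 0 0 r) =
          m'.write vT 0 0 r := by
        simp [run, Expr.eval, Mem.write, hf0, hk, hc]
      rw [this]
      refine ⟨by rwa [col_write (by decide), Mem.write_table (by decide)], ?_⟩
      rw [Mem.write_table (by decide), hcur, hRk]
      omega

/-- The memory just before `save` is exposed so that each use can evaluate its own `save`. -/
theorem run_offer {e : Expr} {save : FProg} {m : Mem}
    (h : m tHas 0 0 ≤ 0 ∨ e.eval m < m tBest 0 0) :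
    ∃ m', (offer e save).run m = save.run m' ∧ m' tHas 0 0 = 1 ∧ m' tBest 0 0 = e.eval m ∧
      ∀ b, b ≠ tVal → b ≠ tHas → b ≠ tBest → m' b = m b := by
  by_cases hh : m tHas 0 0 ≤ 0
  · have e1 : m tHas 0 0 < 1 := by omega
    refine ⟨(((m.write tVal 0 0 (e.eval m)).write tBest 0 0 (e.eval m + 1)).write tHas 0 0 1).write
      tBest 0 0 (e.eval m), ?_, ?_, ?_, fun b h1 h2 h3 => ?_⟩
    · simp [run, Expr.eval, Mem.write_apply, Mem.write_table, e1]
    · simp [Mem.write]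
    · simp [Mem.write]
    · simp [Mem.write_table, h1, h2, h3]
  · have e1 : ¬ m tHas 0 0 < 1 := by omega
    have e2 : e.eval m < m tBest 0 0 := by tauto
    refine ⟨((m.write tVal 0 0 (e.eval m)).write tHas 0 0 1).write tBest 0 0 (e.eval m),
      ?_, ?_, ?_, fun b h1 h2 h3 => ?_⟩
    · simp [run, Expr.eval, Mem.write_apply, Mem.write_table, e1, e2]
    · simp [Mem.write]
    · simp [Mem.write]
    · simp [Mem.write_table, h1, h2, h3]

theorem run_offer_of_le {e : Expr} {save : FProg} {m : Mem} (h1 : 0 < m tHas 0 0)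
    (h2 : m tBest 0 0 ≤ e.eval m) : (offer e save).run m = m.write tVal 0 0 (e.eval m) := by
  have e1 : ¬ m tHas 0 0 < 1 := by omega
  have e2 : ¬ e.eval m < m tBest 0 0 := by omega
  simp [run, Expr.eval, Mem.write_apply, Mem.write_table, e1, e2]

/-- The pair `q₁`, `i₁` serves only to exclude an empty search. -/
theorem run_slackProg {n k : ℤ} {m : Mem} (hn : m 0 0 0 = n) (hn0 : 0 ≤ n) (hk : m 0 0 2 = k)
    (hk0 : 0 ≤ k) {q₁ i₁ : ℤ} (hq₁ : 0 ≤ q₁ ∧ q₁ < n) (hi₁ : 0 ≤ i₁ ∧ i₁ < k)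
    (hR₁ : 0 < m tR (m tQ q₁ 0) 0) (hRi₁ : m tR i₁ 0 ≤ 0) :
    ∃ q i, (0 ≤ q ∧ q < n) ∧ (0 ≤ i ∧ i < k) ∧ 0 < m tR (m tQ q 0) 0 ∧ m tR i 0 ≤ 0 ∧
      slackProg.run m tBq 0 0 = q ∧ slackProg.run m tBi 0 0 = i ∧
      slackProg.run m tBest 0 0 = m tW q i + m tLam i 0 -
        (m tW q (m tQ q 0) + m tLam (m tQ q 0) 0) ∧
      ∀ q' i', (0 ≤ q' ∧ q' < n) → (0 ≤ i' ∧ i' < k) → 0 < m tR (m tQ q' 0) 0 → m tR i' 0 ≤ 0 →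
        slackProg.run m tBest 0 0 ≤ m tW q' i' + m tLam i' 0 -
          (m tW q' (m tQ q' 0) + m tLam (m tQ q' 0) 0) := by
  have key := rep_rep_min (v := vQ) (s := 0) (v' := vI) (s' := 2)
    (c := guard (.get tR (.entry tQ vQ) (.const 0)) (guard (.le (.entry tR vI) (.const 0))
      (offer (.sub (.add (.entry₂ tW vQ vI) (.entry tLam vI))
          (.add (.get tW (.scalar vQ) (.entry tQ vQ)) (.get tLam (.entry tQ vQ) (.const 0))))
        (put tBq (.scalar vQ) ;; put tBi (.scalar vI)))))
    (m := (put tHas (.const 0)).run m) (N := n) (N' := k)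
    (fun q i => m tW q i + m tLam i 0 - (m tW q (m tQ q 0) + m tLam (m tQ q 0) 0))
    (fun q i => 0 < m tR (m tQ q 0) 0 ∧ m tR i 0 ≤ 0)
    (fun m' q i => m' tBq 0 0 = q ∧ m' tBi 0 0 = i)
    (by simp [run, Mem.write, hn]) hn0 (by simp [run, Mem.write, hk]) hk0 rfl (by decide) rfl
    (by decide) (fun m' r p q h => by simpa [Mem.write] using h)
    (by simp [run, Mem.write, Expr.eval]) ?_
  · change HasMin _ _ _ (slackProg.run m) at key
    rcases key with ⟨-, h⟩ | ⟨-, ⟨q, i, ⟨hq, hi, hv⟩, hb, hp⟩, h⟩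
    · exact absurd ⟨hq₁, hi₁, hR₁, hRi₁⟩ (h q₁ i₁)
    · exact ⟨q, i, hq, hi, hv.1, hv.2, hp.1, hp.2, hb, fun q' i' h1 h2 h3 h4 =>
        h q' i' ⟨h1, h2, h3, h4⟩⟩
  · intro q i m' hq0 hq1 hi0 hi1 hvq hvi hf
    have hR := hf tR rfl
    have hQ := hf tQ rfl
    have hW := hf tW rfl
    have hL := hf tLam rfl
    simp only [run, Mem.write_table (show tR ≠ tHas by decide)] at hR
    simp only [run, Mem.write_table (show tQ ≠ tHas by decide)] at hQ
    simp only [run, Mem.write_table (show tW ≠ tHas by decide)] at hW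
    simp only [run, Mem.write_table (show tLam ≠ tHas by decide)] at hL
    have hg : ∀ c : FProg, 0 < m tR (m tQ q 0) 0 → m tR i 0 ≤ 0 →
        (guard (.get tR (.entry tQ vQ) (.const 0)) (guard (.le (.entry tR vI) (.const 0)) c)).run m' =
          c.run m' := fun c h1 h2 => by
      simp [run, Expr.eval, hR, hQ, hvq, hvi, h1, h2]
    have hg' : ∀ c : FProg, ¬ (0 < m tR (m tQ q 0) 0 ∧ m tR i 0 ≤ 0) →
        (guard (.get tR (.entry tQ vQ) (.const 0)) (guard (.le (.entry tR vI) (.const 0)) c)).run m' =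
          m' := fun c h => by
      by_cases h1 : 0 < m tR (m tQ q 0) 0
      · have h2 : ¬ 0 < 0 - m tR i 0 + 1 := by omega
        simp only [run, Expr.eval, hR, hQ, hvq, hvi, h1, h2, decide_true, decide_false, select_true,
          select_false]
      · simp only [run, Expr.eval, hR, hQ, hvq, h1, decide_false, select_false]
    by_cases hv : 0 < m tR (m tQ q 0) 0 ∧ m tR i 0 ≤ 0
    · rw [hg _ hv.1 hv.2]
      set e : Expr := .sub (.add (.entry₂ tW vQ vI) (.entry tLam vI))
          (.add (.get tW (.scalar vQ) (.entry tQ vQ)) (.get tLam (.entry tQ vQ) (.const 0)))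
      have he : e.eval m' = m tW q i + m tLam i 0 - (m tW q (m tQ q 0) + m tLam (m tQ q 0) 0) := by
        simp only [e, Expr.eval, hQ, hW, hL, hvq, hvi]
      rw [← he]
      by_cases hlt : m' tHas 0 0 ≤ 0 ∨ e.eval m' < m' tBest 0 0
      · obtain ⟨m'', h1, h2, h3, h4⟩ := run_offer (save := put tBq (.scalar vQ) ;; put tBi (.scalar vI)) hlt
        refine Or.inl ⟨hv, hlt, ?_⟩
        rw [h1]
        have h5 := h4 vQ (by decide) (by decide) (by decide)
        have h6 := h4 vI (by decide) (by decide) (by decide)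
        simp [run, Expr.eval, Mem.write, h2, h3, h5, h6, hvq, hvi]
      · rw [not_or, not_le, not_lt] at hlt
        rw [run_offer_of_le hlt.1 hlt.2]
        exact Or.inr ⟨fun _ => hlt, by simp [Mem.write], by simp [Mem.write], by simp [Mem.write]⟩
    · rw [hg' _ hv]
      exact Or.inr ⟨fun h => absurd h hv, rfl, fun _ => rfl, fun _ _ h => h⟩

theorem run_raiseProg {k : ℤ} {m : Mem} (hk : m 0 0 2 = k) (hk0 : 0 ≤ k) (hR : 0 < m tR k 0) (i : ℤ)
    (h0 : 0 ≤ i) (h1 : i ≤ k) : raiseProg.run m tLam i 0 =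
      if 0 < m tR i 0 then m tLam i 0 + m tBest 0 0 else m tLam i 0 := by
  have key := rep_rule (v := vI) (s := 2) (c := guard (.entry tR vI) (.set tLam (.scalar vI)
    (.const 0) (.add (.entry tLam vI) (.scalar tBest)))) (m := m)
    (fun r m' => ∀ i, m' tLam i 0 = if (r ≤ i ∧ i < k) ∧ 0 < m tR i 0 then
      m tLam i 0 + m tBest 0 0 else m tLam i 0) hk hk0 ?_ ?_
  · rw [raiseProg, run]
    set m' := (FProg.rep vI 2 (guard (.entry tR vI) (.set tLam (.scalar vI)
      (.const 0) (.add (.entry tLam vI) (.scalar tBest))))).run m with hm'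
    have e1 : m' 0 = m 0 := frame_run _ _ 0 rfl
    have e2 : m' tBest = m tBest := frame_run _ _ tBest rfl
    have e3 : m' 0 0 2 = k := by rw [e1, hk]
    rcases h1.eq_or_lt with rfl | h1
    · simp [run, Expr.eval, Mem.write_apply, e2, e3, key, hR]
    · simp [run, Expr.eval, Mem.write_apply, e3, key, h0, h1, h1.ne]
  · intro i
    rw [Mem.write_table (by decide), if_neg (by omega)]
  · intro r m' hr0 hr1 hf hI i
    have e1 := hf tBest rfl
    have e2 := hf tR rfl
    have hri : (r ≤ i ∧ i < k) ↔ i = r ∨ (r < i ∧ i < k) := by omega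
    by_cases hr : 0 < m tR r 0
    · by_cases hi : i = r
      · subst hi
        simp [run, Expr.eval, Mem.write_apply, Mem.write_table, e1, e2, hr, hI, hr1]
      · simp [run, Expr.eval, Mem.write_apply, Mem.write_table, e2, hr, hI, hri, hi]
    · by_cases hi : i = r
      · subst hi
        simp [run, Expr.eval, Mem.write_apply, Mem.write_table, e2, hr, hI]
      · simp [run, Expr.eval, Mem.write_apply, Mem.write_table, e2, hr, hI, hri, hi]

end FProg

end LogRAM

/-! ### Invariants of the phases of the assignment program -/

namespace LogRAM

/-- The memory holds an optimal partial assignment with `c` points not yet assigned. -/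
structure AssignInv (n k : ℤ) (W : ℤ → ℤ → ℤ) (U : ℤ → ℤ) (c : ℤ) (m : Mem) : Prop where
  dual : DualInv n k W U (col m tQ) (col m tLam) (col m tK)
  count : ∀ i, 0 ≤ i → i < k → m tK i 0 = countEq n (col m tQ) i
  free : countEq n (col m tQ) k = c

/-- The memory holds a tree of full clusters reached from the dummy cluster; at most `r` clusters
are not reached. -/
structure TreeInv (n k : ℤ) (W : ℤ → ℤ → ℤ) (U : ℤ → ℤ) (r : ℤ) (m : Mem) : Prop where
  root : m tR k 0 = 1
  rk : m tRk 0 0 + r = k + 1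
  le_rk : ∀ i, 0 ≤ i → i ≤ k → m tR i 0 ≤ m tRk 0 0
  reached : ∀ i, 0 ≤ i → i < k → 0 < m tR i 0 →
    Reached n W (col m tQ) (col m tLam) (col m tR) (col m tMov) i
  full : ∀ i, 0 ≤ i → i < k → 0 < m tR i 0 → m tK i 0 = U i
  unreached : ∑ i ∈ Ico 0 k, (if m tR i 0 ≤ 0 then 1 else 0) ≤ r

theorem AssignInv.congr {n k : ℤ} {W : ℤ → ℤ → ℤ} {U : ℤ → ℤ} {c : ℤ} {m m' : Mem}
    (h : AssignInv n k W U c m) (hQ : m' tQ = m tQ) (hL : m' tLam = m tLam) (hK : m' tK = m tK) :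
    AssignInv n k W U c m' := by
  obtain ⟨h1, h2, h3⟩ := h
  constructor
  · rwa [col_congr hQ, col_congr hL, col_congr hK]
  · rwa [hK, col_congr hQ]
  · rwa [col_congr hQ]

theorem TreeInv.congr {n k : ℤ} {W : ℤ → ℤ → ℤ} {U : ℤ → ℤ} {r : ℤ} {m m' : Mem}
    (h : TreeInv n k W U r m) (hQ : m' tQ = m tQ) (hL : m' tLam = m tLam) (hK : m' tK = m tK)
    (hR : m' tR = m tR) (hM : m' tMov = m tMov) (hr : m' tRk = m tRk) :
    TreeInv n k W U r m' := by
  obtain ⟨h1, h2, h3, h4, h5, h6⟩ := h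
  constructor
  · rwa [hR]
  · rwa [hr]
  · simpa only [hR, hr] using h3
  · rwa [hR, col_congr hQ, col_congr hL, col_congr hR, col_congr hM]
  · simpa only [hR, hK] using h5
  · simpa only [hR] using h6

namespace FProg

/-- The size of the target is incremented first, so it is the cluster that lacks a point; the
shortage is then pushed back to the dummy, which ends up with one point fewer. -/
theorem run_augmentProg {n k c : ℤ} {W : ℤ → ℤ → ℤ} {U : ℤ → ℤ} {m : Mem}
    (hk : m 0 0 2 = k) (hk0 : 0 ≤ k) (hA : AssignInv n k W U c m) (hRk : m tR k 0 = 1)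
    (hreached : ∀ i, 0 ≤ i → i < k → 0 < m tR i 0 →
      Reached n W (col m tQ) (col m tLam) (col m tR) (col m tMov) i)
    {i : ℤ} (hi : m tBi 0 0 = i) (hi0 : 0 ≤ i) (hik : i < k) (hRi : 0 < m tR i 0)
    (hRik : m tR i 0 ≤ k + 1) (hlt : m tK i 0 < U i) :
    augmentProg.run m tDone 0 0 = 1 ∧ AssignInv n k W U (c - 1) (augmentProg.run m) := by
  set m₁ := (put tCur (.scalar tBi)).run ((FProg.set tK (.scalar tBi) (.const 0)
    (.add (.entry tK tBi) (.const 1))).run ((put tDone (.const 1)).run m)) with hm₁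
  have hrun : augmentProg.run m =
    (FProg.rep vT 2 (guard (.lt (.scalar tCur) (.param 2)) moveProg)).run m₁ := rfl
  have e0 : m₁ 0 = m 0 := by simp [hm₁, run, Mem.write_table]
  have eQ : m₁ tQ = m tQ := by simp [hm₁, run, Mem.write_table]
  have eL : m₁ tLam = m tLam := by simp [hm₁, run, Mem.write_table]
  have eM : m₁ tMov = m tMov := by simp [hm₁, run, Mem.write_table]
  have eC : m₁ tCur 0 0 = i := by simp [hm₁, run, Expr.eval, Mem.write, hi]
  have eD : m₁ tDone 0 0 = 1 := by simp [hm₁, run, Expr.eval, Mem.write]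
  have eK : ∀ j, m₁ tK j 0 = if j = i then m tK i 0 + 1 else m tK j 0 := fun j => by
    simp [hm₁, run, Expr.eval, Mem.write, hi]
  have eQc : col m₁ tQ = col m tQ := col_congr eQ
  have eLc : col m₁ tLam = col m tLam := col_congr eL
  have eMc : col m₁ tMov = col m tMov := col_congr eM
  have hAug : AugInv n k W U (col m₁ tQ) (col m₁ tLam) (col m₁ tK) (col m tR) (col m₁ tMov) c
      (m₁ tCur 0 0) := by
    rw [eC, eQc, eLc, eMc]
    refine ⟨⟨hA.dual.range, hA.dual.nonneg, hA.dual.tight, ?_, ?_⟩, hi0, hik.le, hRi, ?_, ?_,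
      fun j h0 h1 h2 _ => hreached j h0 h1 h2⟩
    · intro j h0 h1
      change m₁ tK j 0 ≤ U j
      rw [eK]
      split_ifs with hj
      · subst hj; omega
      · exact hA.dual.cap j h0 h1
    · intro j h0 h1 h2
      change m₁ tK j 0 < U j at h2
      rw [eK] at h2
      refine hA.dual.slack j h0 h1 ?_
      change m tK j 0 < U j
      split_ifs at h2 with hj
      · subst hj; omega
      · exact h2
    · intro j h0 h1
      change m₁ tK j 0 = _
      rw [eK, ← hA.count j h0 h1]
      split_ifs with hj
      · rw [hj]
      · simp
    · rw [if_neg hik.ne', hA.free, add_zero]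
  have key := run_augmentLoop (by rw [e0, hk]) hk0 hAug hRk (by rw [eC]; exact hRik)
  rw [hrun]
  set L := FProg.rep vT 2 (guard (.lt (.scalar tCur) (.param 2)) moveProg)
  have fD : L.run m₁ tDone = m₁ tDone := run_table _ rfl _
  have fL : L.run m₁ tLam = m₁ tLam := run_table _ rfl _
  have fK : L.run m₁ tK = m₁ tK := run_table _ rfl _
  refine ⟨by rw [fD, eD], ⟨?_, ?_, ?_⟩⟩
  · have := key.dual
    rwa [col_congr fL, col_congr fK]
  · intro j h0 h1
    have := key.count j h0 h1
    rw [if_neg h1.ne, add_zero] at this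
    rw [fK]; exact this
  · have := key.free
    rw [if_pos rfl] at this
    omega

/-- A free point lies in the dummy, which is reached, and some cluster is not full, hence unreached;
so an edge leaves the tree, and δ ≥ 0 by tightness. After the raise the cheapest such edge is tight.
Its end either has room, and a point is added, or is full and joins the tree. -/
theorem run_growProg {n k c r : ℤ} {W : ℤ → ℤ → ℤ} {U : ℤ → ℤ} {m : Mem} (hn : m 0 0 0 = n)
    (hn0 : 0 ≤ n) (hk : m 0 0 2 = k) (hk0 : 0 ≤ k) (hW : m tW = W) (hU : ∀ i, m tU i 0 = U i)
    (hUn : n ≤ ∑ i ∈ Ico 0 k, U i) (hc : 0 < c) (hr : 0 ≤ r) (hd : m tDone 0 0 = 0)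
    (hA : AssignInv n k W U c m) (hT : TreeInv n k W U (r + 1) m) :
    (growProg.run m tDone 0 0 = 1 ∧ AssignInv n k W U (c - 1) (growProg.run m)) ∨
      (growProg.run m tDone 0 0 = 0 ∧ AssignInv n k W U c (growProg.run m) ∧
        TreeInv n k W U r (growProg.run m)) := by
  obtain ⟨q₁, hq₁0, hq₁n, hq₁⟩ := exists_of_countEq_pos (by rw [hA.free]; exact hc)
  change m tQ q₁ 0 = k at hq₁
  obtain ⟨i₁, hi₁0, hi₁k, hi₁⟩ : ∃ i, 0 ≤ i ∧ i < k ∧ m tR i 0 ≤ 0 := by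
    by_contra! hall
    exact hA.dual.not_all_full hn0 hk0 hA.count hUn (by rw [hA.free]; exact hc)
      fun i h0 h1 => hT.full i h0 h1 (hall i h0 h1)
  obtain ⟨q, i, ⟨hq0, hqn⟩, ⟨hi0, hik⟩, hRq, hRi, hbq, hbi, hbest, hmin⟩ :=
    run_slackProg hn hn0 hk hk0 ⟨hq₁0, hq₁n⟩ ⟨hi₁0, hi₁k⟩ (by rw [hq₁, hT.root]; norm_num) hi₁
  set m₁ := slackProg.run m with hm₁
  have f0 : m₁ 0 = m 0 := run_table _ rfl _
  have fQ : m₁ tQ = m tQ := run_table _ rfl _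
  have fL : m₁ tLam = m tLam := run_table _ rfl _
  have fK : m₁ tK = m tK := run_table _ rfl _
  have fR : m₁ tR = m tR := run_table _ rfl _
  have fM : m₁ tMov = m tMov := run_table _ rfl _
  have fk : m₁ tRk = m tRk := run_table _ rfl _
  have fU : m₁ tU = m tU := run_table _ rfl _
  have fD : m₁ tDone = m tDone := run_table _ rfl _
  set δ := m₁ tBest 0 0 with hδ
  have hraise := run_raiseProg (m := m₁) (by rw [f0, hk]) hk0 (by rw [fR, hT.root]; norm_num)
  rw [fR, fL, ← hδ] at hraise
  set m₂ := raiseProg.run m₁ with hm₂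
  have g0 : m₂ 0 = m 0 := (run_table _ rfl _).trans f0
  have gQ : m₂ tQ = m tQ := (run_table _ rfl _).trans fQ
  have gK : m₂ tK = m tK := (run_table _ rfl _).trans fK
  have gR : m₂ tR = m tR := (run_table _ rfl _).trans fR
  have gM : m₂ tMov = m tMov := (run_table _ rfl _).trans fM
  have gk : m₂ tRk = m tRk := (run_table _ rfl _).trans fk
  have gU : m₂ tU = m tU := (run_table _ rfl _).trans fU
  have gD : m₂ tDone = m tDone := (run_table _ rfl _).trans fD
  have gq : m₂ tBq 0 0 = q := by rw [hm₂, run_table _ rfl, hbq]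
  have gi : m₂ tBi 0 0 = i := by rw [hm₂, run_table _ rfl, hbi]
  set m₃ := reachProg.run m₂ with hm₃
  have hrun : growProg.run m =
      (guard (.lt (.entry tK tBi) (.entry tU tBi)) augmentProg).run m₃ := rfl
  have k0 : m₃ 0 = m 0 := (run_table _ rfl _).trans g0
  have kQ : m₃ tQ = m tQ := (run_table _ rfl _).trans gQ
  have kK : m₃ tK = m tK := (run_table _ rfl _).trans gK
  have kU : m₃ tU = m tU := (run_table _ rfl _).trans gU
  have kD : m₃ tDone = m tDone := (run_table _ rfl _).trans gD
  have kL : m₃ tLam = m₂ tLam := run_table _ rfl _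
  have ki : m₃ tBi 0 0 = i := by rw [hm₃, run_table _ rfl, gi]
  have kk : m₃ tRk 0 0 = m tRk 0 0 + 1 := by
    simp [hm₃, reachProg, run, Expr.eval, Mem.write, gk]
  have kR : ∀ j, m₃ tR j 0 = if j = i then m tRk 0 0 + 1 else m tR j 0 := fun j => by
    simp [hm₃, reachProg, run, Expr.eval, Mem.write, gk, gi, gR]
  have kM : ∀ j, m₃ tMov j 0 = if j = i then q else m tMov j 0 := fun j => by
    simp [hm₃, reachProg, run, Expr.eval, Mem.write, gi, gq, gM]
  have hlam : ∀ j, 0 ≤ j → j ≤ k → m₃ tLam j 0 = if 0 < m tR j 0 then m tLam j 0 + δ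
      else m tLam j 0 := fun j h0 h1 => by rw [kL, hraise j h0 h1]
  have kQc : col m₃ tQ = col m tQ := col_congr kQ
  have kKc : col m₃ tK = col m tK := col_congr kK
  have hδ0 : 0 ≤ δ := by
    have h : W q (m tQ q 0) + m tLam (m tQ q 0) 0 ≤ W q i + m tLam i 0 :=
      hA.dual.tight q i hq0 hqn hi0 hik
    rw [hW] at hbest; omega
  have hdual : DualInv n k W U (col m₃ tQ) (col m₃ tLam) (col m₃ tK) := by
    rw [kQc, kKc]
    refine hA.dual.raise (R := col m tR) hT.full hδ0 (fun q' i' h1 h2 h3 h4 h5 h6 => ?_) hlam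
    have := hmin q' i' ⟨h1, h2⟩ ⟨h3, h4⟩ h5 h6
    rwa [hW] at this
  have hA₃ : AssignInv n k W U c m₃ := by
    refine ⟨hdual, ?_, ?_⟩
    · rw [kQc, kK]; exact hA.count
    · rw [kQc]; exact hA.free
  have hik' : i ≠ k := hik.ne
  have hreached : ∀ j, 0 ≤ j → j < k → 0 < m₃ tR j 0 →
      Reached n W (col m₃ tQ) (col m₃ tLam) (col m₃ tR) (col m₃ tMov) j := by
    intro j h0 h1 h2
    rw [kQc]
    exact Reached.raise (R := col m tR) (mv := col m tMov) (lam := col m tLam) hA.dual.range hq0 hqn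
      hi0 hik hRq hRi (by rw [hbest, hW]) (fun j h0 h1 => Int.lt_add_one_iff.2 (hT.le_rk j h0 h1))
      hlam kR kM hT.reached h0 h1 h2
  have hroot : m₃ tR k 0 = 1 := by rw [kR, if_neg hik'.symm, hT.root]
  have hrk1 : 1 ≤ m tRk 0 0 := by
    have := hT.le_rk k hk0 le_rfl
    rwa [hT.root] at this
  have hRi3 : m₃ tR i 0 = m tRk 0 0 + 1 := by rw [kR, if_pos rfl]
  have hrk := hT.rk
  rw [hrun]
  by_cases hlt : m tK i 0 < U i
  · left
    have : (guard (.lt (.entry tK tBi) (.entry tU tBi)) augmentProg).run m₃ = augmentProg.run m₃ := by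
      simp [run, Expr.eval, ki, kK, kU, hU, hlt]
    rw [this]
    exact run_augmentProg (by rw [k0, hk]) hk0 hA₃ hroot hreached ki hi0 hik (by omega) (by omega)
      (by rw [kK]; exact hlt)
  · right
    have : (guard (.lt (.entry tK tBi) (.entry tU tBi)) augmentProg).run m₃ = m₃ := by
      simp [run, Expr.eval, ki, kK, kU, hU, hlt]
    rw [this]
    refine ⟨by rw [kD, hd], hA₃, hroot, by omega, ?_, hreached, ?_, ?_⟩
    · intro j h0 h1
      rw [kR, kk]
      have := hT.le_rk j h0 h1
      split_ifs <;> omega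
    · intro j h0 h1 h2
      rw [kK]
      by_cases hj : j = i
      · subst hj
        have : m tK j 0 ≤ U j := hA.dual.cap j h0 h1
        omega
      · rw [kR, if_neg hj] at h2
        exact hT.full j h0 h1 h2
    · have hmem : i ∈ Ico 0 k := mem_Ico.2 ⟨hi0, hik⟩
      have h1 := hT.unreached
      rw [← add_sum_erase _ _ hmem, if_pos hRi] at h1
      rw [← add_sum_erase _ _ hmem, hRi3, if_neg (by omega)]
      have : ∑ j ∈ (Ico 0 k).erase i, (if m₃ tR j 0 ≤ 0 then (1 : ℤ) else 0) =
          ∑ j ∈ (Ico 0 k).erase i, if m tR j 0 ≤ 0 then 1 else 0 := by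
        refine sum_congr rfl fun j hj => ?_
        rw [kR, if_neg (mem_erase.1 hj).1]
      rw [this]
      omega

theorem run_rootProg {n k : ℤ} {W : ℤ → ℤ → ℤ} {U : ℤ → ℤ} {m : Mem} (hk : m 0 0 2 = k)
    (hk0 : 0 ≤ k) : rootProg.run m tDone 0 0 = 0 ∧ TreeInv n k W U k (rootProg.run m) := by
  set L := FProg.rep vI 2 (.set tR (.scalar vI) (.const 0) (.const 0)) with hL
  have key : ∀ i, 0 ≤ i → i < k → L.run m tR i 0 = 0 := by
    refine rep_forall (fun i m' => m' tR i 0 = 0) hk hk0 ?_ ?_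
    · intro r m' _ _ _; simp [run, Expr.eval, Mem.write]
    · intro r r' m' _ _ _ _ h; simp [run, Expr.eval, Mem.write, h]
  have e0 : L.run m 0 0 2 = k := by rw [run_table _ rfl, hk]
  have hR : ∀ i, rootProg.run m tR i 0 = if i = k then 1 else L.run m tR i 0 := fun i => by
    change (put tRk (.const 1)).run ((put tDone (.const 0)).run
      ((FProg.set tR (.param 2) (.const 0) (.const 1)).run (L.run m))) tR i 0 = _
    simp [run, Expr.eval, Mem.write, e0]
  have hrk : rootProg.run m tRk 0 0 = 1 := by simp [rootProg, run, Expr.eval, Mem.write]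
  have hz : ∀ i, 0 ≤ i → i < k → rootProg.run m tR i 0 = 0 := fun i h0 h1 => by
    rw [hR, if_neg h1.ne, key i h0 h1]
  refine ⟨by simp [rootProg, run, Expr.eval, Mem.write], ?_, ?_, ?_, ?_, ?_, ?_⟩
  · rw [hR, if_pos rfl]
  · rw [hrk]; ring
  · intro i h0 h1
    rw [hrk]
    rcases h1.eq_or_lt with rfl | h1
    · rw [hR, if_pos rfl]
    · rw [hz i h0 h1]; norm_num
  · intro i h0 h1 h2
    rw [hz i h0 h1] at h2; omega
  · intro i h0 h1 h2
    rw [hz i h0 h1] at h2; omega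
  · refine (sum_le_sum (g := fun _ => (1 : ℤ)) fun i _ => by split_ifs <;> norm_num).trans ?_
    simp [hk0]

/-- If none of the k growth steps augmented, every cluster would be reached and hence full, contrary
to `DualInv.not_all_full`. -/
theorem run_phaseProg {n k c : ℤ} {W : ℤ → ℤ → ℤ} {U : ℤ → ℤ} {m : Mem} (hn : m 0 0 0 = n)
    (hn0 : 0 ≤ n) (hk : m 0 0 2 = k) (hk0 : 0 ≤ k) (hW : m tW = W) (hU : ∀ i, m tU i 0 = U i)
    (hUn : n ≤ ∑ i ∈ Ico 0 k, U i) (hc : 0 < c) (hA : AssignInv n k W U c m) :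
    AssignInv n k W U (c - 1) (phaseProg.run m) := by
  set m₀ := rootProg.run m with hm₀
  have hA₀ : AssignInv n k W U c m₀ :=
    hA.congr (run_table _ rfl _) (run_table _ rfl _) (run_table _ rfl _)
  obtain ⟨hd, hT⟩ := run_rootProg (n := n) (W := W) (U := U) hk hk0
  rw [← hm₀] at hd hT
  have f0 : m₀ 0 = m 0 := run_table _ rfl _
  have fW : m₀ tW = m tW := run_table _ rfl _
  have fU : m₀ tU = m tU := run_table _ rfl _
  have key := rep_rule (v := vS) (s := 2) (c := guard (.le (.scalar tDone) (.const 0)) growProg)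
    (m := m₀) (fun r m' => (m' tDone 0 0 = 1 ∧ AssignInv n k W U (c - 1) m') ∨
      (m' tDone 0 0 = 0 ∧ AssignInv n k W U c m' ∧ TreeInv n k W U r m')) ((congrFun (congrFun f0 0) 2).trans hk) hk0 ?_ ?_
  · change AssignInv n k W U (c - 1) ((FProg.rep vS 2
      (guard (.le (.scalar tDone) (.const 0)) growProg)).run m₀)
    rcases key with ⟨-, h⟩ | ⟨-, h, hT'⟩
    · exact h
    · exfalso
      refine h.dual.not_all_full hn0 hk0 h.count hUn (by rw [h.free]; exact hc) fun i h0 h1 =>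
        hT'.full i h0 h1 ?_
      by_contra hR
      have h2 := (sum_eq_zero_iff_of_nonneg fun i _ => by split_ifs <;> norm_num).1
        (le_antisymm hT'.unreached (sum_nonneg fun i _ => by split_ifs <;> norm_num)) i
        (mem_Ico.2 ⟨h0, h1⟩)
      simp [not_lt.1 hR] at h2
  · right
    exact ⟨by rw [Mem.write_table (by decide), hd],
      hA₀.congr (Mem.write_table (by decide) _ _ _ _) (Mem.write_table (by decide) _ _ _ _)
        (Mem.write_table (by decide) _ _ _ _),
      hT.congr (Mem.write_table (by decide) _ _ _ _) (Mem.write_table (by decide) _ _ _ _)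
        (Mem.write_table (by decide) _ _ _ _) (Mem.write_table (by decide) _ _ _ _)
        (Mem.write_table (by decide) _ _ _ _) (Mem.write_table (by decide) _ _ _ _)⟩
  · intro r m' h0 h1 hf hI
    have hw : ∀ a, a ≠ vS → m'.write vS 0 0 r a = m' a := fun a h => Mem.write_table h _ _ _ _
    rcases hI with ⟨hd', hA'⟩ | ⟨hd', hA', hT'⟩
    · have : (guard (.le (.scalar tDone) (.const 0)) growProg).run (m'.write vS 0 0 r) =
          m'.write vS 0 0 r := by
        simp [run, Expr.eval, hw, hd']
      rw [this]
      exact Or.inl ⟨by rw [hw _ (by decide), hd'],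
        hA'.congr (hw _ (by decide)) (hw _ (by decide)) (hw _ (by decide))⟩
    · have : (guard (.le (.scalar tDone) (.const 0)) growProg).run (m'.write vS 0 0 r) =
          growProg.run (m'.write vS 0 0 r) := by
        simp [run, Expr.eval, hw, hd']
      rw [this]
      refine run_growProg ?_ hn0 ?_ hk0 ?_ ?_ hUn hc h0 ?_ ?_ ?_
      · rw [hw _ (by decide), hf 0 rfl, f0, hn]
      · rw [hw _ (by decide), hf 0 rfl, f0, hk]
      · rw [hw _ (by decide), hf tW rfl, fW, hW]
      · intro i; rw [hw _ (by decide), hf tU rfl, fU, hU]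
      · rw [hw _ (by decide), hd']
      · exact hA'.congr (hw _ (by decide)) (hw _ (by decide)) (hw _ (by decide))
      · exact hT'.congr (hw _ (by decide)) (hw _ (by decide)) (hw _ (by decide)) (hw _ (by decide))
          (hw _ (by decide)) (hw _ (by decide))

/-- Zero prices certify the empty assignment: the dummy costs 0, and no other cost is negative. Only
the dummy column of the cost table is overwritten. -/
theorem run_startProg {n k : ℤ} {U : ℤ → ℤ} {m : Mem} (hn : m 0 0 0 = n) (hn0 : 0 ≤ n)
    (hk : m 0 0 2 = k) (hk0 : 0 ≤ k)
    (hW : ∀ p i, 0 ≤ p → p < n → 0 ≤ i → i < k → 0 ≤ m tW p i) (hU : ∀ i, 0 ≤ i → i < k → 0 ≤ U i) :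
    AssignInv n k (startProg.run m tW) U n (startProg.run m) ∧
      ∀ p i, i ≠ k → startProg.run m tW p i = m tW p i := by
  set L := FProg.rep vI 2 (.set tLam (.scalar vI) (.const 0) (.const 0) ;;
    .set tK (.scalar vI) (.const 0) (.const 0)) with hL
  have key : ∀ i, 0 ≤ i → i < k → L.run m tLam i 0 = 0 ∧ L.run m tK i 0 = 0 := by
    refine rep_forall (fun i m' => m' tLam i 0 = 0 ∧ m' tK i 0 = 0) hk hk0 ?_ ?_
    · intro r m' _ _ _; simp [run, Expr.eval, Mem.write]
    · intro r r' m' _ _ _ _ h; simp [run, Expr.eval, Mem.write, h]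
  set m₁ := (FProg.set tLam (.param 2) (.const 0) (.const 0)).run (L.run m) with hm₁
  have e0 : m₁ 0 = m 0 := by
    rw [hm₁, run_table _ rfl, run_table _ rfl]
  have eW : m₁ tW = m tW := by
    rw [hm₁, run_table _ rfl, run_table _ rfl]
  have eL : ∀ i, 0 ≤ i → i ≤ k → m₁ tLam i 0 = 0 := fun i h0 h1 => by
    have e2 : L.run m 0 0 2 = k := by rw [run_table _ rfl, hk]
    rcases h1.eq_or_lt with rfl | h1
    · simp [hm₁, run, Expr.eval, Mem.write, e2]
    · simp [hm₁, run, Expr.eval, Mem.write, (key i h0 h1).1]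
  have eK : m₁ tK = L.run m tK := run_table _ rfl _
  set L' := FProg.rep vP 0 (.set tQ (.scalar vP) (.const 0) (.param 2) ;;
    .set tW (.scalar vP) (.param 2) (.const 0)) with hL'
  have hrun : startProg.run m = L'.run m₁ := rfl
  have hn1 : m₁ 0 0 0 = n := by rw [e0, hn]
  have hk1 : m₁ 0 0 2 = k := by rw [e0, hk]
  have key' : ∀ p, 0 ≤ p → p < n → L'.run m₁ tQ p 0 = k ∧ L'.run m₁ tW p k = 0 := by
    refine rep_forall (fun p m' => m' tQ p 0 = k ∧ m' tW p k = 0) hn1 hn0 ?_ ?_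
    · intro r m' _ _ hf
      have h2 := hf 0 rfl
      simp [run, Expr.eval, Mem.write, h2, hk1]
    · intro r r' m' _ hlt _ hf h
      have h2 := hf 0 rfl
      simp [run, Expr.eval, Mem.write, h2, hk1, h, hlt.ne']
  have keyW : ∀ p i, i ≠ k → L'.run m₁ tW p i = m tW p i := by
    refine rep_rule (fun _ m' => ∀ p i, i ≠ k → m' tW p i = m tW p i) hn1 hn0 ?_ ?_
    · intro p i _; rw [Mem.write_table (by decide), eW]
    · intro r m' _ _ hf hI p i hi
      have h2 := hf 0 rfl
      simp [run, Expr.eval, Mem.write, h2, hk1, hi, hI p i hi]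
  rw [hrun]
  have fL : L'.run m₁ tLam = m₁ tLam := run_table _ rfl _
  have fK : L'.run m₁ tK = m₁ tK := run_table _ rfl _
  have hcount : ∀ i, countEq n (col (L'.run m₁) tQ) i = if i = k then n else 0 := by
    intro i
    have : countEq n (col (L'.run m₁) tQ) i = ∑ p ∈ Ico 0 n, if i = k then 1 else 0 := by
      refine sum_congr rfl fun p hp => ?_
      rw [mem_Ico] at hp
      simp only [col, (key' p hp.1 hp.2).1, eq_comm]
    rw [this]
    split_ifs <;> simp [hn0]
  have hK : ∀ i, 0 ≤ i → i < k → L'.run m₁ tK i 0 = 0 := fun i h0 h1 => by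
    rw [fK, eK, (key i h0 h1).2]
  have hLam : ∀ i, 0 ≤ i → i ≤ k → L'.run m₁ tLam i 0 = 0 := fun i h0 h1 => by
    rw [fL, eL i h0 h1]
  refine ⟨⟨⟨?_, ?_, ?_, ?_, ?_⟩, ?_, ?_⟩, keyW⟩
  · intro p h0 h1
    change 0 ≤ L'.run m₁ tQ p 0 ∧ L'.run m₁ tQ p 0 ≤ k
    rw [(key' p h0 h1).1]; exact ⟨hk0, le_rfl⟩
  · intro i h0 h1; exact (hLam i h0 h1.le).ge
  · intro p i h0 h1 h2 h3
    change L'.run m₁ tW p (L'.run m₁ tQ p 0) + L'.run m₁ tLam (L'.run m₁ tQ p 0) 0 ≤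
      L'.run m₁ tW p i + L'.run m₁ tLam i 0
    rw [(key' p h0 h1).1, (key' p h0 h1).2, hLam k hk0 le_rfl, hLam i h2 h3.le, keyW p i h3.ne]
    have := hW p i h0 h1 h2 h3
    omega
  · intro i h0 h1
    change L'.run m₁ tK i 0 ≤ U i
    rw [hK i h0 h1]; exact hU i h0 h1
  · intro i h0 h1 _; exact hLam i h0 h1.le
  · intro i h0 h1
    rw [hK i h0 h1, hcount, if_neg h1.ne]
  · rw [hcount, if_pos rfl]

/-- The assignment program computes a cheapest assignment that respects the capacities. -/
theorem run_assignProg {n k : ℤ} {m : Mem} (hn : m 0 0 0 = n) (hn0 : 0 ≤ n)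
    (hk : m 0 0 2 = k) (hk0 : 0 ≤ k)
    (hW : ∀ p i, 0 ≤ p → p < n → 0 ≤ i → i < k → 0 ≤ m tW p i)
    (hU : ∀ i, 0 ≤ i → i < k → 0 ≤ m tU i 0) (hUn : n ≤ ∑ i ∈ Ico 0 k, m tU i 0) :
    (∀ p, 0 ≤ p → p < n → 0 ≤ assignProg.run m tQ p 0 ∧ assignProg.run m tQ p 0 < k) ∧
      (∀ i, 0 ≤ i → i < k → countEq n (col (assignProg.run m) tQ) i ≤ m tU i 0) ∧
      ∀ S : ℤ → ℤ, (∀ p, 0 ≤ p → p < n → 0 ≤ S p ∧ S p < k) →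
        (∀ i, 0 ≤ i → i < k → countEq n S i ≤ m tU i 0) →
        ∑ p ∈ Ico 0 n, m tW p (assignProg.run m tQ p 0) ≤ ∑ p ∈ Ico 0 n, m tW p (S p) := by
  obtain ⟨hA, hWeq⟩ := run_startProg (U := col m tU) hn hn0 hk hk0 hW hU
  set m₁ := startProg.run m with hm₁
  have f0 : m₁ 0 = m 0 := run_table _ rfl _
  have fU : m₁ tU = m tU := run_table _ rfl _
  have key := rep_rule (v := vH) (s := 0) (c := phaseProg) (m := m₁)
    (fun r m' => AssignInv n k (m₁ tW) (col m tU) r m') ((congrFun (congrFun f0 0) 0).trans hn) hn0 ?_ ?_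
  · change AssignInv n k (m₁ tW) (col m tU) 0 (assignProg.run m) at key
    have hrange : ∀ p, 0 ≤ p → p < n →
        0 ≤ assignProg.run m tQ p 0 ∧ assignProg.run m tQ p 0 < k := fun p h0 h1 => by
      have h2 := key.dual.range p h0 h1
      have h3 := countEq_eq_zero key.free h0 h1
      simp only [col] at h2 h3
      omega
    refine ⟨hrange, fun i h0 h1 => ?_, fun S hS hSU => ?_⟩
    · rw [← key.count i h0 h1]; exact key.dual.cap i h0 h1
    · have := key.dual.optimal key.count key.free hS hSU
      refine le_trans (sum_le_sum fun p hp => ?_) (this.trans (sum_le_sum fun p hp => ?_))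
      · rw [mem_Ico] at hp
        rw [← hWeq p _ (hrange p hp.1 hp.2).2.ne]
      · rw [mem_Ico] at hp
        rw [← hWeq p _ (hS p hp.1 hp.2).2.ne]
  · exact hA.congr (Mem.write_table (by decide) _ _ _ _) (Mem.write_table (by decide) _ _ _ _)
      (Mem.write_table (by decide) _ _ _ _)
  · intro r m' h0 h1 hf hI
    have hw : ∀ a, a ≠ vH → m'.write vH 0 0 r a = m' a := fun a h => Mem.write_table h _ _ _ _
    have hfW : m' tW = m₁ tW := hf tW rfl
    have := run_phaseProg (m := m'.write vH 0 0 r) (W := m₁ tW) (U := col m tU) (n := n) (k := k)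
      (c := r + 1) (by rw [hw _ (by decide), hf 0 rfl, f0, hn]) hn0
      (by rw [hw _ (by decide), hf 0 rfl, f0, hk]) hk0 (by rw [hw _ (by decide), hfW])
      (fun i => by rw [hw _ (by decide), hf tU rfl, fU]) hUn (by omega)
      (hI.congr (hw _ (by decide)) (hw _ (by decide)) (hw _ (by decide)))
    rwa [add_sub_cancel_right] at this

end FProg

end LogRAM

/-! ### Correctness of scaling, counting, copying, costs and capacities -/

namespace LogRAM

theorem mul_self_sub_lt_one {a b : ℤ} : (a - b) * (a - b) < 1 ↔ a = b := by
  constructor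
  · intro h
    by_contra hne
    have : 0 < (a - b) * (a - b) := mul_self_pos.2 (sub_ne_zero.2 hne)
    omega
  · rintro rfl; simp

theorem prod_Ico_step {r N : ℤ} (h : r < N) (f : ℤ → ℤ) :
    ∏ p ∈ Ico r N, f p = f r * ∏ p ∈ Ico (r + 1) N, f p := by
  have : Ico r N = insert r (Ico (r + 1) N) := by
    ext z; simp only [mem_insert, mem_Ico]; omega
  rw [this, prod_insert (by simp)]

namespace FProg

/-- A loop that multiplies an entry by `f r`. -/
theorem rep_prod {v s : ℕ} {c : FProg} {m : Mem} {N : ℤ} {a : ℕ} {i j : ℤ} (f : ℤ → ℤ)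
    (hN : m 0 0 s = N) (hN0 : 0 ≤ N) (hav : a ≠ v)
    (step : ∀ r m', 0 ≤ r → r < N → Frame (.rep v s c) m m' →
      (c.run (m'.write v 0 0 r)) a i j = m' a i j * f r) :
    ((FProg.rep v s c).run m) a i j = m a i j * ∏ r ∈ Ico 0 N, f r := by
  refine rep_rule (fun r m' => m' a i j = m a i j * ∏ r ∈ Ico r N, f r) hN hN0 ?_ ?_
  · rw [Mem.write_table hav]; simp
  · intro r m' h0 h1 hf hI
    rw [step r m' h0 h1 hf, hI, prod_Ico_step h1]; ring

/-- A loop that leaves an entry unchanged. -/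
theorem rep_entry {v s : ℕ} {c : FProg} {m : Mem} {N : ℤ} {a : ℕ} {i j : ℤ}
    (hN : m 0 0 s = N) (hN0 : 0 ≤ N) (hav : a ≠ v)
    (step : ∀ r m', 0 ≤ r → r < N → Frame (.rep v s c) m m' →
      (c.run (m'.write v 0 0 r)) a i j = m' a i j) :
    ((FProg.rep v s c).run m) a i j = m a i j := by
  have := rep_sum (fun _ => 0) hN hN0 hav fun r m' h0 h1 hf => by
    rw [step r m' h0 h1 hf, add_zero]
  simpa using this

/-- `D` is n! times the product of all denominators. Each denominator already divides the second
factor, so the factor n! remains after the division. -/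
theorem run_scaleProg {n d : ℤ} {m : Mem} (hn : m 0 0 0 = n) (hn0 : 0 ≤ n) (hd : m 0 0 1 = d)
    (hd0 : 0 ≤ d) (hden : ∀ p j, 0 ≤ p → p < n → 0 ≤ j → j < d → 0 < m 2 p j) :
    ∃ D, 0 < D ∧ ∀ p j, 0 ≤ p → p < n → 0 ≤ j → j < d →
      scaleProg.run m tX p j * m 2 p j = D * m 1 p j ∧
        (∏ p ∈ Ico 0 n, (p + 1)) ∣ scaleProg.run m tX p j := by
  set L₁ := FProg.rep vP 0 (put tD (.mul (.scalar tD) (.add (.scalar vP) (.const 1))) ;;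
    .rep vJ 1 (put tD (.mul (.scalar tD) (.entry₂ 2 vP vJ)))) with hL₁
  set L₂ := FProg.rep vP 0 (.rep vJ 1 (.set tX (.scalar vP) (.scalar vJ)
    (.mul (.entry₂ 1 vP vJ) (.div (.scalar tD) (.entry₂ 2 vP vJ))))) with hL₂
  set m₀ := (put tD (.const 1)).run m with hm₀
  have e0 : m₀ 0 = m 0 := run_table _ rfl _
  have e1 : m₀ 1 = m 1 := run_table _ rfl _
  have e2 : m₀ 2 = m 2 := run_table _ rfl _
  have eD : m₀ tD 0 0 = 1 := by simp [hm₀, run, Expr.eval, Mem.write]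
  have hD : L₁.run m₀ tD 0 0 =
      ∏ p ∈ Ico 0 n, ((p + 1) * ∏ j ∈ Ico 0 d, m 2 p j) := by
    have := rep_prod (v := vP) (s := 0) (a := tD) (i := 0) (j := 0) (m := m₀)
      (c := put tD (.mul (.scalar tD) (.add (.scalar vP) (.const 1))) ;;
        .rep vJ 1 (put tD (.mul (.scalar tD) (.entry₂ 2 vP vJ))))
      (fun p => (p + 1) * ∏ j ∈ Ico 0 d, m 2 p j) ((congrFun (congrFun e0 0) 0).trans hn) hn0
      (by decide) ?_
    · rw [this, eD, one_mul]
    · intro p m' hp0 hp1 hf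
      have f0 := hf 0 rfl
      have f2 := hf 2 rfl
      set m₁ := (put tD (.mul (.scalar tD) (.add (.scalar vP) (.const 1)))).run (m'.write vP 0 0 p)
        with hm₁
      have g0 : m₁ 0 = m 0 := by
        rw [hm₁, run_table _ rfl, Mem.write_table (by decide), f0, e0]
      have g2 : m₁ 2 = m 2 := by
        rw [hm₁, run_table _ rfl, Mem.write_table (by decide), f2, e2]
      have gP : m₁ vP 0 0 = p := by
        rw [hm₁, run_table _ rfl, Mem.write_apply]; simp
      have gD : m₁ tD 0 0 = m' tD 0 0 * (p + 1) := by
        simp [hm₁, run, Expr.eval, Mem.write]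
      have := rep_prod (v := vJ) (s := 1) (a := tD) (i := 0) (j := 0) (m := m₁)
        (c := put tD (.mul (.scalar tD) (.entry₂ 2 vP vJ))) (fun j => m 2 p j)
        ((congrFun (congrFun g0 0) 1).trans hd) hd0 (by decide) ?_
      · rw [run, this, gD, mul_assoc]
      · intro j m'' _ _ hf'
        have h2 := hf' 2 rfl
        have hP := hf' vP rfl
        simp [run, Expr.eval, Mem.write, h2, hP, g2, gP]
  set D := ∏ p ∈ Ico 0 n, ((p + 1) * ∏ j ∈ Ico 0 d, m 2 p j) with hDdef
  have hX : ∀ p, 0 ≤ p → p < n → ∀ j, 0 ≤ j → j < d →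
      scaleProg.run m tX p j = m 1 p j * (D / m 2 p j) := by
    have h0 : L₁.run m₀ 0 = m 0 := by rw [run_table _ rfl, e0]
    have h1 : L₁.run m₀ 1 = m 1 := by rw [run_table _ rfl, e1]
    have h2 : L₁.run m₀ 2 = m 2 := by rw [run_table _ rfl, e2]
    refine rep_forall (v := vP) (s := 0) (m := L₁.run m₀) (fun p m' => ∀ j, 0 ≤ j → j < d →
      m' tX p j = m 1 p j * (D / m 2 p j)) ((congrFun (congrFun h0 0) 0).trans hn) hn0 ?_ ?_
    · intro p m' _ _ hf
      have f0 : (m'.write vP 0 0 p) 0 = m 0 := by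
        rw [Mem.write_table (by decide), hf 0 rfl, h0]
      refine rep_forall (v := vJ) (s := 1) (fun j m' => m' tX p j = m 1 p j * (D / m 2 p j))
        ((congrFun (congrFun f0 0) 1).trans hd) hd0 ?_ ?_
      · intro j m'' _ _ hf'
        have g1 : m'' 1 = m 1 := by rw [hf' 1 rfl, Mem.write_table (by decide), hf 1 rfl, h1]
        have g2 : m'' 2 = m 2 := by rw [hf' 2 rfl, Mem.write_table (by decide), hf 2 rfl, h2]
        have gD : m'' tD 0 0 = D := by
          rw [hf' tD rfl, Mem.write_table (by decide), hf tD rfl, hD]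
        have gP : m'' vP 0 0 = p := by rw [hf' vP rfl, Mem.write_apply]; simp
        simp [run, Expr.eval, Mem.write, g1, g2, gD, gP]
      · intro j j' m'' _ hj _ hf' h
        simp [run, Expr.eval, Mem.write, h, hj.ne']
    · intro p p' m' _ hp _ hf h j hj0 hj1
      rw [← h j hj0 hj1]
      have f0 : (m'.write vP 0 0 p) 0 = m 0 := by
        rw [Mem.write_table (by decide), hf 0 rfl, h0]
      refine (rep_entry ((congrFun (congrFun f0 0) 1).trans hd) hd0 (by decide) ?_).trans
        (by rw [Mem.write_table (by decide)])
      intro j' m'' _ _ hf'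
      have gP : m'' vP 0 0 = p := by rw [hf' vP rfl, Mem.write_apply]; simp
      simp [run, Expr.eval, Mem.write, gP, hp.ne']
  have hpos : ∀ p ∈ Ico 0 n, 0 < ∏ j ∈ Ico 0 d, m 2 p j := fun p hp => by
    rw [mem_Ico] at hp
    refine prod_pos fun j hj => ?_
    rw [mem_Ico] at hj
    exact hden p j hp.1 hp.2 hj.1 hj.2
  refine ⟨D, prod_pos fun p hp => ?_, fun p j hp0 hp1 hj0 hj1 => ?_⟩
  · have := hpos p hp
    rw [mem_Ico] at hp
    exact mul_pos (by omega) this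
  · rw [hX p hp0 hp1 j hj0 hj1]
    have hmul : D = (∏ p ∈ Ico 0 n, (p + 1)) * ∏ p ∈ Ico 0 n, ∏ j ∈ Ico 0 d, m 2 p j :=
      prod_mul_distrib
    have hdvd : m 2 p j ∣ ∏ p ∈ Ico 0 n, ∏ j ∈ Ico 0 d, m 2 p j :=
      (dvd_prod_of_mem (fun j => m 2 p j) (mem_Ico.2 ⟨hj0, hj1⟩)).trans
        (dvd_prod_of_mem (fun p => ∏ j ∈ Ico 0 d, m 2 p j) (mem_Ico.2 ⟨hp0, hp1⟩))
    constructor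
    · rw [mul_assoc, Int.ediv_mul_cancel (hmul ▸ hdvd.mul_left _), mul_comm]
    · rw [hmul, Int.mul_ediv_assoc _ hdvd]
      exact (dvd_mul_right _ _).mul_left _

theorem run_countProg {n k : ℤ} {m : Mem} (hn : m 0 0 0 = n) (hn0 : 0 ≤ n) (hk : m 0 0 2 = k)
    (hk0 : 0 ≤ k) : ∀ i, 0 ≤ i → i < k → countProg.run m tM i 0 = countEq n (col m 3) i := by
  refine rep_forall (fun i m' => m' tM i 0 = countEq n (col m 3) i) hk hk0 ?_ ?_
  · intro i m' _ _ hf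
    set m₁ := (FProg.set tM (.scalar vI) (.const 0) (.const 0)).run (m'.write vI 0 0 i) with hm₁
    have g0 : m₁ 0 = m 0 := by
      rw [hm₁, run_table _ rfl, Mem.write_table (by decide), hf 0 rfl]
    have g3 : m₁ 3 = m 3 := by
      rw [hm₁, run_table _ rfl, Mem.write_table (by decide), hf 3 rfl]
    have gI : m₁ vI 0 0 = i := by rw [hm₁, run_table _ rfl, Mem.write_apply]; simp
    have gM : m₁ tM i 0 = 0 := by simp [hm₁, run, Expr.eval, Mem.write]
    refine (rep_sum (m := m₁) (fun p => if m 3 p 0 = i then 1 else 0)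
      ((congrFun (congrFun g0 0) 0).trans hn) hn0 (by decide) ?_).trans
      (by rw [gM, zero_add]; rfl)
    intro p m'' _ _ hf'
    have h3 := hf' 3 rfl
    have hI := hf' vI rfl
    by_cases hp : m 3 p 0 = i <;>
      simp [run, Expr.eval, Mem.write, h3, hI, g3, gI, hp, mul_self_sub_lt_one]
  · intro i i' m' _ hi _ hf h
    rw [← h]
    set m₁ := (FProg.set tM (.scalar vI) (.const 0) (.const 0)).run (m'.write vI 0 0 i) with hm₁
    have g0 : m₁ 0 = m 0 := by
      rw [hm₁, run_table _ rfl, Mem.write_table (by decide), hf 0 rfl]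
    have gI : m₁ vI 0 0 = i := by rw [hm₁, run_table _ rfl, Mem.write_apply]; simp
    have gM : m₁ tM i' 0 = m' tM i' 0 := by simp [hm₁, run, Expr.eval, Mem.write, hi.ne']
    refine (rep_entry (m := m₁) ((congrFun (congrFun g0 0) 0).trans hn) hn0 (by decide) ?_).trans gM
    intro p m'' _ _ hf'
    have hI := hf' vI rfl
    by_cases hp : m'' 3 p 0 = i <;>
      simp [run, Expr.eval, Mem.write, hI, gI, hp, mul_self_sub_lt_one, hi.ne']

theorem run_initProg {n : ℤ} {m : Mem} (hn : m 0 0 0 = n) (hn0 : 0 ≤ n) :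
    ∀ p, 0 ≤ p → p < n → initProg.run m tQ p 0 = m 3 p 0 := by
  refine rep_forall (fun p m' => m' tQ p 0 = m 3 p 0) hn hn0 ?_ ?_
  · intro p m' _ _ hf
    have h3 := hf 3 rfl
    simp [run, Expr.eval, Mem.write, h3]
  · intro p p' m' _ hp _ _ h
    simp [run, Expr.eval, Mem.write, h, hp.ne']

theorem run_keepProg {n : ℤ} {m : Mem} (hn : m 0 0 0 = n) (hn0 : 0 ≤ n) :
    keepProg.run m tOpt 0 0 = m tCost 0 0 ∧
      ∀ p, 0 ≤ p → p < n → keepProg.run m tOut p 0 = m tQ p 0 := by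
  constructor
  · set L := FProg.rep vP 0 (.set tOut (.scalar vP) (.const 0) (.entry tQ vP)) with hL
    have h : L.run m tCost = m tCost := run_table _ rfl _
    simp [keepProg, run, Expr.eval, Mem.write, ← h]
    rfl
  · intro p hp0 hp1
    change (put tOpt (.scalar tCost)).run _ tOut p 0 = _
    rw [run_table _ rfl]
    refine rep_forall (fun p m' => m' tOut p 0 = m tQ p 0) hn hn0 ?_ ?_ p hp0 hp1
    · intro p m' _ _ hf
      have h3 := hf tQ rfl
      simp [run, Expr.eval, Mem.write, h3]
    · intro p p' m' _ hp _ _ h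
      simp [run, Expr.eval, Mem.write, h, hp.ne']

theorem run_costProg {n d : ℤ} {m : Mem} (hn : m 0 0 0 = n) (hn0 : 0 ≤ n) (hd : m 0 0 1 = d)
    (hd0 : 0 ≤ d) : costProg.run m tCost 0 0 = ∑ p ∈ Ico 0 n, ∑ q ∈ Ico 0 n,
      if m tQ p 0 = m tQ q 0 then ∑ j ∈ Ico 0 d, (m tX p j - m tX q j) ^ 2 else 0 := by
  set m₀ := (put tCost (.const 0)).run m with hm₀
  have e0 : m₀ 0 = m 0 := run_table _ rfl _
  have eQ : m₀ tQ = m tQ := run_table _ rfl _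
  have eX : m₀ tX = m tX := run_table _ rfl _
  have eC : m₀ tCost 0 0 = 0 := by simp [hm₀, run, Expr.eval, Mem.write]
  refine (rep_sum (m := m₀) (fun p => ∑ q ∈ Ico 0 n,
    if m tQ p 0 = m tQ q 0 then ∑ j ∈ Ico 0 d, (m tX p j - m tX q j) ^ 2 else 0)
    ((congrFun (congrFun e0 0) 0).trans hn) hn0 (by decide) ?_).trans (by rw [eC, zero_add])
  intro p m₁ _ _ hf₁
  have f0 : (m₁.write vP 0 0 p) 0 = m 0 := by
    rw [Mem.write_table (by decide), hf₁ 0 rfl, e0]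
  refine (rep_sum (m := m₁.write vP 0 0 p) (fun q =>
    if m tQ p 0 = m tQ q 0 then ∑ j ∈ Ico 0 d, (m tX p j - m tX q j) ^ 2 else 0)
    ((congrFun (congrFun f0 0) 0).trans hn) hn0 (by decide) ?_).trans
    (by rw [Mem.write_table (by decide)])
  intro q m₂ _ _ hf₂
  set m₃ := m₂.write vQ 0 0 q with hm₃
  have g0 : m₃ 0 = m 0 := by rw [hm₃, Mem.write_table (by decide), hf₂ 0 rfl, f0]
  have gQ : m₃ tQ = m tQ := by
    rw [hm₃, Mem.write_table (by decide), hf₂ tQ rfl, Mem.write_table (by decide), hf₁ tQ rfl, eQ]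
  have gX : m₃ tX = m tX := by
    rw [hm₃, Mem.write_table (by decide), hf₂ tX rfl, Mem.write_table (by decide), hf₁ tX rfl, eX]
  have gP : m₃ vP 0 0 = p := by
    rw [hm₃, Mem.write_table (by decide), hf₂ vP rfl, Mem.write_apply]; simp
  have gq : m₃ vQ 0 0 = q := by rw [hm₃, Mem.write_apply]; simp
  have gC : m₃ tCost 0 0 = m₂ tCost 0 0 := by rw [hm₃, Mem.write_table (by decide)]
  by_cases hpq : m tQ p 0 = m tQ q 0
  · rw [if_pos hpq, run]
    simp only [Expr.eval, gQ, gP, gq, hpq, sub_self, mul_zero, sub_zero, zero_lt_one, decide_true,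
      select_true]
    rw [← gC]
    refine rep_sum (m := m₃) (fun j => (m tX p j - m tX q j) ^ 2)
      ((congrFun (congrFun g0 0) 1).trans hd) hd0 (by decide) ?_
    intro j m₄ _ _ hf₄
    have h1 := hf₄ tX rfl
    have h2 := hf₄ vP rfl
    have h3 := hf₄ vQ rfl
    simp [run, Expr.eval, Mem.write, h1, h2, h3, gX, gP, gq, sq]
  · rw [if_neg hpq, add_zero, ← gC]
    simp [run, Expr.eval, gQ, gP, gq, mul_self_sub_lt_one, hpq]

theorem run_weightProg {n d k : ℤ} {m : Mem} (hn : m 0 0 0 = n) (hn0 : 0 ≤ n) (hd : m 0 0 1 = d)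
    (hd0 : 0 ≤ d) (hk : m 0 0 2 = k) (hk0 : 0 ≤ k) :
    (∀ p, 0 ≤ p → p < n → ∀ i, 0 ≤ i → i < k → weightProg.run m tW p i =
      m tM i 0 * ∑ j ∈ Ico 0 d, (m tX p j - m tC i j) ^ 2) ∧
    ∀ i, 0 ≤ i → i < k → weightProg.run m tU i 0 =
      (m vC 0 0 + 1) * m tM i 0 / (m vC 0 0 + 1 - m vB 0 0) := by
  set c₁ := put tAcc (.const 0) ;;
    .rep vJ 1 (put tAcc (.add (.scalar tAcc) (.sq (.sub (.entry₂ tX vP vJ) (.entry₂ tC vI vJ))))) ;;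
    .set tW (.scalar vP) (.scalar vI) (.mul (.entry tM vI) (.scalar tAcc)) with hc₁
  set L₁ := FProg.rep vP 0 (.rep vI 2 c₁) with hL₁
  set L₂ := FProg.rep vI 2 (.set tU (.scalar vI) (.const 0)
    (.div (.mul (.add (.scalar vC) (.const 1)) (.entry tM vI))
      (.sub (.add (.scalar vC) (.const 1)) (.scalar vB)))) with hL₂
  have hrun : weightProg.run m = L₂.run (L₁.run m) := rfl
  constructor
  · intro p hp0 hp1
    rw [hrun, run_table (a := tW) L₂ rfl]
    refine rep_forall (fun p m' => ∀ i, 0 ≤ i → i < k → m' tW p i =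
      m tM i 0 * ∑ j ∈ Ico 0 d, (m tX p j - m tC i j) ^ 2) hn hn0 ?_ ?_ p hp0 hp1
    · intro p m₁ _ _ hf₁
      have f0 : (m₁.write vP 0 0 p) 0 = m 0 := by
        rw [Mem.write_table (by decide), hf₁ 0 rfl]
      refine rep_forall (fun i m' => m' tW p i =
        m tM i 0 * ∑ j ∈ Ico 0 d, (m tX p j - m tC i j) ^ 2)
        ((congrFun (congrFun f0 0) 2).trans hk) hk0 ?_ ?_
      · intro i m₂ _ _ hf₂
        set m₃ := (put tAcc (.const 0)).run (m₂.write vI 0 0 i) with hm₃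
        have g : ∀ a, L₁.writes a = false → m₃ a = m a := fun a ha => by
          have ha' := ha
          simp only [hL₁, hc₁, writes, Bool.or_eq_false_iff, beq_eq_false_iff_ne] at ha
          rw [hm₃, run_table _ (by simp [writes, ha]), Mem.write_table ha.2.1.symm,
            hf₂ a (by simp [writes, hc₁, ha]), Mem.write_table ha.1.symm, hf₁ a ha']
        have gP : m₃ vP 0 0 = p := by
          rw [hm₃, run_table _ rfl, Mem.write_table (by decide), hf₂ vP rfl, Mem.write_apply]; simp
        have gI : m₃ vI 0 0 = i := by rw [hm₃, run_table _ rfl, Mem.write_apply]; simp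
        have gA : m₃ tAcc 0 0 = 0 := by simp [hm₃, run, Expr.eval, Mem.write]
        set L := FProg.rep vJ 1 (put tAcc (.add (.scalar tAcc)
          (.sq (.sub (.entry₂ tX vP vJ) (.entry₂ tC vI vJ))))) with hL
        have hacc : L.run m₃ tAcc 0 0 = ∑ j ∈ Ico 0 d, (m tX p j - m tC i j) ^ 2 := by
          refine (rep_sum (m := m₃) (fun j => (m tX p j - m tC i j) ^ 2)
            ((congrFun (congrFun (g 0 rfl) 0) 1).trans hd) hd0 (by decide) ?_).trans
            (by rw [gA, zero_add])
          intro j m₄ _ _ hf₄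
          have h1 := hf₄ tX rfl
          have h2 := hf₄ vP rfl
          have h3 := hf₄ vI rfl
          have h4 := hf₄ tC rfl
          simp [run, Expr.eval, Mem.write, h1, h2, h3, h4, g tX rfl, g tC rfl, gP, gI, sq]
        have hP : L.run m₃ vP 0 0 = p := by rw [run_table _ rfl, gP]
        have hI : L.run m₃ vI 0 0 = i := by rw [run_table _ rfl, gI]
        have hM : L.run m₃ tM = m tM := by rw [run_table _ rfl, g tM rfl]
        change (FProg.set tW (.scalar vP) (.scalar vI) (.mul (.entry tM vI) (.scalar tAcc))).run
          (L.run m₃) tW p i = _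
        simp [run, Expr.eval, Mem.write, hP, hI, hM, hacc]
      · intro i i' m₂ _ hi _ hf₂ h
        rw [← h]
        set m₃ := (put tAcc (.const 0)).run (m₂.write vI 0 0 i) with hm₃
        set L := FProg.rep vJ 1 (put tAcc (.add (.scalar tAcc)
          (.sq (.sub (.entry₂ tX vP vJ) (.entry₂ tC vI vJ))))) with hL
        have hI : L.run m₃ vI 0 0 = i := by
          rw [run_table _ rfl, hm₃, run_table _ rfl, Mem.write_apply]; simp
        have hW : L.run m₃ tW = m₂ tW := by
          rw [run_table _ rfl, hm₃, run_table _ rfl, Mem.write_table (by decide)]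
        change (FProg.set tW (.scalar vP) (.scalar vI) (.mul (.entry tM vI) (.scalar tAcc))).run
          (L.run m₃) tW p i' = _
        simp [run, Expr.eval, Mem.write, hI, hW, hi.ne']
    · intro p p' m₁ _ hp _ hf₁ h i hi0 hi1
      rw [← h i hi0 hi1]
      have f0 : (m₁.write vP 0 0 p) 0 = m 0 := by
        rw [Mem.write_table (by decide), hf₁ 0 rfl]
      refine (rep_entry ((congrFun (congrFun f0 0) 2).trans hk) hk0 (by decide) ?_).trans
        (by rw [Mem.write_table (by decide)])
      intro i' m₂ _ _ hf₂
      set m₃ := (put tAcc (.const 0)).run (m₂.write vI 0 0 i') with hm₃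
      set L := FProg.rep vJ 1 (put tAcc (.add (.scalar tAcc)
        (.sq (.sub (.entry₂ tX vP vJ) (.entry₂ tC vI vJ))))) with hL
      have hP : L.run m₃ vP 0 0 = p := by
        rw [run_table _ rfl, hm₃, run_table _ rfl, Mem.write_table (by decide), hf₂ vP rfl,
          Mem.write_apply]; simp
      have hW : L.run m₃ tW = m₂ tW := by
        rw [run_table _ rfl, hm₃, run_table _ rfl, Mem.write_table (by decide)]
      change (FProg.set tW (.scalar vP) (.scalar vI) (.mul (.entry tM vI) (.scalar tAcc))).run
        (L.run m₃) tW p' i = _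
      simp [run, Expr.eval, Mem.write, hP, hW, hp.ne']
  · rw [hrun]
    have g0 : L₁.run m 0 = m 0 := run_table _ rfl _
    have gC : L₁.run m vC = m vC := run_table _ rfl _
    have gB : L₁.run m vB = m vB := run_table _ rfl _
    have gM : L₁.run m tM = m tM := run_table _ rfl _
    refine rep_forall (m := L₁.run m) (fun i m' => m' tU i 0 =
      (m vC 0 0 + 1) * m tM i 0 / (m vC 0 0 + 1 - m vB 0 0))
      ((congrFun (congrFun g0 0) 2).trans hk) hk0 ?_ ?_
    · intro i m' _ _ hf
      have h1 := hf vC rfl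
      have h2 := hf vB rfl
      have h3 := hf tM rfl
      simp [run, Expr.eval, Mem.write, h1, h2, h3, gC, gB, gM]
    · intro i i' m' _ hi _ _ h
      simp [run, Expr.eval, Mem.write, h, hi.ne']

end FProg

end LogRAM

namespace LogRAM

/-! ### Correctness of the computation of the centers -/

/-- The points `r < n` with label `i` between `p` and `q` in the order by the values `Y`. -/
noncomputable def keySegment (n : ℤ) (lab Y : ℤ → ℤ) (i p q : ℤ) : Finset ℤ :=
  (Ico 0 n).filter fun r => lab r = i ∧ n * Y p + p ≤ n * Y r + r ∧ n * Y r + r ≤ n * Y q + q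

/-- The rounded mean of a segment. -/
noncomputable def segmentMean (n : ℤ) (lab Y : ℤ → ℤ) (i p q : ℤ) : ℤ :=
  (∑ r ∈ keySegment n lab Y i p q, Y r) / (keySegment n lab Y i p q).card

/-- The sum of the squared distances to the mean of a segment. -/
noncomputable def segmentError (n : ℤ) (lab Y : ℤ → ℤ) (i p q : ℤ) : ℤ :=
  ∑ r ∈ keySegment n lab Y i p q, (Y r - segmentMean n lab Y i p q) ^ 2

/-- The segment is nonempty and has at least `(1 - b/c) * M` points. -/
def SegmentLarge (n : ℤ) (lab Y : ℤ → ℤ) (b c M i p q : ℤ) : Prop :=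
  0 < ((keySegment n lab Y i p q).card : ℤ) ∧ (c - b) * M ≤ c * (keySegment n lab Y i p q).card

namespace FProg

theorem run_guard_pos {e : Expr} {c : FProg} {m : Mem} (h : 0 < e.eval m) :
    (guard e c).run m = c.run m := by
  simp [run, h]

theorem run_guard_neg {e : Expr} {c : FProg} {m : Mem} (h : ¬ 0 < e.eval m) :
    (guard e c).run m = m := by
  rw [run, decide_eq_false h]; rfl

/-- One rule for the three accumulations over a segment: its size, its sum and its squared error. -/
theorem run_forBetween {n i j p q : ℤ} {m : Mem} {c : FProg} {a : ℕ} {s t : ℤ} (f : ℤ → ℤ)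
    (hn : m 0 0 0 = n) (hn0 : 0 ≤ n) (hI : m vI 0 0 = i) (hJ : m vJ 0 0 = j) (hP : m vP 0 0 = p)
    (hQ : m vQ 0 0 = q)
    (hc : ∀ b ∈ [0, 3, tX, vI, vJ, vP, vQ], c.writes b = false) (ha : a ≠ vR)
    (step : ∀ m' r, m' vR 0 0 = r → Frame (forBetween c) m m' →
      c.run m' a s t = m' a s t + f r) :
    (forBetween c).run m a s t =
      m a s t + ∑ r ∈ keySegment n (col m 3) (fun r => m tX r j) i p q, f r := by
  rw [keySegment, sum_filter]
  refine rep_sum _ hn hn0 ha ?_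
  intro r m' _ _ hf
  have hf' : Frame (forBetween c) m (m'.write vR 0 0 r) := fun b hb => by
    have hb' := hb
    simp only [writes, Bool.or_eq_false_iff, beq_eq_false_iff_ne] at hb
    rw [Mem.write_table hb.1.symm, hf b hb']
  have hR : (m'.write vR 0 0 r) vR 0 0 = r := by rw [Mem.write_apply]; simp
  have hv : (m'.write vR 0 0 r) a s t = m' a s t := by rw [Mem.write_table ha]
  rw [← hv]
  set m₁ := m'.write vR 0 0 r
  have hw : ∀ b, b ≠ vR → b ∈ [0, 3, tX, vI, vJ, vP, vQ] → m₁ b = m b := fun b h1 h2 =>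
    hf' b (by simp [writes, hc b h2, h1.symm])
  have f0 := hw 0 (by decide) (by decide)
  have f3 := hw 3 (by decide) (by decide)
  have fX := hw tX (by decide) (by decide)
  have fI := hw vI (by decide) (by decide)
  have fJ := hw vJ (by decide) (by decide)
  have fP := hw vP (by decide) (by decide)
  have fQ := hw vQ (by decide) (by decide)
  have e1 : 0 < (Expr.eq (.entry 3 vR) (.scalar vI)).eval m₁ ↔ m 3 r 0 = i := by
    simp [Expr.eval, f3, fI, hR, hI, mul_self_sub_lt_one]
  have e2 : 0 < (Expr.le (.key vP) (.key vR)).eval m₁ ↔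
      n * m tX p j + p ≤ n * m tX r j + r := by
    simp only [Expr.eval, Nat.cast_zero, f0, fX, fP, fJ, hR, hP, hJ, hn]
    constructor <;> intro h <;> linarith
  have e3 : 0 < (Expr.le (.key vR) (.key vQ)).eval m₁ ↔
      n * m tX r j + r ≤ n * m tX q j + q := by
    simp only [Expr.eval, Nat.cast_zero, f0, fX, fQ, fJ, hR, hQ, hJ, hn]
    constructor <;> intro h <;> linarith
  by_cases h1 : m 3 r 0 = i
  · rw [run_guard_pos (e1.2 h1)]
    by_cases h2 : n * m tX p j + p ≤ n * m tX r j + r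
    · rw [run_guard_pos (e2.2 h2)]
      by_cases h3 : n * m tX r j + r ≤ n * m tX q j + q
      · rw [run_guard_pos (e3.2 h3), if_pos ⟨h1, h2, h3⟩]
        exact step m₁ r hR hf'
      · rw [run_guard_neg (h3 ∘ e3.1), if_neg fun h => h3 h.2.2, add_zero]
    · rw [run_guard_neg (h2 ∘ e2.1), if_neg fun h => h2 h.2.1, add_zero]
  · rw [run_guard_neg (h1 ∘ e1.1), if_neg fun h => h1 h.1, add_zero]

/-- The offer of a candidate interval to the minimum. -/
abbrev offerInterval : FProg :=
  offer (.scalar tAcc) (.set tC (.scalar vI) (.scalar vJ) (.scalar tCen))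

theorem run_intervalProg {n i j p q : ℤ} {m : Mem} (hn : m 0 0 0 = n) (hn0 : 0 ≤ n)
    (hI : m vI 0 0 = i) (hJ : m vJ 0 0 = j) (hP : m vP 0 0 = p) (hQ : m vQ 0 0 = q) :
    (¬ SegmentLarge n (col m 3) (fun r => m tX r j) (m vB 0 0) (m vC 0 0 + 1) (m tM i 0) i p q ∧
      ∀ b ∈ [tHas, tBest, tC], intervalProg.run m b = m b) ∨
    (SegmentLarge n (col m 3) (fun r => m tX r j) (m vB 0 0) (m vC 0 0 + 1) (m tM i 0) i p q ∧
      ∃ m', intervalProg.run m = offerInterval.run m' ∧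
        (∀ b ∈ [tHas, tBest, tC, vI, vJ], m' b = m b) ∧
        m' tAcc 0 0 = segmentError n (col m 3) (fun r => m tX r j) i p q ∧
        m' tCen 0 0 = segmentMean n (col m 3) (fun r => m tX r j) i p q) := by
  set Y := fun r => m tX r j with hY
  set m₁ := (put tCnt (.const 0) ;; put tSum (.const 0)).run m with hm₁
  set F := forBetween (put tCnt (.add (.scalar tCnt) (.const 1)) ;;
    put tSum (.add (.scalar tSum) (.entry₂ tX vR vJ))) with hF
  set m₂ := F.run m₁ with hm₂
  have g1 : ∀ a, a ≠ tCnt → a ≠ tSum → m₁ a = m a := fun a h1 h2 => by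
    exact run_table _ (by simp [writes, h1.symm, h2.symm]) m
  have g2 : ∀ a, a ≠ vR → a ≠ tCnt → a ≠ tSum → m₂ a = m a := fun a h0 h1 h2 => by
    exact (run_table F (by simp [hF, writes, h0.symm, h1.symm, h2.symm]) m₁).trans (g1 a h1 h2)
  have b0 : m₁ 0 0 0 = n := by rw [g1 0 (by decide) (by decide), hn]
  have bI : m₁ vI 0 0 = i := by rw [g1 vI (by decide) (by decide), hI]
  have bJ : m₁ vJ 0 0 = j := by rw [g1 vJ (by decide) (by decide), hJ]
  have bP : m₁ vP 0 0 = p := by rw [g1 vP (by decide) (by decide), hP]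
  have bQ : m₁ vQ 0 0 = q := by rw [g1 vQ (by decide) (by decide), hQ]
  have bX := g1 tX (by decide) (by decide)
  have b3 := g1 3 (by decide) (by decide)
  have hcnt : m₂ tCnt 0 0 = (keySegment n (col m 3) Y i p q).card := by
    have := run_forBetween (a := tCnt) (s := 0) (t := 0) (fun _ => 1) b0 hn0 bI bJ bP bQ
      (c := put tCnt (.add (.scalar tCnt) (.const 1)) ;;
        put tSum (.add (.scalar tSum) (.entry₂ tX vR vJ))) (by decide) (by decide)
      fun m' r _ _ => by simp [run, Expr.eval, Mem.write]
    rw [hm₂, hF, this, bX, col_congr b3]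
    simp [hm₁, run, Expr.eval, Mem.write, hY]
  have hsum : m₂ tSum 0 0 = ∑ r ∈ keySegment n (col m 3) Y i p q, Y r := by
    have := run_forBetween (a := tSum) (s := 0) (t := 0) Y b0 hn0 bI bJ bP bQ
      (c := put tCnt (.add (.scalar tCnt) (.const 1)) ;;
        put tSum (.add (.scalar tSum) (.entry₂ tX vR vJ))) (by decide) (by decide)
      fun m' r hr hf => by
        have h1 := hf tX rfl
        have h2 := hf vJ rfl
        simp [run, Expr.eval, Mem.write, h1, h2, bX, bJ, hr, hY]
    rw [hm₂, hF, this, bX, col_congr b3]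
    simp [hm₁, run, Expr.eval, Mem.write, hY]
  have c0 : m₂ 0 0 0 = n := by rw [g2 0 (by decide) (by decide) (by decide), hn]
  have cI : m₂ vI 0 0 = i := by rw [g2 vI (by decide) (by decide) (by decide), hI]
  have cJ : m₂ vJ 0 0 = j := by rw [g2 vJ (by decide) (by decide) (by decide), hJ]
  have cP : m₂ vP 0 0 = p := by rw [g2 vP (by decide) (by decide) (by decide), hP]
  have cQ : m₂ vQ 0 0 = q := by rw [g2 vQ (by decide) (by decide) (by decide), hQ]
  have cX := g2 tX (by decide) (by decide) (by decide)
  have c3 := g2 3 (by decide) (by decide) (by decide)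
  have cM := g2 tM (by decide) (by decide) (by decide)
  have cB := g2 vB (by decide) (by decide) (by decide)
  have cC := g2 vC (by decide) (by decide) (by decide)
  set eL := Expr.le (.mul (.sub (.add (.scalar vC) (.const 1)) (.scalar vB)) (.entry tM vI))
    (.mul (.add (.scalar vC) (.const 1)) (.scalar tCnt)) with heL
  set G := put tCen (.div (.scalar tSum) (.scalar tCnt)) ;; put tAcc (.const 0) with hG
  set F' := forBetween (put tAcc (.add (.scalar tAcc)
    (.sq (.sub (.entry₂ tX vR vJ) (.scalar tCen))))) with hF'
  have hrun : intervalProg.run m =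
      (guard (.scalar tCnt) (guard eL (put tCen (.div (.scalar tSum) (.scalar tCnt)) ;;
        put tAcc (.const 0) ;; F' ;; offerInterval))).run m₂ := rfl
  have e1 : 0 < (Expr.scalar tCnt).eval m₂ ↔ 0 < ((keySegment n (col m 3) Y i p q).card : ℤ) := by
    rw [← hcnt]; rfl
  have e2 : 0 < eL.eval m₂ ↔ (m vC 0 0 + 1 - m vB 0 0) * m tM i 0 ≤
      (m vC 0 0 + 1) * (keySegment n (col m 3) Y i p q).card := by
    simp only [heL, Expr.eval, cC, cB, cM, cI, hcnt]
    constructor <;> intro h <;> linarith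
  have hskip : ∀ b ∈ [tHas, tBest, tC], m₂ b = m b := fun b hb => by
    simp only [List.mem_cons, List.not_mem_nil, or_false] at hb
    exact g2 b (by omega) (by omega) (by omega)
  by_cases h1 : 0 < ((keySegment n (col m 3) Y i p q).card : ℤ)
  swap
  · exact Or.inl ⟨fun h => h1 h.1, by rwa [hrun, run_guard_neg (h1 ∘ e1.1)]⟩
  rw [hrun, run_guard_pos (e1.2 h1)]
  by_cases h2 : (m vC 0 0 + 1 - m vB 0 0) * m tM i 0 ≤
      (m vC 0 0 + 1) * (keySegment n (col m 3) Y i p q).card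
  swap
  · exact Or.inl ⟨fun h => h2 h.2, by rwa [run_guard_neg (h2 ∘ e2.1)]⟩
  rw [run_guard_pos (e2.2 h2)]
  refine Or.inr ⟨⟨h1, h2⟩, F'.run (G.run m₂), rfl, ?_, ?_, ?_⟩
  · intro b hb
    simp only [List.mem_cons, List.not_mem_nil, or_false] at hb
    rw [run_table F' (by rcases hb with rfl | rfl | rfl | rfl | rfl <;> rfl),
      run_table G (by rcases hb with rfl | rfl | rfl | rfl | rfl <;> rfl),
      g2 b (by omega) (by omega) (by omega)]
  · have d : ∀ a, G.writes a = false → G.run m₂ a = m₂ a := fun a h => run_table _ h _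
    have dC : G.run m₂ tCen 0 0 = segmentMean n (col m 3) Y i p q := by
      simp [hG, run, Expr.eval, Mem.write, hcnt, hsum, segmentMean]
    have := run_forBetween (m := G.run m₂) (n := n) (i := i) (j := j) (p := p) (q := q)
      (a := tAcc) (s := 0) (t := 0)
      (fun r => (Y r - segmentMean n (col m 3) Y i p q) ^ 2) (by rw [d 0 rfl, c0]) hn0
      (by rw [d vI rfl, cI]) (by rw [d vJ rfl, cJ]) (by rw [d vP rfl, cP]) (by rw [d vQ rfl, cQ])
      (c := put tAcc (.add (.scalar tAcc) (.sq (.sub (.entry₂ tX vR vJ) (.scalar tCen)))))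
      (by decide) (by decide)
      fun m' r hr hf => by
        have h1 := hf tX rfl
        have h2 := hf vJ rfl
        have h3 := hf tCen rfl
        simp [run, Expr.eval, Mem.write, h1, h2, h3, d tX rfl, d vJ rfl, cX, cJ, dC, hr, hY, sq]
    rw [hF', this, d tX rfl, cX, col_congr (d 3 rfl), col_congr c3]
    simp [hG, run, Expr.eval, Mem.write, hY, segmentError]
  · rw [run_table F' rfl]
    simp [hG, run, Expr.eval, Mem.write, hcnt, hsum, segmentMean]

/-- The search for the best interval. -/
abbrev searchProg : FProg := .rep vP 0 (.rep vQ 0 intervalProg)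

/-- Centers found for other clusters and coordinates must survive the later searches. -/
theorem run_offerInterval_tC {m : Mem} {r s : ℤ} (h : ¬ (r = m vI 0 0 ∧ s = m vJ 0 0)) :
    offerInterval.run m tC r s = m tC r s := by
  by_cases hlt : m tHas 0 0 ≤ 0 ∨ (Expr.scalar tAcc).eval m < m tBest 0 0
  · obtain ⟨m', h1, -, -, h2⟩ := run_offer (save := .set tC (.scalar vI) (.scalar vJ) (.scalar tCen))
      hlt
    rw [h1]
    have hI := h2 vI (by decide) (by decide) (by decide)
    have hJ := h2 vJ (by decide) (by decide) (by decide)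
    have hC := h2 tC (by decide) (by decide) (by decide)
    simp only [run, Expr.eval, Mem.write_apply, hI, hJ, hC, if_neg h]
  · rw [not_or, not_le, not_lt] at hlt
    rw [run_offer_of_le hlt.1 hlt.2, Mem.write_table (by decide)]

theorem run_intervalProg_tC {n i j r s : ℤ} {m : Mem} (hn : m 0 0 0 = n) (hn0 : 0 ≤ n)
    (hI : m vI 0 0 = i) (hJ : m vJ 0 0 = j) (h : ¬ (r = i ∧ s = j)) :
    intervalProg.run m tC r s = m tC r s := by
  rcases run_intervalProg hn hn0 hI hJ rfl rfl with ⟨-, h1⟩ | ⟨-, m', h1, h2, -, -⟩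
  · rw [h1 tC (by decide)]
  · rw [h1, run_offerInterval_tC (by rwa [h2 vI (by decide), h2 vJ (by decide), hI, hJ]),
      h2 tC (by decide)]

theorem run_searchProg_tC {n i j r s : ℤ} {m : Mem} (hn : m 0 0 0 = n) (hn0 : 0 ≤ n)
    (hI : m vI 0 0 = i) (hJ : m vJ 0 0 = j) (h : ¬ (r = i ∧ s = j)) :
    searchProg.run m tC r s = m tC r s := by
  refine rep_entry hn hn0 (by decide) fun p m₁ _ _ hf₁ => ?_
  have f : ∀ b, searchProg.writes b = false → (m₁.write vP 0 0 p) b = m b := fun b hb => by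
    have hb' := hb
    simp only [writes, Bool.or_eq_false_iff, beq_eq_false_iff_ne] at hb
    rw [Mem.write_table hb.1.symm, hf₁ b hb']
  refine (rep_entry ((congrFun (congrFun (f 0 rfl) 0) 0).trans hn) hn0 (by decide)
    fun q m₂ _ _ hf₂ => ?_).trans (by rw [Mem.write_table (by decide)])
  refine (run_intervalProg_tC (n := n) (i := i) (j := j) ?_ hn0 ?_ ?_ h).trans
    (by rw [Mem.write_table (by decide)])
  · rw [Mem.write_table (by decide), hf₂ 0 rfl, f 0 rfl, hn]
  · rw [Mem.write_table (by decide), hf₂ vI rfl, f vI rfl, hI]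
  · rw [Mem.write_table (by decide), hf₂ vJ rfl, f vJ rfl, hJ]

theorem run_searchProg {n i j : ℤ} {m : Mem} (hn : m 0 0 0 = n) (hn0 : 0 ≤ n)
    (hI : m vI 0 0 = i) (hJ : m vJ 0 0 = j) (hhas : m tHas 0 0 = 0) :
    HasMin (segmentError n (col m 3) (fun r => m tX r j) i)
      (fun m' p q => m' tC i j = segmentMean n (col m 3) (fun r => m tX r j) i p q)
      (fun p q => (0 ≤ p ∧ p < n) ∧ (0 ≤ q ∧ q < n) ∧
        SegmentLarge n (col m 3) (fun r => m tX r j) (m vB 0 0) (m vC 0 0 + 1) (m tM i 0) i p q)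
      (searchProg.run m) := by
  refine rep_rep_min _ _ _ hn hn0 hn hn0 rfl (by decide) rfl (by decide) (fun m' r p q h => ?_) hhas
    fun p q m' _ _ _ _ hP hQ hf => ?_
  · rw [Mem.write_table (by decide), Mem.write_table (by decide)]
    exact ⟨h, h⟩
  · have f0 : m' 0 0 0 = n := by rw [hf 0 rfl, hn]
    have fI : m' vI 0 0 = i := by rw [hf vI rfl, hI]
    have fJ : m' vJ 0 0 = j := by rw [hf vJ rfl, hJ]
    have key := run_intervalProg f0 hn0 fI fJ hP hQ
    rw [col_congr (hf 3 rfl), hf tX rfl, hf vB rfl, hf vC rfl, hf tM rfl] at key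
    rcases key with ⟨h1, h2⟩ | ⟨h1, m'', h2, h3, h4, h5⟩
    · refine Or.inr ⟨fun h => absurd h h1, ?_, fun _ => ?_, fun p' q' h => ?_⟩
      · rw [h2 tHas (by decide)]
      · rw [h2 tBest (by decide)]
      · rw [h2 tC (by decide), h]
    · rw [h2]
      have hT : m'' tHas 0 0 = m' tHas 0 0 := by rw [h3 tHas (by decide)]
      have hB : m'' tBest 0 0 = m' tBest 0 0 := by rw [h3 tBest (by decide)]
      by_cases hlt : m' tHas 0 0 ≤ 0 ∨
        segmentError n (col m 3) (fun r => m tX r j) i p q < m' tBest 0 0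
      · obtain ⟨m₃, e1, e2, e3, e4⟩ := run_offer (e := .scalar tAcc) (m := m'')
          (save := .set tC (.scalar vI) (.scalar vJ) (.scalar tCen)) (by
            rw [hT, hB]
            exact hlt.imp_right fun h => by simpa only [Expr.eval, h4] using h)
        refine Or.inl ⟨h1, hlt, ?_, ?_, ?_⟩
        · rw [e1, run, Mem.write_table (by decide), e2]
        · rw [e1, run, Mem.write_table (by decide), e3]; exact h4
        · have gI := e4 vI (by decide) (by decide) (by decide)
          have gJ := e4 vJ (by decide) (by decide) (by decide)
          have gC := e4 tCen (by decide) (by decide) (by decide)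
          have kI := h3 vI (by decide)
          have kJ := h3 vJ (by decide)
          rw [e1]
          simp [run, Expr.eval, Mem.write_apply, gI, gJ, gC, kI, kJ, fI, fJ, h5]
      · rw [not_or, not_le, not_lt] at hlt
        rw [run_offer_of_le (by rw [hT]; exact hlt.1) (by rw [hB]; exact hlt.2.trans_eq h4.symm)]
        refine Or.inr ⟨fun _ => hlt, ?_, fun _ => ?_, fun p' q' h => ?_⟩
        · rw [Mem.write_table (by decide), hT]
        · rw [Mem.write_table (by decide), hB]
        · rw [Mem.write_table (by decide), h3 tC (by decide), h]

/-- The alternative without any large segment is needed for empty label classes;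
`isCenter_of_segment` rules it out for the others. -/
theorem run_centerProg {n d k : ℤ} {m : Mem} (hn : m 0 0 0 = n) (hn0 : 0 ≤ n) (hd : m 0 0 1 = d)
    (hd0 : 0 ≤ d) (hk : m 0 0 2 = k) (hk0 : 0 ≤ k) :
    ∀ i, 0 ≤ i → i < k → ∀ j, 0 ≤ j → j < d →
      (∀ p q, ¬ ((0 ≤ p ∧ p < n) ∧ (0 ≤ q ∧ q < n) ∧ SegmentLarge n (col m 3)
        (fun r => m tX r j) (m vB 0 0) (m vC 0 0 + 1) (m tM i 0) i p q)) ∨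
      ∃ p q, SegmentLarge n (col m 3) (fun r => m tX r j) (m vB 0 0) (m vC 0 0 + 1) (m tM i 0) i
          p q ∧
        centerProg.run m tC i j = segmentMean n (col m 3) (fun r => m tX r j) i p q ∧
        ∀ p₀ q₀, (0 ≤ p₀ ∧ p₀ < n) ∧ (0 ≤ q₀ ∧ q₀ < n) ∧ SegmentLarge n (col m 3)
          (fun r => m tX r j) (m vB 0 0) (m vC 0 0 + 1) (m tM i 0) i p₀ q₀ →
        segmentError n (col m 3) (fun r => m tX r j) i p q ≤
          segmentError n (col m 3) (fun r => m tX r j) i p₀ q₀ := by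
  refine rep_forall (fun i m' => ∀ j, 0 ≤ j → j < d →
      (∀ p q, ¬ ((0 ≤ p ∧ p < n) ∧ (0 ≤ q ∧ q < n) ∧ SegmentLarge n (col m 3)
        (fun r => m tX r j) (m vB 0 0) (m vC 0 0 + 1) (m tM i 0) i p q)) ∨
      ∃ p q, SegmentLarge n (col m 3) (fun r => m tX r j) (m vB 0 0) (m vC 0 0 + 1) (m tM i 0) i
          p q ∧
        m' tC i j = segmentMean n (col m 3) (fun r => m tX r j) i p q ∧
        ∀ p₀ q₀, (0 ≤ p₀ ∧ p₀ < n) ∧ (0 ≤ q₀ ∧ q₀ < n) ∧ SegmentLarge n (col m 3)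
          (fun r => m tX r j) (m vB 0 0) (m vC 0 0 + 1) (m tM i 0) i p₀ q₀ →
        segmentError n (col m 3) (fun r => m tX r j) i p q ≤
          segmentError n (col m 3) (fun r => m tX r j) i p₀ q₀) hk hk0 ?_ ?_
  · intro i m₁ _ _ hf₁
    have f : ∀ b, centerProg.writes b = false → (m₁.write vI 0 0 i) b = m b := fun b hb => by
      have hb' := hb
      simp only [centerProg, writes, Bool.or_eq_false_iff, beq_eq_false_iff_ne] at hb
      rw [Mem.write_table hb.1.symm, hf₁ b hb']
    refine rep_forall (fun j m' =>
      (∀ p q, ¬ ((0 ≤ p ∧ p < n) ∧ (0 ≤ q ∧ q < n) ∧ SegmentLarge n (col m 3)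
        (fun r => m tX r j) (m vB 0 0) (m vC 0 0 + 1) (m tM i 0) i p q)) ∨
      ∃ p q, SegmentLarge n (col m 3) (fun r => m tX r j) (m vB 0 0) (m vC 0 0 + 1) (m tM i 0) i
          p q ∧
        m' tC i j = segmentMean n (col m 3) (fun r => m tX r j) i p q ∧
        ∀ p₀ q₀, (0 ≤ p₀ ∧ p₀ < n) ∧ (0 ≤ q₀ ∧ q₀ < n) ∧ SegmentLarge n (col m 3)
          (fun r => m tX r j) (m vB 0 0) (m vC 0 0 + 1) (m tM i 0) i p₀ q₀ →
        segmentError n (col m 3) (fun r => m tX r j) i p q ≤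
          segmentError n (col m 3) (fun r => m tX r j) i p₀ q₀)
      ((congrFun (congrFun (f 0 rfl) 0) 1).trans hd) hd0 ?_ ?_
    · intro j m₂ _ _ hf₂
      set m₃ := (put tHas (.const 0)).run (m₂.write vJ 0 0 j) with hm₃
      have g : ∀ b, centerProg.writes b = false → m₃ b = m b := fun b hb => by
        have hb' := hb
        simp only [centerProg, writes, Bool.or_eq_false_iff, beq_eq_false_iff_ne] at hb
        rw [hm₃, run_table _ (by simp [writes, hb]), Mem.write_table hb.2.1.symm,
          hf₂ b (by simp [writes, hb]), f b hb']
      have gI : m₃ vI 0 0 = i := by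
        rw [hm₃, run_table _ rfl, Mem.write_table (by decide), hf₂ vI rfl, Mem.write_apply]; simp
      have gJ : m₃ vJ 0 0 = j := by rw [hm₃, run_table _ rfl, Mem.write_apply]; simp
      have key := run_searchProg (m := m₃) (n := n) (by rw [g 0 rfl, hn]) hn0 gI gJ
        (by simp [hm₃, run, Expr.eval, Mem.write])
      rw [col_congr (g 3 rfl), g tX rfl, g vB rfl, g vC rfl, g tM rfl] at key
      change _ ∨ ∃ p q, _ ∧ searchProg.run m₃ tC i j = _ ∧ _
      rcases key with ⟨-, h⟩ | ⟨-, ⟨p, q, h1, h2, h3⟩, h4⟩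
      · exact Or.inl h
      · exact Or.inr ⟨p, q, h1.2.2, h3, fun p₀ q₀ h => h2.symm.trans_le (h4 p₀ q₀ h)⟩
    · intro j j' m₂ _ hj _ hf₂ h
      set m₃ := (put tHas (.const 0)).run (m₂.write vJ 0 0 j) with hm₃
      have : searchProg.run m₃ tC i j' = m₂ tC i j' := by
        refine (run_searchProg_tC (n := n) (i := i) (j := j) ?_ hn0 ?_ ?_ fun h => ?_).trans ?_
        · rw [hm₃, run_table _ rfl, Mem.write_table (by decide), hf₂ 0 rfl, f 0 rfl, hn]
        · rw [hm₃, run_table _ rfl, Mem.write_table (by decide), hf₂ vI rfl, Mem.write_apply]; simp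
        · rw [hm₃, run_table _ rfl, Mem.write_apply]; simp
        · exact hj.ne' h.2
        · rw [hm₃, run_table _ rfl, Mem.write_table (by decide)]
      change _ ∨ ∃ p q, _ ∧ searchProg.run m₃ tC i j' = _ ∧ _
      rwa [this]
  · intro i i' m₁ _ hi _ hf₁ h j hj0 hj1
    have f0 : (m₁.write vI 0 0 i) 0 = m 0 := by
      rw [Mem.write_table (by decide), hf₁ 0 rfl]
    have : (FProg.rep vJ 1 (put tHas (.const 0) ;; searchProg)).run (m₁.write vI 0 0 i) tC i' j =
        m₁ tC i' j := by
      refine (rep_entry ((congrFun (congrFun f0 0) 1).trans hd) hd0 (by decide) ?_).trans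
        (by rw [Mem.write_table (by decide)])
      intro j' m₂ _ _ hf₂
      set m₃ := (put tHas (.const 0)).run (m₂.write vJ 0 0 j') with hm₃
      change searchProg.run m₃ tC i' j = _
      refine (run_searchProg_tC (n := n) (i := i) (j := j') ?_ hn0 ?_ ?_ fun h => ?_).trans ?_
      · rw [hm₃, run_table _ rfl, Mem.write_table (by decide), hf₂ 0 rfl, f0, hn]
      · rw [hm₃, run_table _ rfl, Mem.write_table (by decide), hf₂ vI rfl, Mem.write_apply]; simp
      · rw [hm₃, run_table _ rfl, Mem.write_apply]; simp
      · exact hi.ne' h.1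
      · rw [hm₃, run_table _ rfl, Mem.write_table (by decide)]
    rw [this]
    exact h j hj0 hj1

end FProg

end LogRAM

/-! ### Correctness of the algorithm -/

namespace MinSum

open LogRAM LogRAM.FProg

variable {n d k : ℕ}

theorem table_apply (f : Fin n → Fin d → ℤ) (p : Fin n) (j : Fin d) :
    table f (p : ℕ) (j : ℕ) = f p j := by
  simp [table]

theorem countEq_eq_card {lab : ℤ → ℤ} {Q : Fin n → Fin k} (h : ∀ p : Fin n, lab (p : ℕ) = (Q p : ℕ))
    (i : Fin k) : countEq n lab (i : ℕ) = (cluster Q i).card := by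
  rw [countEq, sum_Ico_fin, cluster, card_filter, Nat.cast_sum]
  refine sum_congr rfl fun p _ => ?_
  rw [h]
  simp [Fin.ext_iff]

theorem natCast_factorial (n : ℕ) : ∏ p ∈ Ico (0 : ℤ) n, (p + 1) = n.factorial := by
  induction n with
  | zero => simp
  | succ n ih =>
    have : Ico (0 : ℤ) (n + 1 : ℕ) = insert (n : ℤ) (Ico (0 : ℤ) n) := by
      ext z; simp only [mem_insert, mem_Ico]; omega
    rw [this, prod_insert (by simp), ih, Nat.factorial_succ]
    push_cast; ring

/-- The segment as a set of points. -/
noncomputable def segmentFin (n : ℕ) (lab Y : ℤ → ℤ) (i p q : ℤ) : Finset (Fin n) :=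
  univ.filter fun r => ((r : ℕ) : ℤ) ∈ keySegment n lab Y i p q

theorem sum_segment (lab Y : ℤ → ℤ) (i p q : ℤ) (f : ℤ → ℤ) :
    ∑ r ∈ keySegment n lab Y i p q, f r = ∑ r ∈ segmentFin n lab Y i p q, f (r : ℕ) := by
  rw [segmentFin, sum_filter, ← sum_Ico_fin n fun r => if r ∈ keySegment n lab Y i p q then f r else 0,
    ← sum_filter]
  congr 1
  ext r
  simp [keySegment]

theorem card_segment (lab Y : ℤ → ℤ) (i p q : ℤ) :
    ((keySegment n lab Y i p q).card : ℤ) = (segmentFin n lab Y i p q).card := by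
  simpa using sum_segment lab Y i p q fun _ => 1

variable {X : Fin n → ℤ} {P : Fin n → Fin k} {lab Y : ℤ → ℤ}

theorem segmentFin_subset (hlab : ∀ p : Fin n, lab (p : ℕ) = (P p : ℕ)) (i : Fin k) (p q : ℤ) :
    segmentFin n lab Y (i : ℕ) p q ⊆ cluster P i := by
  intro r hr
  simp only [segmentFin, keySegment, mem_filter, mem_univ, true_and, hlab] at hr
  simpa [cluster, Fin.ext_iff] using hr.2.1

theorem segmentFin_eq_between (hlab : ∀ p : Fin n, lab (p : ℕ) = (P p : ℕ))
    (hY : ∀ p : Fin n, Y (p : ℕ) = X p) (i : Fin k) (p q : Fin n) :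
    segmentFin n lab Y (i : ℕ) (p : ℕ) (q : ℕ) = between (sortKey X) (cluster P i) p q := by
  ext r
  simp [segmentFin, keySegment, between, cluster, sortKey, hlab, hY, Fin.ext_iff]

/-- The rounded mean is the exact mean, because the size of the segment divides n!, hence every
coordinate. -/
theorem segmentMean_mul (hdvd : ∀ p, (n.factorial : ℤ) ∣ X p) (hY : ∀ p : Fin n, Y (p : ℕ) = X p)
    {i p q : ℤ} (h : (segmentFin n lab Y i p q).Nonempty) :
    segmentMean n lab Y i p q * (segmentFin n lab Y i p q).card =
      ∑ r ∈ segmentFin n lab Y i p q, X r := by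
  rw [segmentMean, sum_segment, card_segment]
  simp only [hY]
  refine Int.ediv_mul_cancel (dvd_sum fun r _ => dvd_trans ?_ (hdvd r))
  exact_mod_cast Nat.dvd_factorial h.card_pos
    ((card_le_univ _).trans_eq (Fintype.card_fin n))

theorem segmentError_eq (hY : ∀ p : Fin n, Y (p : ℕ) = X p) (i p q : ℤ) :
    segmentError n lab Y i p q =
      ∑ r ∈ segmentFin n lab Y i p q, (X r - segmentMean n lab Y i p q) ^ 2 := by
  rw [segmentError, sum_segment]
  simp only [hY]

/-- The whole class is the segment between its extreme points, so the search had a candidate. Every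
interval that competes in `IsCenter` has points as ends and was therefore examined, with the same
mean, as the mean is determined by the sum. -/
theorem isCenter_of_segment (hdvd : ∀ p, (n.factorial : ℤ) ∣ X p)
    (hlab : ∀ p : Fin n, lab (p : ℕ) = (P p : ℕ)) (hY : ∀ p : Fin n, Y (p : ℕ) = X p) {i : Fin k}
    (hne : (cluster P i).Nonempty) {b c M C : ℤ} (hb : 0 ≤ b) (hM : M = (cluster P i).card)
    (h : (∀ p q : ℤ, ¬ ((0 ≤ p ∧ p < n) ∧ (0 ≤ q ∧ q < n) ∧
        SegmentLarge n lab Y b c M (i : ℕ) p q)) ∨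
      ∃ p q : ℤ, SegmentLarge n lab Y b c M (i : ℕ) p q ∧ C = segmentMean n lab Y (i : ℕ) p q ∧
        ∀ p₀ q₀ : ℤ, (0 ≤ p₀ ∧ p₀ < n) ∧ (0 ≤ q₀ ∧ q₀ < n) ∧
            SegmentLarge n lab Y b c M (i : ℕ) p₀ q₀ →
          segmentError n lab Y (i : ℕ) p q ≤ segmentError n lab Y (i : ℕ) p₀ q₀) :
    IsCenter X (cluster P i) b c C := by
  obtain ⟨p₁, hp₁, hmin⟩ := exists_min_image (cluster P i) (sortKey X) hne
  obtain ⟨q₁, hq₁, hmax⟩ := exists_max_image (cluster P i) (sortKey X) hne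
  have hall : segmentFin n lab Y (i : ℕ) (p₁ : ℕ) (q₁ : ℕ) = cluster P i := by
    rw [segmentFin_eq_between hlab hY, between, filter_eq_self]
    exact fun r hr => ⟨hmin r hr, hmax r hr⟩
  have hlarge : ∀ p q : Fin n, (between (sortKey X) (cluster P i) p q).Nonempty →
      (c - b) * (cluster P i).card ≤ c * (between (sortKey X) (cluster P i) p q).card →
      SegmentLarge n lab Y b c M (i : ℕ) (p : ℕ) (q : ℕ) := fun p q h1 h2 => by
    rw [SegmentLarge, card_segment, segmentFin_eq_between hlab hY, hM]
    exact ⟨by exact_mod_cast h1.card_pos, h2⟩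
  have hfin : ∀ p : Fin n, 0 ≤ ((p : ℕ) : ℤ) ∧ ((p : ℕ) : ℤ) < n := fun p =>
    ⟨by positivity, by exact_mod_cast p.2⟩
  replace h := h.resolve_left fun h => h (p₁ : ℕ) (q₁ : ℕ) ⟨hfin p₁, hfin q₁, by
    rw [SegmentLarge, card_segment, hall, hM]
    have := hne.card_pos
    exact ⟨by exact_mod_cast this, mul_le_mul_of_nonneg_right (by omega) (by positivity)⟩⟩
  obtain ⟨p, q, ⟨h1, h2⟩, rfl, h3⟩ := h
  rw [card_segment] at h1 h2
  have hI : (segmentFin n lab Y (i : ℕ) p q).Nonempty := card_pos.1 (by exact_mod_cast h1)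
  refine ⟨segmentFin n lab Y (i : ℕ) p q, segmentFin_subset hlab i p q, hI, hM ▸ h2,
    segmentMean_mul hdvd hY hI, fun p' q' e hne' hl' he => ?_⟩
  have h4 := h3 (p' : ℕ) (q' : ℕ) ⟨hfin p', hfin q', hlarge p' q' hne' hl'⟩
  have h5 := segmentFin_eq_between hlab hY i p' q'
  have h6 : segmentMean n lab Y (i : ℕ) (p' : ℕ) (q' : ℕ) = e := by
    have := segmentMean_mul hdvd hY (h5 ▸ hne')
    rw [h5, ← he] at this
    have h0 := hne'.card_pos
    exact mul_right_cancel₀ (by exact_mod_cast h0.ne') this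
  rwa [segmentError_eq hY, segmentError_eq hY, h5, h6] at h4

end MinSum

/-! ### From memory tables to clusterings: one candidate, and the search over error rates -/

namespace MinSum

open LogRAM LogRAM.FProg

variable {n d k : ℕ} {X : Fin n → Fin d → ℤ} {P : Fin n → Fin k}

/-- The memory holds the integer points `X`, the labels `P` and the sizes of the label classes. -/
structure Loaded (X : Fin n → Fin d → ℤ) (P : Fin n → Fin k) (m : Mem) : Prop where
  n_eq : m 0 0 0 = n
  d_eq : m 0 0 1 = d
  k_eq : m 0 0 2 = k
  label : ∀ p : Fin n, m 3 (p : ℕ) 0 = (P p : ℕ)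
  point : ∀ (p : Fin n) (j : Fin d), m tX (p : ℕ) (j : ℕ) = X p j
  size : ∀ i : Fin k, m tM (i : ℕ) 0 = (cluster P i).card

theorem Loaded.congr {m m' : Mem} (h : Loaded X P m) (h' : ∀ b ∈ [0, 3, tX, tM], m' b = m b) :
    Loaded X P m' :=
  ⟨by rw [h' 0 (by decide), h.n_eq], by rw [h' 0 (by decide), h.d_eq],
    by rw [h' 0 (by decide), h.k_eq], fun p => by rw [h' 3 (by decide), h.label],
    fun p j => by rw [h' tX (by decide), h.point], fun i => by rw [h' tM (by decide), h.size]⟩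

/-- The memory holds the clustering `Q` in the table `a`. -/
def Holds (a : ℕ) (Q : Fin n → Fin k) (m : Mem) : Prop := ∀ p : Fin n, m a (p : ℕ) 0 = (Q p : ℕ)

theorem Loaded.run_costProg {m : Mem} (h : Loaded X P m) {Q : Fin n → Fin k} (hQ : Holds tQ Q m) :
    costProg.run m tCost 0 0 = intCost X Q := by
  rw [LogRAM.FProg.run_costProg h.n_eq (by positivity) h.d_eq (by positivity), sum_Ico_fin, intCost]
  refine sum_congr rfl fun p _ => ?_
  rw [sum_Ico_fin]
  refine sum_congr rfl fun q _ => ?_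
  rw [hQ, hQ, sum_Ico_fin]
  simp only [h.point, Nat.cast_inj, Fin.val_inj]

theorem Loaded.run_keepProg {m : Mem} (h : Loaded X P m) {Q : Fin n → Fin k} (hQ : Holds tQ Q m) :
    keepProg.run m tOpt 0 0 = m tCost 0 0 ∧ Holds tOut Q (keepProg.run m) := by
  obtain ⟨h1, h2⟩ := LogRAM.FProg.run_keepProg h.n_eq (by positivity)
  refine ⟨h1, fun p => ?_⟩
  rw [h2 _ (by positivity) (by exact_mod_cast p.2), hQ]

theorem Loaded.isCenter {m : Mem} (h : Loaded X P m) (hdvd : ∀ p j, (n.factorial : ℤ) ∣ X p j)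
    (hb : 0 ≤ m vB 0 0) (i : Fin k) (j : Fin d) (hne : (cluster P i).Nonempty) :
    IsCenter (fun p => X p j) (cluster P i) (m vB 0 0) (m vC 0 0 + 1)
      (centerProg.run m tC (i : ℕ) (j : ℕ)) :=
  isCenter_of_segment (fun p => hdvd p j) h.label (fun p => h.point p j) hne hb (h.size i)
    (run_centerProg h.n_eq (by positivity) h.d_eq (by positivity) h.k_eq (by positivity) (i : ℕ)
      (by positivity) (by exact_mod_cast i.2) (j : ℕ) (by positivity) (by exact_mod_cast j.2))

theorem exists_holds {a : ℕ} {m : Mem}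
    (h : ∀ p : ℤ, 0 ≤ p → p < n → 0 ≤ m a p 0 ∧ m a p 0 < k) : ∃ Q : Fin n → Fin k, Holds a Q m := by
  have h' : ∀ p : Fin n, 0 ≤ m a (p : ℕ) 0 ∧ m a (p : ℕ) 0 < k := fun p =>
    h _ (by positivity) (by exact_mod_cast p.2)
  refine ⟨fun p => ⟨(m a (p : ℕ) 0).toNat, by have := h' p; omega⟩, fun p => ?_⟩
  have := h' p
  simp only [Int.toNat_of_nonneg this.1]

/-- Transfers `run_assignProg` to points and clusters. The assignment problem is solvable because
each capacity is at least the size of its label class, and these sizes add up to n. -/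
theorem Loaded.exists_isAssignment {m : Mem} (h : Loaded X P m)
    (hdvd : ∀ p j, (n.factorial : ℤ) ∣ X p j) {b c : ℤ} (hB : m vB 0 0 = b) (hC : m vC 0 0 + 1 = c)
    (hb : 0 ≤ b) (hbc : 2 * b < c) :
    ∃ Q, IsAssignment X P b c Q ∧
      Holds tQ Q (assignProg.run (weightProg.run (centerProg.run m))) := by
  set m₁ := centerProg.run m with hm₁
  set m₂ := weightProg.run m₁ with hm₂
  have h₁ : Loaded X P m₁ := h.congr fun b hb => run_table _ (by
    simp only [List.mem_cons, List.not_mem_nil, or_false] at hb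
    rcases hb with rfl | rfl | rfl | rfl <;> rfl) _
  have h₂ : Loaded X P m₂ := h₁.congr fun b hb => run_table _ (by
    simp only [List.mem_cons, List.not_mem_nil, or_false] at hb
    rcases hb with rfl | rfl | rfl | rfl <;> rfl) _
  obtain ⟨hW, hU⟩ := run_weightProg h₁.n_eq (by positivity) h₁.d_eq (by positivity) h₁.k_eq
    (by positivity)
  have hW' : ∀ (p : Fin n) (i : Fin k), m₂ tW (p : ℕ) (i : ℕ) =
      (cluster P i).card * ∑ j : Fin d, (X p j - m₁ tC (i : ℕ) (j : ℕ)) ^ 2 := fun p i => by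
    rw [hm₂, hW _ (by positivity) (by exact_mod_cast p.2) _ (by positivity)
      (by exact_mod_cast i.2), h₁.size, sum_Ico_fin]
    simp only [h₁.point]
  have hU' : ∀ i : Fin k, m₂ tU (i : ℕ) 0 = c * (cluster P i).card / (c - b) := fun i => by
    rw [hm₂, hU _ (by positivity) (by exact_mod_cast i.2), h₁.size, ← hB, ← hC, hm₁,
      run_table (a := vB) _ rfl, run_table (a := vC) _ rfl]
  have hcb : 0 < c - b := by omega
  have hlift : ∀ {N : ℕ} (i : ℤ), 0 ≤ i → i < N → ∃ i' : Fin N, i = (i' : ℕ) := fun i h0 h1 =>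
    ⟨⟨i.toNat, by omega⟩, by simp [h0]⟩
  -- Rounding the capacity down loses nothing, as cluster sizes are integers.
  have hcap : ∀ (i : Fin k) (z : ℤ), z ≤ m₂ tU (i : ℕ) 0 ↔
      (c - b) * z ≤ c * (cluster P i).card := fun i z => by
    rw [hU', Int.le_ediv_iff_mul_le hcb, mul_comm]
  have hsize : ∀ i : Fin k, ((cluster P i).card : ℤ) ≤ m₂ tU (i : ℕ) 0 := fun i => by
    rw [hcap]
    exact mul_le_mul_of_nonneg_right (by omega) (by positivity)
  obtain ⟨h3, h4, h5⟩ := run_assignProg h₂.n_eq (by positivity) h₂.k_eq (by positivity)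
    (fun p i hp0 hp1 hi0 hi1 => by
      obtain ⟨p, rfl⟩ := hlift p hp0 hp1
      obtain ⟨i, rfl⟩ := hlift i hi0 hi1
      rw [hW']; positivity)
    (fun i hi0 hi1 => by
      obtain ⟨i, rfl⟩ := hlift i hi0 hi1
      exact le_trans (by positivity) (hsize i))
    (by
      rw [sum_Ico_fin]
      refine le_trans (le_of_eq ?_) (sum_le_sum fun i _ => hsize i)
      have := card_eq_sum_card_fiberwise (f := P) (s := univ) (t := univ) fun _ _ => mem_univ _
      rw [card_univ, Fintype.card_fin] at this
      exact_mod_cast this)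
  obtain ⟨Q, hQ⟩ := exists_holds h3
  refine ⟨Q, ⟨fun i j => m₁ tC (i : ℕ) (j : ℕ), fun i j hne => ?_, fun i => ?_, fun S hS => ?_⟩, hQ⟩
  · have := h.isCenter hdvd (hb.trans_eq hB.symm) i j hne
    rwa [hB, hC] at this
  · rw [← hcap, ← countEq_eq_card (lab := col _ tQ) fun p => hQ p]
    exact h4 _ (by positivity) (by exact_mod_cast i.2)
  · set S' : ℤ → ℤ := fun z => table (d := 1) (fun p _ => ((S p : ℕ) : ℤ)) z 0 with hS'
    have hS'' : ∀ p : Fin n, S' (p : ℕ) = (S p : ℕ) := fun p =>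
      table_apply (d := 1) (fun p _ => ((S p : ℕ) : ℤ)) p 0
    have key := h5 S' (fun p hp0 hp1 => by
      obtain ⟨p, rfl⟩ := hlift p hp0 hp1
      rw [hS'']
      exact ⟨by positivity, by exact_mod_cast (S p).2⟩)
      (fun i hi0 hi1 => by
        obtain ⟨i, rfl⟩ := hlift i hi0 hi1
        rw [countEq_eq_card hS'', hcap]
        exact hS i)
    rw [sum_Ico_fin, sum_Ico_fin] at key
    simp only [hS'', hQ _, hW'] at key
    exact key

/-- The memory holds the clustering `Q` as output, and its cost. -/
def Kept (X : Fin n → Fin d → ℤ) (Q : Fin n → Fin k) (m : Mem) : Prop :=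
  Holds tOut Q m ∧ m tOpt 0 0 = intCost X Q

theorem Kept.congr {Q : Fin n → Fin k} {m m' : Mem} (h : Kept X Q m) (h₁ : m' tOut = m tOut)
    (h₂ : m' tOpt = m tOpt) : Kept X Q m' :=
  ⟨fun p => by rw [h₁, h.1], by rw [h₂, h.2]⟩

theorem Loaded.run_candidateProg {m : Mem} (h : Loaded X P m)
    (hdvd : ∀ p j, (n.factorial : ℤ) ∣ X p j) {b c : ℤ} (hB : m vB 0 0 = b) (hC : m vC 0 0 + 1 = c)
    (hb : 0 ≤ b) (hbc : 2 * b < c) {Q : Fin n → Fin k} (hQ : Kept X Q m) :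
    ∃ Q₁ : Fin n → Fin k, Kept X Q₁ (candidateProg.run m) ∧ intCost X Q₁ ≤ intCost X Q ∧
      ∃ Q', IsAssignment X P b c Q' ∧ intCost X Q₁ ≤ intCost X Q' := by
  obtain ⟨Q', hQ', hH⟩ := h.exists_isAssignment hdvd hB hC hb hbc
  set m₃ := assignProg.run (weightProg.run (centerProg.run m)) with hm₃
  have e₃ : ∀ a, (centerProg ;; weightProg ;; assignProg).writes a = false → m₃ a = m a :=
    fun a ha => run_table _ ha m
  have h₃ : Loaded X P m₃ := h.congr fun b hb => e₃ b (by
    simp only [List.mem_cons, List.not_mem_nil, or_false] at hb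
    rcases hb with rfl | rfl | rfl | rfl <;> rfl)
  set m₄ := costProg.run m₃ with hm₄
  have h₄ : Loaded X P m₄ := h₃.congr fun b hb => run_table _ (by
    simp only [List.mem_cons, List.not_mem_nil, or_false] at hb
    rcases hb with rfl | rfl | rfl | rfl <;> rfl) _
  have hH₄ : Holds tQ Q' m₄ := fun p => by rw [hm₄, run_table _ rfl, hH]
  have hcost : m₄ tCost 0 0 = intCost X Q' := h₃.run_costProg hH
  have hQ₄ : Kept X Q m₄ := hQ.congr (by rw [hm₄, run_table _ rfl, e₃ _ rfl])
    (by rw [hm₄, run_table _ rfl, e₃ _ rfl])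
  have hrun : candidateProg.run m =
      (guard (.lt (.scalar tCost) (.scalar tOpt)) keepProg).run m₄ := rfl
  have he : 0 < (Expr.lt (.scalar tCost) (.scalar tOpt)).eval m₄ ↔
      intCost X Q' < intCost X Q := by
    simp [Expr.eval, hcost, hQ₄.2]
  by_cases hlt : intCost X Q' < intCost X Q
  · obtain ⟨h5, h6⟩ := h₄.run_keepProg hH₄
    rw [hrun, run_guard_pos (he.2 hlt)]
    exact ⟨Q', ⟨h6, h5.trans hcost⟩, hlt.le, Q', hQ', le_rfl⟩
  · rw [hrun, run_guard_neg (hlt ∘ he.1)]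
    exact ⟨Q, hQ₄, le_rfl, Q', hQ', not_lt.1 hlt⟩

/-- The clustering `Q` is at least as good as the candidates for the error rates in `R`. -/
def Beats (X : Fin n → Fin d → ℤ) (P : Fin n → Fin k) (R : ℤ → ℤ → Prop) (Q : Fin n → Fin k) : Prop :=
  ∀ b c : ℤ, 0 ≤ b → 2 * b < c → c ≤ n → R b c →
    ∃ Q', IsAssignment X P b c Q' ∧ intCost X Q ≤ intCost X Q'

theorem Loaded.run_searchLoop {m : Mem} (h : Loaded X P m)
    (hdvd : ∀ p j, (n.factorial : ℤ) ∣ X p j) {Q : Fin n → Fin k} (hQ : Kept X Q m) :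
    ∃ Q : Fin n → Fin k, Kept X Q ((FProg.rep vB 0 (.rep vC 0 (guard
        (.lt (.mul (.const 2) (.scalar vB)) (.add (.scalar vC) (.const 1))) candidateProg))).run m) ∧
      ∀ b c : ℤ, 0 ≤ b → 2 * b < c → c ≤ n →
        ∃ Q', IsAssignment X P b c Q' ∧ intCost X Q ≤ intCost X Q' := by
  set body := guard (.lt (.mul (.const 2) (.scalar vB)) (.add (.scalar vC) (.const 1)))
    candidateProg with hbody
  -- The vacuous restriction 0 ≤ b is the outer invariant r ≤ b at r = 0. At the start, r = n, it
  -- excludes every pair, since 2b < c ≤ n forces b < n.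
  suffices hs : ∃ Q : Fin n → Fin k, Kept X Q ((FProg.rep vB 0 (.rep vC 0 body)).run m) ∧
      Beats X P (fun b _ => 0 ≤ b) Q by
    obtain ⟨Q, h1, h2⟩ := hs
    exact ⟨Q, h1, fun b c h3 h4 h5 => h2 b c h3 h4 h5 h3⟩
  refine rep_rule (fun r m' => ∃ Q : Fin n → Fin k, Kept X Q m' ∧ Beats X P (fun b _ => r ≤ b) Q) h.n_eq
    (by positivity) ?_ ?_
  · exact ⟨Q, hQ.congr (Mem.write_table (by decide) _ _ _ _) (Mem.write_table (by decide) _ _ _ _),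
      fun b c h1 h2 h3 h4 => by omega⟩
  · rintro r m₁ hr0 hr1 hf₁ ⟨Q₁, hQ₁, hB₁⟩
    have f0 : (m₁.write vB 0 0 r) 0 = m 0 := by
      rw [Mem.write_table (by decide), hf₁ 0 rfl]
    -- In the unfinished row b = r, the inner counter r' stands for the denominator c = r' + 1.
    have : ∃ Q : Fin n → Fin k, Kept X Q ((FProg.rep vC 0 body).run (m₁.write vB 0 0 r)) ∧
        Beats X P (fun b c => r ≤ b ∧ (b = r → 0 + 1 ≤ c)) Q := by
      refine rep_rule (fun r' m' => ∃ Q : Fin n → Fin k, Kept X Q m' ∧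
        Beats X P (fun b c => r ≤ b ∧ (b = r → r' + 1 ≤ c)) Q)
        ((congrFun (congrFun f0 0) 0).trans h.n_eq) (by positivity) ?_ ?_
      · refine ⟨Q₁, hQ₁.congr ?_ ?_, fun b c h1 h2 h3 h4 => hB₁ b c h1 h2 h3 ?_⟩
        · rw [Mem.write_table (by decide), Mem.write_table (by decide)]
        · rw [Mem.write_table (by decide), Mem.write_table (by decide)]
        · omega
      · rintro r' m₂ hr'0 hr'1 hf₂ ⟨Q₂, hQ₂, hB₂⟩
        set m₃ := m₂.write vC 0 0 r' with hm₃
        have hQ₃ : Kept X Q₂ m₃ := hQ₂.congr (Mem.write_table (by decide) _ _ _ _)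
          (Mem.write_table (by decide) _ _ _ _)
        have hB : m₃ vB 0 0 = r := by
          rw [hm₃, Mem.write_table (by decide), hf₂ vB rfl, Mem.write_apply]; simp
        have hC : m₃ vC 0 0 = r' := by rw [hm₃, Mem.write_apply]; simp
        have h₃ : Loaded X P m₃ := h.congr fun b hb => by
          simp only [List.mem_cons, List.not_mem_nil, or_false] at hb
          rcases hb with rfl | rfl | rfl | rfl <;>
            rw [hm₃, Mem.write_table (by decide), hf₂ _ rfl, Mem.write_table (by decide), hf₁ _ rfl]
        have he : 0 < (Expr.lt (.mul (.const 2) (.scalar vB))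
            (.add (.scalar vC) (.const 1))).eval m₃ ↔ 2 * r < r' + 1 := by
          simp only [Expr.eval, hB, hC]; omega
        by_cases hlt : 2 * r < r' + 1
        · obtain ⟨Q₃, h1, h2, Q', h3, h4⟩ := h₃.run_candidateProg hdvd hB
            (congrArg (· + 1) hC) hr0 hlt hQ₃
          refine ⟨Q₃, by rwa [hbody, run_guard_pos (he.2 hlt)], fun b c hb0 hbc hcn hR => ?_⟩
          by_cases hbc' : b = r ∧ c = r' + 1
          · rw [hbc'.1, hbc'.2]
            exact ⟨Q', h3, h4⟩
          · obtain ⟨Q'', h5, h6⟩ := hB₂ b c hb0 hbc hcn ⟨hR.1, fun h => by have := hR.2 h; omega⟩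
            exact ⟨Q'', h5, h2.trans h6⟩
        · refine ⟨Q₂, by rwa [hbody, run_guard_neg (hlt ∘ he.1)], fun b c hb0 hbc hcn hR => ?_⟩
          exact hB₂ b c hb0 hbc hcn ⟨hR.1, fun h => by have := hR.2 h; omega⟩
    obtain ⟨Q₂, h1, h2⟩ := this
    exact ⟨Q₂, h1, fun b c h3 h4 h5 h6 => h2 b c h3 h4 h5 ⟨h6, fun _ => by omega⟩⟩

end MinSum

/-! ### The whole program and its running time -/

namespace MinSum

open LogRAM LogRAM.FProg

variable {n d k : ℕ}

theorem run_mainProg {m : Mem} (hn : m 0 0 0 = n) (hd : m 0 0 1 = d) (hk : m 0 0 2 = k)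
    {P : Fin n → Fin k} (hP : Holds 3 P m)
    (hden : ∀ (p : Fin n) (j : Fin d), 0 < m 2 (p : ℕ) (j : ℕ)) :
    ∃ (D : ℤ) (X : Fin n → Fin d → ℤ) (Q : Fin n → Fin k), 0 < D ∧
      (∀ p j, X p j * m 2 (p : ℕ) (j : ℕ) = D * m 1 (p : ℕ) (j : ℕ)) ∧
      (∀ p j, (n.factorial : ℤ) ∣ X p j) ∧ Holds tOut Q (mainProg.run m) ∧
      ∀ b c : ℤ, 0 ≤ b → 2 * b < c → c ≤ n →
        ∃ Q', IsAssignment X P b c Q' ∧ intCost X Q ≤ intCost X Q' := by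
  obtain ⟨D, hD, hX⟩ := run_scaleProg hn (by positivity) hd (by positivity)
    fun p j hp0 hp1 hj0 hj1 => by
      have := hden ⟨p.toNat, by omega⟩ ⟨j.toNat, by omega⟩
      simpa [hp0, hj0] using this
  set m₁ := scaleProg.run m with hm₁
  have hX' : ∀ (p : Fin n) (j : Fin d), _ := fun p j => hX (p : ℕ) (j : ℕ) (by positivity)
    (by exact_mod_cast p.2) (by positivity) (by exact_mod_cast j.2)
  rw [natCast_factorial] at hX'
  set X : Fin n → Fin d → ℤ := fun p j => m₁ tX (p : ℕ) (j : ℕ) with hXdef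
  set m₂ := countProg.run m₁ with hm₂
  set m₃ := initProg.run m₂ with hm₃
  set m₄ := costProg.run m₃ with hm₄
  set m₅ := keepProg.run m₄ with hm₅
  have e₁ : ∀ b, scaleProg.writes b = false → m₁ b = m b := fun b hb => run_table _ hb _
  have hL₂ : Loaded X P m₂ := by
    refine ⟨?_, ?_, ?_, fun p => ?_, fun p j => ?_, fun i => ?_⟩
    · rw [hm₂, run_table _ rfl, e₁ _ rfl, hn]
    · rw [hm₂, run_table _ rfl, e₁ _ rfl, hd]
    · rw [hm₂, run_table _ rfl, e₁ _ rfl, hk]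
    · rw [hm₂, run_table _ rfl, e₁ _ rfl, hP]
    · rw [hm₂, run_table _ rfl]
    · rw [hm₂, run_countProg (n := n) (k := k) (by rw [e₁ _ rfl, hn]) (by positivity)
        (by rw [e₁ _ rfl, hk]) (by positivity) _ (by positivity) (by exact_mod_cast i.2)]
      exact countEq_eq_card (fun p => by rw [col, e₁ _ rfl, hP]) i
  have hc : ∀ {c : FProg} {m : Mem}, Loaded X P m →
      (∀ b ∈ [0, 3, tX, tM], c.writes b = false) → Loaded X P (c.run m) := fun h hw =>
    h.congr fun b hb => run_table _ (hw b hb) _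
  have hL₃ : Loaded X P m₃ := hc hL₂ (by decide)
  have hL₄ : Loaded X P m₄ := hc hL₃ (by decide)
  have hL₅ : Loaded X P m₅ := hc hL₄ (by decide)
  have hP₃ : Holds tQ P m₃ := fun p => by
    rw [hm₃, run_initProg hL₂.n_eq (by positivity) _ (by positivity) (by exact_mod_cast p.2),
      hL₂.label]
  have hP₄ : Holds tQ P m₄ := fun p => by rw [hm₄, run_table _ rfl, hP₃]
  obtain ⟨h1, h2⟩ := hL₄.run_keepProg hP₄
  -- The given labels are the first record, so the output is a clustering whatever the candidates
  -- are.
  have hK : Kept X P m₅ := ⟨h2, by rw [hm₅, h1, hm₄, hL₃.run_costProg hP₃]⟩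
  obtain ⟨Q, hQ, hQ'⟩ := hL₅.run_searchLoop (fun p j => (hX' p j).2) hK
  exact ⟨D, X, Q, hD, fun p j => (hX' p j).1, fun p j => (hX' p j).2, hQ.1, hQ'⟩

theorem table_induct {f : Fin n → Fin d → ℤ} {R : ℤ → Prop} (h0 : R 0) (h : ∀ p j, R (f p j))
    (r s : ℤ) : R (table f r s) := by
  unfold table
  split_ifs
  exacts [h _ _, h0]

theorem bitLen_le_inputSize (x : Fin n → Fin d → ℚ) (p : Fin n) (j : Fin d) :
    bitLen (x p j).num + bitLen ((x p j).den : ℤ) ≤ inputSize k x := by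
  have h1 := single_le_sum (f := fun j => bitLen (x p j).num + bitLen ((x p j).den : ℤ))
    (fun _ _ => Nat.zero_le _) (mem_univ j)
  have h2 := single_le_sum (f := fun p => ∑ j, (bitLen (x p j).num + bitLen ((x p j).den : ℤ)))
    (fun _ _ => Nat.zero_le _) (mem_univ p)
  rw [inputSize]
  exact le_add_left (h1.trans h2)

theorem inputMem_bounds (x : Fin n → Fin d → ℚ) (P : Fin n → Fin k) (r s : ℤ) :
    0 ≤ inputMem x P 0 r s ∧ inputMem x P 0 r s ≤ inputSize k x := by
  rw [inputMem]
  refine table_induct (R := fun z => 0 ≤ z ∧ z ≤ inputSize k x) ⟨le_rfl, by positivity⟩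
    (fun _ j => ?_) r s
  have : n ≤ inputSize k x ∧ d ≤ inputSize k x ∧ k ≤ inputSize k x := by
    unfold inputSize; omega
  fin_cases j <;> simp [this]

theorem bitLen_inputMem (x : Fin n → Fin d → ℚ) (P : Fin n → Fin k) (a : ℕ) (r s : ℤ) :
    bitLen (inputMem x P a r s) ≤ inputSize k x + 2 := by
  have h0 : bitLen 0 ≤ inputSize k x + 2 := by simp [bitLen]
  match a with
  | 0 =>
    have := inputMem_bounds x P r s
    exact (bitLen_le_self_add this.1 this.2).trans (by omega)
  | 1 =>
    rw [inputMem]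
    refine table_induct (R := fun z => bitLen z ≤ inputSize k x + 2) h0 (fun p j => ?_) r s
    have := bitLen_le_inputSize (k := k) x p j
    omega
  | 2 =>
    rw [inputMem]
    refine table_induct (R := fun z => bitLen z ≤ inputSize k x + 2) h0 (fun p j => ?_) r s
    have := bitLen_le_inputSize (k := k) x p j
    omega
  | 3 =>
    rw [inputMem]
    refine table_induct (R := fun z => bitLen z ≤ inputSize k x + 2) h0 (fun p _ => ?_) r s
    have h1 : bitLen ((P p : ℕ) : ℤ) ≤ k + 1 :=
      bitLen_le_self_add (by positivity) (by exact_mod_cast (P p).2.le)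
    have h2 : k ≤ inputSize k x := by unfold inputSize; omega
    omega
  | a + 4 => exact h0

/-- `runs_compile` with three levels: the instance size bounds each of n, d and k, hence every loop,
and up to the constant 2 it bounds the bit lengths in the initial memory. -/
theorem runs_mainProg (x : Fin n → Fin d → ℚ) (P : Fin n → Fin k) :
    ∃ t, Runs mainProg.compile (inputMem x P) (mainProg.run (inputMem x P)) t ∧
      t ≤ (mainProg.weightPoly * ((Polynomial.X + Polynomial.C 2) *
        (1 + mainProg.weightPoly) ^ 2)).eval (inputSize k x) := by
  set S := inputSize k x with hS
  have hB : Bounded tableLevel (S + 2) (mainProg.weight S) 0 (inputMem x P) := fun a i j => by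
    refine (bitLen_inputMem x P a i j).trans ?_
    cases tableLevel a with
    | zero => exact le_rfl
    | succ l =>
      simp only [levelBound, add_zero, mul_one]
      exact Nat.le_mul_of_pos_right _ (pow_pos (by omega) _)
  obtain ⟨-, -, t, h1, h2⟩ := runs_compile (lev := tableLevel) (L := 2) (B := S + 2)
    (N := mainProg.weight S) (M := S) tableLevel_le (by omega) (inputMem x P 0)
    (fun s => (inputMem_bounds x P 0 s).2)
    ((bitLen_le_self_add (by positivity) le_rfl).trans (by omega))
    (fun s => (inputMem_bounds x P 0 s).1) mainProg leveled_mainProg (inputMem x P) rfl 0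
    (by omega) hB
  refine ⟨t, h1, h2.trans (le_of_eq ?_)⟩
  simp [eval_weightPoly]

end MinSum

theorem mainTheorem6 :
    ∃ (A : LogRAM.Prog) (T : Polynomial ℕ),
      ∀ (n d k : ℕ) (x : Fin n → Fin d → ℚ) (P : Fin n → Fin k),
        ∃ (m : LogRAM.Mem) (t : ℕ) (Q : Fin n → Fin k),
          LogRAM.Runs A (MinSum.inputMem x P) m t ∧
          t ≤ T.eval (MinSum.inputSize k x) ∧
          MinSum.IsOutput m Q ∧
          ∀ α : ℝ, 0 ≤ α → α < 1 / 2 →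
            MinSum.IsLabelPredictor (MinSum.toPoints x) P α →
              (α < 1 / 7 →
                MinSum.cost (MinSum.toPoints x) Q ≤
                  (1 + 7.7 * α) / (1 - α) ^ 2 * MinSum.opt k (MinSum.toPoints x)) ∧
              MinSum.cost (MinSum.toPoints x) Q ≤
                (1 + (5 - 2 * α) / ((1 - 2 * α) * (1 - α)) * α) / (1 - α) ^ 2 *
                  MinSum.opt k (MinSum.toPoints x) := by
  refine ⟨LogRAM.FProg.mainProg.compile,
    LogRAM.FProg.mainProg.weightPoly * ((Polynomial.X + Polynomial.C 2) *
      (1 + LogRAM.FProg.mainProg.weightPoly) ^ 2), fun n d k x P => ?_⟩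
  obtain ⟨t, h1, h2⟩ := MinSum.runs_mainProg x P
  have h1' : ∀ (p : Fin n) (j : Fin d), MinSum.inputMem x P 1 (p : ℕ) (j : ℕ) = (x p j).num :=
    MinSum.table_apply fun p j => (x p j).num
  have h2' : ∀ (p : Fin n) (j : Fin d), MinSum.inputMem x P 2 (p : ℕ) (j : ℕ) = (x p j).den :=
    MinSum.table_apply fun p j => ((x p j).den : ℤ)
  have hpar : ∀ s : Fin 3, MinSum.inputMem x P 0 0 (s : ℕ) = ![(n : ℤ), d, k] s := fun s =>
    MinSum.table_apply (n := 1) (d := 3) (fun _ => ![(n : ℤ), (d : ℤ), (k : ℤ)]) 0 s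
  obtain ⟨D, X, Q, hD, hX, hdvd, hQ, hbest⟩ := MinSum.run_mainProg (m := MinSum.inputMem x P)
    (hpar 0) (hpar 1) (hpar 2) (P := P) (fun p => MinSum.table_apply (d := 1) (fun p _ => ((P p : ℕ) : ℤ)) p 0)
    (fun p j => by rw [h2']; exact_mod_cast (x p j).den_pos)
  refine ⟨_, t, Q, h1, h2, hQ, fun α h0 hα hP => MinSum.guarantee hD (fun p j => ?_) hdvd hbest h0 hα hP⟩
  have := hX p j
  rw [h1', h2'] at this
  have hne : ((x p j).den : ℚ) ≠ 0 := by exact_mod_cast (x p j).den_ne_zero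
  have hxd : x p j * (x p j).den = (x p j).num := Rat.mul_den_eq_num _
  -- Multiplication by the denominator reduces the scaling relation to the integer identity for
  -- numerators provided by `run_mainProg`.
  apply mul_right_cancel₀ hne
  rw [mul_assoc, hxd]
  exact_mod_cast this
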